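/- Let $\Omega$ be a separable metric space with Borel $\sigma$-field $\mathcal F$, and let $\mathbb F=(\mathcal F_t)_{t\ge 0}$ be a filtration of sub-$\sigma$-fields of $\mathcal F$ such that each $\mathcal F_t$ is countably generated. Put $\mathcal F_{t+}=\bigcap_{u>t}\mathcal F_u$ and $\mathbb F_+=(\mathcal F_{t+})_{t\ge0}$. Let $\mathfrak P(\Omega)$ be the set of probability measures on $(\Omega,\mathcal F)$ with the topology of weak convergence, let $\mathfrak P\subseteq\mathfrak P(\Omega)$ be a Borel set, and let $\widehat{\mathbb F}=(\widehat{\mathcal F}_t)_{t\ge0}$ be the filtration $\widehat{\mathcal F}_t=\mathcal B(\mathfrak P)\otimes\mathcal F_t$ on $\mathfrak P\times\Omega$, with $\widehat{\mathcal F}_{t+}=\bigcap_{u>t}\widehat{\mathcal F}_u$ and $\widehat{\mathbb F}_+=(\widehat{\mathcal F}_{t+})_{t\ge0}$. For $P\in\mathfrak P$, let $\mathbb F_+^P$ be the usual augmentation of $\mathbb F$, that is, $\mathcal F^P_{t+}$ is generated by $\mathcal F_{t+}$ and the $P$-null sets of $(\Omega,\mathcal F)$. A process is $\mathbb F_+^P$-predictable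 if it is measurable with respect to the $\sigma$-field on $\Omega\times\mathbb R_+$ generated by the processes $H$ that are left-continuous on $(0,\infty)$ and such that $H_t$ is $\bigvee_{s<t}\mathcal F^P_{s+}$-measurable for every $t>0$, while $H_0$ is measurable with respect to the $\sigma$-field generated by the $P$-null sets of $(\Omega,\mathcal F)$. A real-valued process is right-continuous if all its paths are right-continuous, and it has $P$-integrable variation if the total variation of its paths over $[0,\infty)$ (not counting the initial value) has finite $P$-expectation. Let $S:\mathfrak P\times\Omega\times\mathbb R_+\to\mathbb R$, $(P,\omega,t)\mapsto S^P_t(\omega)$, be a right-continuous, $\widehat{\mathbb F}_+$-adapted process such that for every $P\in\mathfrak P$, $S^P$ is an $\mathbb F_+$-adapted process of $P$-integrable variation. Then there exists a function $A:\mathfrak P\times\Omega\times\mathbb R_+\to\mathbb R$, $(P,\omega,t)\mapsto A^P_t(\omega)$, measurable with respect to $\mathcal B(\mathfrak P)\otimes\mathcal F\otimes\mathcal B(\mathbb R_+)$, such that for every $P\in\mathfrak P$, $$S^P-S^P_0-A^P\quad\text{is a martingale with respect to } P \text{ and } \mathbb F^P_+,$$ and $A^P$ is right-continuous, $\mathbb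 F_+$-adapted, $\mathbb F^P_+$-predictable and $P$-a.s. of (locally) finite variation. -/

import Mathlib

open MeasureTheory
open scoped NNReal ENNReal

noncomputable section

namespace MeasurableCompensator

/-- A right-continuous path on `ℝ_+`: right-continuity holds at every time. -/
def IsRightContinuousPath (f : ℝ≥0 → ℝ) : Prop :=
  ∀ t : ℝ≥0, ContinuousWithinAt f (Set.Ici t) t

/-- The product filtration `F̂_t = B(𝔓) ⊗ F_t` on `𝔓 × Ω`, where the parameter space `E`
(in the application a set of probability measures with its topology of weak convergence) carries
its Borel σ-field. -/
def hatFiltration (E : Type*) [TopologicalSpace E] {Ω : Type*} {mΩ : MeasurableSpace Ω}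
    (F : Filtration ℝ≥0 mΩ) : Filtration ℝ≥0 (MeasurableSpace.prod (borel E) mΩ) where
  seq t := MeasurableSpace.prod (borel E) (F t)
  mono' _ _ hst := sup_le_sup_left (MeasurableSpace.comap_mono (F.mono hst)) _
  le' t := sup_le_sup_left (MeasurableSpace.comap_mono (F.le t)) _

/-- The σ-field generated by the `P`-null sets of `(Ω, F)`. -/
abbrev nullSigma {Ω : Type*} {mΩ : MeasurableSpace Ω} (P : Measure Ω) : MeasurableSpace Ω :=
  MeasurableSpace.generateFrom {N : Set Ω | MeasurableSet N ∧ P N = 0}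

theorem nullSigma_le {Ω : Type*} {mΩ : MeasurableSpace Ω} (P : Measure Ω) :
    nullSigma P ≤ mΩ :=
  MeasurableSpace.generateFrom_le fun _ h => h.1

/-- The usual augmentation `F_+^P`: the `P`-null sets of `(Ω, F)` are adjoined to `F_{t+}`
for every `t`. -/
def usualAugmentation {Ω : Type*} {mΩ : MeasurableSpace Ω} (F : Filtration ℝ≥0 mΩ)
    (P : Measure Ω) : Filtration ℝ≥0 mΩ :=
  F.rightCont ⊔ Filtration.const ℝ≥0 (nullSigma P) (nullSigma_le P)

/-- The left-continuous version `(G_{t-})` of a filtration `G`, with a prescribed σ-field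
`G_{0-}` at time zero. -/
abbrev leftLimit {Ω : Type*} {mΩ : MeasurableSpace Ω} (G0 : MeasurableSpace Ω)
    (G : Filtration ℝ≥0 mΩ) (t : ℝ≥0) : MeasurableSpace Ω :=
  if t = 0 then G0 else ⨆ (s : ℝ≥0) (_ : s < t), G s

/-- The predictable σ-field on `Ω × ℝ_+`, generated by the `(G_{t-})`-adapted real processes
all of whose paths are left-continuous on `(0, ∞)`. -/
abbrev predictableSigma {Ω : Type*} {mΩ : MeasurableSpace Ω} (G0 : MeasurableSpace Ω)
    (G : Filtration ℝ≥0 mΩ) : MeasurableSpace (Ω × ℝ≥0) :=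
  ⨆ (H : Ω → ℝ≥0 → ℝ)
    (_ : (∀ t : ℝ≥0, Measurable[leftLimit G0 G t] fun ω => H ω t) ∧
      ∀ (ω : Ω) (t : ℝ≥0), 0 < t → ContinuousWithinAt (H ω) (Set.Iic t) t),
    MeasurableSpace.comap (fun x : Ω × ℝ≥0 => H x.1 x.2) (inferInstance : MeasurableSpace ℝ)

/-- `F_+^P`-predictability. The σ-field `F_{0-}` is trivial, so that after augmentation the
σ-field at time `0-` is generated by the `P`-null sets. -/
def IsAugPredictable {Ω : Type*} {mΩ : MeasurableSpace Ω} (F : Filtration ℝ≥0 mΩ)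
    (P : Measure Ω) (X : Ω → ℝ≥0 → ℝ) : Prop :=
  Measurable[predictableSigma (nullSigma P) (usualAugmentation F P)]
    fun x : Ω × ℝ≥0 => X x.1 x.2

/-- `P`-integrable variation: the total variation over `[0, ∞)` (not counting the initial value)
has finite expectation. -/
def HasIntegrableVariation {Ω : Type*} {mΩ : MeasurableSpace Ω} (P : Measure Ω)
    (X : Ω → ℝ≥0 → ℝ) : Prop :=
  ∫⁻ ω, eVariationOn (X ω) Set.univ ∂P < ∞

end MeasurableCompensator

end

/-! The classical Doob-Meyer construction is carried out so that every choice depends measurably on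
the law. The tautological map `P ↦ P` is a Markov kernel, and the construction works for any kernel
`κ`. A Jordan decomposition, with the variation computed along dyadic times, reduces `S` to
nondecreasing integrable processes; cutting the range into slices of height one reduces these to
nondecreasing processes `x` with values in `[0, 1]`.

For such an `x`, take the discrete Doob compensators on the grids of mesh `2⁻ⁿ` on `[0, 2ⁿ]`. Their
conditional expectations can be chosen jointly measurable in the law and the state: for a countably
generated σ-field as a Radon-Nikodym derivative of kernels, for `F_{s+}` as a reverse martingale
limit (`exists_measurable_condExp_rightCont`). An energy inequality bounds the terminal values in
`L²`, so convex combinations of their tails converge in `L¹`. Rational weights suffice, and among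
these countably many, near-minimizers of the `L²` norm are selected measurably in the law
(`exists_measurable_convexWeights`). The compensated approximations are conditional expectations of
their terminal values, so convergence passes to every dyadic time, and the right-continuous
regularization of the limit is the compensator.

Predictability is the delicate point. The approximations are left-continuous and adapted, so their
upper limit is predictable, and it lies below the regularized limit. Optional stopping and Fatou's
lemma give equality at each first passage time of a rational level (`ae_limitPath_passageTime`). A
gap at a time `t` would make `t` the passage time of a rational level inside the gap, so the two
processes are indistinguishable. The null sets, available already at time `0-`, absorb the
exceptional paths. -/

namespace MeasurableCompensator

section

open ProbabilityTheory Filter Topology Set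

/-! ### Dyadic times. -/

section Dyadic

/-- The dyadic time `k / 2 ^ n`. -/
noncomputable def dyadic (n k : ℕ) : ℝ≥0 := (k : ℝ≥0) / 2 ^ n

theorem dyadic_zero (n : ℕ) : dyadic n 0 = 0 := by simp [dyadic]

theorem dyadic_lt_dyadic {n j k : ℕ} : dyadic n j < dyadic n k ↔ j < k := by
  unfold dyadic
  rw [div_lt_div_iff_of_pos_right (by positivity)]
  exact Nat.cast_lt

theorem dyadic_le_dyadic {n j k : ℕ} : dyadic n j ≤ dyadic n k ↔ j ≤ k := by
  rw [← not_lt, dyadic_lt_dyadic, not_lt]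

theorem dyadic_mul (n m k : ℕ) : dyadic (n + m) (k * 2 ^ m) = dyadic n k := by
  unfold dyadic
  push_cast
  rw [pow_add]
  field_simp

theorem dyadic_four_pow (n : ℕ) : dyadic n (4 ^ n) = 2 ^ n := by
  unfold dyadic
  push_cast
  rw [div_eq_iff (by positivity), ← mul_pow]
  norm_num

/-- From some level on, a dyadic time is a point of the grid `{k / 2 ^ n | k ≤ 4 ^ n}`. -/
theorem exists_dyadic_eq (n₀ k₀ : ℕ) :
    ∃ N, ∀ n ≥ N, ∃ k ≤ 4 ^ n, dyadic n₀ k₀ = dyadic n k := by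
  -- The summand `k₀` makes the horizon `2 ^ n` large enough: the refined index is `k₀ * 2 ^ m` with
  -- `k₀ ≤ m < 2 ^ m`.
  refine ⟨n₀ + k₀, fun n hn => ?_⟩
  obtain ⟨m, rfl⟩ : ∃ m, n = n₀ + m := ⟨n - n₀, by omega⟩
  refine ⟨k₀ * 2 ^ m, ?_, (dyadic_mul _ _ _).symm⟩
  have h1 : k₀ ≤ 2 ^ m := (by omega : k₀ ≤ m).trans m.lt_two_pow_self.le
  calc k₀ * 2 ^ m ≤ 2 ^ m * 2 ^ m := by gcongr
    _ = 4 ^ m := by rw [← mul_pow]; norm_num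
    _ ≤ 4 ^ (n₀ + m) := Nat.pow_le_pow_right (by norm_num) (by omega)

/-- The index of the first dyadic time of level `n` strictly after `t`. -/
noncomputable def nextIndex (n : ℕ) (t : ℝ≥0) : ℕ := ⌊t * 2 ^ n⌋₊ + 1

theorem lt_dyadic_nextIndex (n : ℕ) (t : ℝ≥0) : t < dyadic n (nextIndex n t) := by
  unfold dyadic nextIndex
  rw [lt_div_iff₀ (by positivity)]
  exact_mod_cast Nat.lt_floor_add_one _

theorem dyadic_nextIndex_le (n : ℕ) (t : ℝ≥0) :
    dyadic n (nextIndex n t) ≤ t + (1 / 2) ^ n := by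
  unfold dyadic nextIndex
  rw [div_le_iff₀ (by positivity), add_mul, ← mul_pow]
  push_cast
  have : (⌊t * 2 ^ n⌋₊ : ℝ≥0) ≤ t * 2 ^ n := Nat.floor_le (by positivity)
  simpa using this

theorem monotone_nextIndex (n : ℕ) : Monotone (nextIndex n) := fun s t h => by
  unfold nextIndex
  gcongr

theorem tendsto_dyadic_nextIndex (t : ℝ≥0) :
    Tendsto (fun n => dyadic n (nextIndex n t)) atTop (𝓝[>] t) := by
  refine tendsto_nhdsWithin_iff.2 ⟨?_, .of_forall fun n => lt_dyadic_nextIndex n t⟩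
  refine tendsto_of_tendsto_of_tendsto_of_le_of_le tendsto_const_nhds ?_
    (fun n => (lt_dyadic_nextIndex n t).le) (fun n => dyadic_nextIndex_le n t)
  have : Tendsto (fun n : ℕ => t + (1 / 2 : ℝ≥0) ^ n) atTop (𝓝 (t + 0)) :=
    tendsto_const_nhds.add
      (NNReal.tendsto_pow_atTop_nhds_zero_of_lt_one (NNReal.half_lt_self one_ne_zero))
  simpa using this

theorem exists_dyadic_between {s t : ℝ≥0} (h : s < t) :
    ∃ n k, s < dyadic n k ∧ dyadic n k < t := by
  have h2 : ∀ᶠ n in atTop, dyadic n (nextIndex n s) < t :=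
    ((tendsto_dyadic_nextIndex s).mono_right nhdsWithin_le_nhds).eventually (Iio_mem_nhds h)
  obtain ⟨n, hn⟩ := h2.exists
  exact ⟨n, _, lt_dyadic_nextIndex n s, hn⟩

end Dyadic

/-! ### Joint measurability and right-continuous filtrations. -/

section RightContinuous

/-- A process with right-continuous paths that is measurable at each time is jointly measurable. -/
theorem measurable_of_rightContinuous {α β : Type*} [MeasurableSpace α] [TopologicalSpace β]
    [TopologicalSpace.PseudoMetrizableSpace β] [MeasurableSpace β] [BorelSpace β]
    {f : α → ℝ≥0 → β} (hf : ∀ t, Measurable fun a => f a t)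
    (hc : ∀ a t, ContinuousWithinAt (f a) (Ici t) t) :
    Measurable fun x : α × ℝ≥0 => f x.1 x.2 := by
  refine measurable_of_tendsto_metrizable
    (f := fun n (x : α × ℝ≥0) => f x.1 (dyadic n (nextIndex n x.2))) (fun n => ?_) ?_
  · have h0 (k : ℕ) : Measurable fun a => f a (dyadic n k) := hf _
    have h1 : Measurable fun y : α × ℕ => f y.1 (dyadic n y.2) :=
      measurable_from_prod_countable_left h0
    have h2 : Measurable fun x : α × ℝ≥0 => (x.1, nextIndex n x.2) :=
      measurable_fst.prodMk (((Nat.measurable_floor.comp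
        (measurable_id.mul_const _)).add_const 1).comp measurable_snd)
    exact h1.comp h2
  · rw [tendsto_pi_nhds]
    rintro ⟨a, t⟩
    exact (hc a t).tendsto.comp
      ((tendsto_dyadic_nextIndex t).mono_right (nhdsWithin_mono _ Ioi_subset_Ici_self))

variable {Ω β : Type*} {mΩ : MeasurableSpace Ω} [MeasurableSpace β] {F : Filtration ℝ≥0 mΩ}

theorem measurable_rightCont_iff {t : ℝ≥0} {f : Ω → β} :
    Measurable[F.rightCont t] f ↔ ∀ u > t, Measurable[F u] f := by
  simp only [measurable_iff_comap_le, Filtration.rightCont_eq, le_iInf_iff]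

theorem rightCont_le {s t : ℝ≥0} (h : s < t) : F.rightCont s ≤ F t := by
  rw [Filtration.rightCont_eq]
  exact iInf₂_le t h

end RightContinuous

/-- By the portmanteau theorem the mass of an open set is lower semicontinuous in the law, and the
open sets form a generating π-system. This makes a set of laws into a kernel. -/
theorem measurable_coe_of_continuous {Ω T : Type*} [MetricSpace Ω] [MeasurableSpace Ω]
    [BorelSpace Ω] [TopologicalSpace T] [MeasurableSpace T] [OpensMeasurableSpace T]
    {f : T → ProbabilityMeasure Ω} (hf : Continuous f) :
    Measurable fun t => (f t : Measure Ω) := by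
  refine Measurable.measure_of_isPiSystem_of_isProbabilityMeasure
    (BorelSpace.measurable_eq (α := Ω)) isPiSystem_isOpen fun G hG => ?_
  refine LowerSemicontinuous.measurable fun t => ?_
  exact lowerSemicontinuousAt_iff_le_liminf.2 <|
    ProbabilityMeasure.le_liminf_measure_open_of_tendsto hf.continuousAt hG

/-! ### Conditional expectations jointly measurable in the law and the state. -/

section ConditionalExpectation

variable {E Ω : Type*} [mE : MeasurableSpace E] [mΩ : MeasurableSpace Ω]

/-- A version of the conditional expectation given a countably generated σ-field that is jointly
measurable in the law and the state. -/
theorem exists_measurable_lintegral_eq {Ω' : Type*} [MeasurableSpace Ω']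
    [MeasurableSpace.CountablyGenerated Ω'] (κ : Kernel E Ω) [IsMarkovKernel κ]
    {f : Ω → Ω'} (hf : Measurable f) {X : E → Ω → ℝ} (hX : Measurable (Function.uncurry X))
    (hX1 : ∀ P ω, X P ω ∈ Icc (0 : ℝ) 1) :
    ∃ Y : E → Ω' → ℝ≥0∞, Measurable (Function.uncurry Y) ∧
      ∀ P, ∀ B : Set Ω', MeasurableSet B →
        ∫⁻ ω in f ⁻¹' B, Y P (f ω) ∂(κ P) = ∫⁻ ω in f ⁻¹' B, ENNReal.ofReal (X P ω) ∂(κ P) := by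
  have hX' : Measurable (Function.uncurry fun P ω => ENNReal.ofReal (X P ω)) := hX.ennreal_ofReal
  have : IsFiniteKernel (κ.withDensity fun P ω => ENNReal.ofReal (X P ω)) :=
    Kernel.isFiniteKernel_withDensity_of_bounded κ ENNReal.one_ne_top
      fun P ω => by simpa using (hX1 P ω).2
  -- Countable generation of the target is what yields a Radon-Nikodym derivative of kernels that is
  -- jointly measurable.
  refine ⟨((κ.withDensity fun P ω => ENNReal.ofReal (X P ω)).map f).rnDeriv (κ.map f),
    Kernel.measurable_rnDeriv _ _, fun P B hB => ?_⟩
  have hac : (κ.withDensity fun P ω => ENNReal.ofReal (X P ω)).map f P ≪ κ.map f P := by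
    rw [Kernel.map_apply _ hf, Kernel.map_apply _ hf]
    exact (Kernel.withDensity_absolutelyContinuous _ P).map hf
  have h := Kernel.setLIntegral_rnDeriv hac hB
  rw [Kernel.map_apply _ hf, Kernel.map_apply _ hf,
    setLIntegral_map hB (Kernel.measurable_rnDeriv_right _ _ _) hf, Measure.map_apply hf hB,
    Kernel.withDensity_apply' κ hX'] at h
  exact h

/-- The smaller σ-field is treated as a second measurable structure on `Ω`, with the identity as the
map into it. Truncation at `1` gives values in `[0, 1]` everywhere and changes the version only on a
null set. -/
theorem exists_measurable_condExp (κ : Kernel E Ω) [IsMarkovKernel κ] {X : E → Ω → ℝ}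
    (hX : Measurable (Function.uncurry X)) (hX1 : ∀ P ω, X P ω ∈ Icc (0 : ℝ) 1)
    {m : MeasurableSpace Ω} (hm : m ≤ mΩ) (hmc : @MeasurableSpace.CountablyGenerated Ω m) :
    ∃ Y : E → Ω → ℝ, Measurable[mE.prod mΩ] (Function.uncurry Y) ∧ (∀ P, Measurable[m] (Y P)) ∧
      (∀ P ω, Y P ω ∈ Icc (0 : ℝ) 1) ∧ ∀ P, Y P =ᵐ[κ P] (κ P)[X P | m] := by
  have hXP : ∀ P, @Measurable _ _ mΩ _ (X P) := fun P => hX.of_uncurry_left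
  obtain ⟨Z, hZ, hZ'⟩ := @exists_measurable_lintegral_eq E Ω mE mΩ Ω m hmc κ _ id
    (measurable_id'' hm) X hX hX1
  have hZP : ∀ P, Measurable[m] (Z P) := fun P =>
    @Measurable.of_uncurry_left E Ω ℝ≥0∞ mE m _ Z hZ P
  have hZm : @Measurable _ _ (@Prod.instMeasurableSpace E Ω mE mΩ) _ (Function.uncurry Z) :=
    hZ.mono (sup_le_sup_left (MeasurableSpace.comap_mono hm) _) le_rfl
  have hmin : Measurable[mE.prod mΩ] (Function.uncurry fun P ω => min 1 (Z P ω).toReal) :=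
    Measurable.min (mδ := mE.prod mΩ) measurable_const
      (@Measurable.ennreal_toReal _ (mE.prod mΩ) _ hZm)
  have hint : ∀ P, Integrable (X P) (κ P) := fun P =>
    Integrable.of_bound (hXP P).aestronglyMeasurable 1
      (.of_forall fun ω => by
        rw [Real.norm_eq_abs, abs_of_nonneg (hX1 P ω).1]; exact (hX1 P ω).2)
  refine ⟨fun P ω => min 1 (Z P ω).toReal, hmin,
    fun P => measurable_const.min (hZP P).ennreal_toReal,
    fun P ω => ⟨le_min zero_le_one ENNReal.toReal_nonneg, min_le_left _ _⟩, fun P => ?_⟩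
  have hfin : ∫⁻ ω, Z P ω ∂(κ P) ≠ ∞ := by
    have := hZ' P univ MeasurableSet.univ
    simp only [preimage_univ, Measure.restrict_univ, id] at this
    rw [this]
    exact (hint P).lintegral_lt_top.ne
  have hZi : Integrable (fun ω => (Z P ω).toReal) (κ P) :=
    integrable_toReal_of_lintegral_ne_top ((hZP P).mono hm le_rfl).aemeasurable hfin
  have key : (fun ω => (Z P ω).toReal) =ᵐ[κ P] (κ P)[X P | m] := by
    refine ae_eq_condExp_of_forall_setIntegral_eq hm (hint P) (fun s _ _ => hZi.integrableOn)
      (fun s hs _ => ?_) (hZP P).ennreal_toReal.stronglyMeasurable.aestronglyMeasurable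
    have h := hZ' P s hs
    simp only [preimage_id, id] at h
    rw [integral_toReal ((hZP P).mono hm le_rfl).aemeasurable, h,
      integral_eq_lintegral_of_nonneg_ae (.of_forall fun ω => (hX1 P ω).1)
      (hXP P).aestronglyMeasurable]
    exact ae_restrict_of_ae ((ae_lt_top ((hZP P).mono hm le_rfl) hfin))
  have hle : (κ P)[X P | m] ≤ᵐ[κ P] fun _ => 1 := by
    have := condExp_mono (m := m) (hint P) (integrable_const (1 : ℝ))
      (.of_forall fun ω => (hX1 P ω).2)
    rwa [condExp_const hm] at this
  filter_upwards [key, hle] with ω h1 h2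
  rw [h1, min_eq_right h2]

end ConditionalExpectation

/-! ### Measurable selection of indices. -/

section Selection

variable {E Ω : Type*} [mE : MeasurableSpace E] [mΩ : MeasurableSpace Ω]

theorem exists_measurable_index {p : E → ℕ → Prop} (hp : ∀ n, MeasurableSet {P | p P n})
    (h : ∀ P, ∃ n, p P n) : ∃ f : E → ℕ, Measurable f ∧ ∀ P, p P (f P) := by
  classical
  exact ⟨fun P => Nat.find (h P), measurable_find h hp, fun P => Nat.find_spec (h P)⟩

theorem measurable_comp_index {β : Type*} [MeasurableSpace β] {Y : ℕ → E → Ω → β}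
    (hY : ∀ n, Measurable (Function.uncurry (Y n))) {N : E → ℕ} (hN : Measurable N) :
    Measurable (Function.uncurry fun P ω => Y (N P) P ω) := by
  have h1 : Measurable fun x : ℕ × (E × Ω) => Function.uncurry (Y x.1) x.2 :=
    measurable_from_prod_countable_right hY
  exact h1.comp ((hN.comp measurable_fst).prodMk measurable_id)

/-- A sequence of jointly measurable functions that is Cauchy in `L¹(P)` for every law `P` has,
measurably in `P`, a rapidly converging subsequence. -/
theorem exists_fast_index (κ : Kernel E Ω) [IsSFiniteKernel κ] {Y : ℕ → E → Ω → ℝ}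
    (hY : ∀ n, Measurable (Function.uncurry (Y n)))
    (hC : ∀ P, ∀ ε : ℝ≥0∞, ε ≠ 0 → ∃ N, ∀ m ≥ N, ∀ n ≥ N, eLpNorm (Y m P - Y n P) 1 (κ P) ≤ ε) :
    ∃ N : ℕ → E → ℕ, (∀ j, Measurable (N j)) ∧ (∀ j P, j ≤ N j P) ∧
      ∀ P J i j, J ≤ i → J ≤ j →
        eLpNorm (Y (N i P) P - Y (N j P) P) 1 (κ P) < 2 * 2⁻¹ ^ J := by
  classical
  -- The Cauchy condition consists of countably many measurable inequalities in `P`, so the least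
  -- admissible index is measurable.
  set p : ℕ → E → ℕ → Prop := fun j P n => j ≤ n ∧ ∀ m ≥ n, ∀ m' ≥ n,
    eLpNorm (Y m P - Y m' P) 1 (κ P) ≤ 2⁻¹ ^ j with hp
  have hpm : ∀ j n, MeasurableSet {P | p j P n} := fun j n => by
    have : {P | p j P n} = {P | j ≤ n} ∩ ⋂ m, ⋂ (_ : m ≥ n), ⋂ m', ⋂ (_ : m' ≥ n),
        {P | eLpNorm (Y m P - Y m' P) 1 (κ P) ≤ 2⁻¹ ^ j} := by
      ext P; simp [hp]
    rw [this]
    refine (MeasurableSet.const _).inter <| .iInter fun m => .iInter fun _ => .iInter fun m' =>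
      .iInter fun _ => measurableSet_le ?_ measurable_const
    simp only [eLpNorm_one_eq_lintegral_enorm, Pi.sub_apply]
    exact Measurable.lintegral_kernel_prod_right ((hY m).sub (hY m')).enorm
  have hpe : ∀ j P, ∃ n, p j P n := fun j P => by
    obtain ⟨N, hN⟩ := hC P (2⁻¹ ^ j) (by simp)
    exact ⟨max j N, le_max_left _ _, fun m hm m' hm' =>
      hN m ((le_max_right _ _).trans hm) m' ((le_max_right _ _).trans hm')⟩
  have hmono : ∀ P i j, i ≤ j → Nat.find (hpe i P) ≤ Nat.find (hpe j P) := fun P i j hij => by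
    obtain ⟨h1, h2⟩ := Nat.find_spec (hpe j P)
    refine Nat.find_min' _ ⟨hij.trans h1, fun m hm m' hm' => (h2 m hm m' hm').trans ?_⟩
    exact pow_le_pow_right_of_le_one' (by simp) hij
  refine ⟨fun j P => Nat.find (hpe j P), fun j => measurable_find _ (hpm j),
    fun j P => (Nat.find_spec (hpe j P)).1, fun P J i j hi hj => ?_⟩
  refine ((Nat.find_spec (hpe J P)).2 _ (hmono P J i hi) _ (hmono P J j hj)).trans_lt ?_
  -- The factor `2` turns the bound `≤ 2⁻¹ ^ J` into the strict one that the `L¹` convergence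
  -- criteria use.
  have h0 : (2⁻¹ : ℝ≥0∞) ^ J ≠ 0 := by simp
  have h1 : (2⁻¹ : ℝ≥0∞) ^ J ≠ ∞ := ENNReal.pow_ne_top (by simp)
  rw [two_mul]
  exact ENNReal.lt_add_right h1 h0

theorem tsum_two_mul_half_pow_ne_top : ∑' J : ℕ, 2 * (2⁻¹ : ℝ≥0∞) ^ J ≠ ∞ := by
  rw [ENNReal.tsum_mul_left, ENNReal.tsum_geometric]
  refine ENNReal.mul_ne_top (by simp) ?_
  simp

end Selection

section Bounded

variable {Ω : Type*} {mΩ : MeasurableSpace Ω} {μ : Measure Ω}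

theorem integrable_of_abs_le [IsFiniteMeasure μ] {f : Ω → ℝ} (hf : Measurable f) {C : ℝ}
    (h : ∀ ω, |f ω| ≤ C) : Integrable f μ :=
  .of_bound hf.aestronglyMeasurable C (.of_forall h)

theorem eLpNorm_one_le_sqrt [IsProbabilityMeasure μ] {f : Ω → ℝ} (hf : Measurable f)
    {C : ℝ} (h : ∀ ω, |f ω| ≤ C) :
    eLpNorm f 1 μ ≤ ENNReal.ofReal (√(∫ ω, f ω ^ 2 ∂μ)) := by
  have hm : MemLp f 2 μ := .of_bound hf.aestronglyMeasurable C (.of_forall h)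
  refine (eLpNorm_le_eLpNorm_of_exponent_le (by norm_num : (1 : ℝ≥0∞) ≤ 2)
    hf.aestronglyMeasurable).trans ?_
  rw [hm.eLpNorm_eq_integral_rpow_norm (by norm_num) (by norm_num)]
  refine ENNReal.ofReal_le_ofReal ?_
  simp [Real.sqrt_eq_rpow]

/-- Pulling out a bounded factor: a version of the conditional expectation tested on bounded
random variables. -/
theorem integral_mul_eq_of_ae_eq_condExp [IsFiniteMeasure μ] {m : MeasurableSpace Ω} (hm : m ≤ mΩ)
    {X Y Z : Ω → ℝ} (hX : Integrable X μ) (hY : Y =ᵐ[μ] μ[X | m]) (hZ : Measurable[m] Z) {C : ℝ}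
    (hC : ∀ ω, |Z ω| ≤ C) : ∫ ω, Z ω * Y ω ∂μ = ∫ ω, Z ω * X ω ∂μ := by
  have hZX : Integrable (Z * X) μ := hX.bdd_mul (hZ.mono hm le_rfl).aestronglyMeasurable
    (.of_forall hC)
  have h := condExp_mul_of_stronglyMeasurable_left hZ.stronglyMeasurable hZX hX
  rw [← integral_condExp hm (f := fun ω => Z ω * X ω)]
  refine integral_congr_ae ?_
  filter_upwards [h, hY] with ω h1 h2
  simp only [Pi.mul_apply] at h1
  rw [h2, ← h1]
  rfl

end Bounded

/-! ### Conditioning on `F_{s+}` by a reverse martingale argument. -/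

section ConditionalExpectation

variable {E Ω : Type*} [mE : MeasurableSpace E] [mΩ : MeasurableSpace Ω]

theorem limsup_mem_Icc {u : ℕ → ℝ} (hu : ∀ n, u n ∈ Icc (0 : ℝ) 1) :
    limsup u atTop ∈ Icc (0 : ℝ) 1 := by
  have hb : IsBoundedUnder (· ≤ ·) atTop u := isBoundedUnder_of ⟨1, fun n => (hu n).2⟩
  have hb' : IsBoundedUnder (· ≥ ·) atTop u := isBoundedUnder_of ⟨0, fun n => (hu n).1⟩
  exact ⟨le_limsup_of_frequently_le (.of_forall fun n => (hu n).1) hb,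
    limsup_le_of_le hb'.isCoboundedUnder_le (.of_forall fun n => (hu n).2)⟩

/-- A jointly measurable version of the conditional expectation given `F_{s+}`. -/
theorem exists_measurable_condExp_rightCont (κ : Kernel E Ω) [IsMarkovKernel κ]
    (F : Filtration ℝ≥0 mΩ) (hF : ∀ t, @MeasurableSpace.CountablyGenerated Ω (F t))
    {X : E → Ω → ℝ} (hX : Measurable (Function.uncurry X))
    (hX1 : ∀ P ω, X P ω ∈ Icc (0 : ℝ) 1) (s : ℝ≥0) :
    ∃ Y : E → Ω → ℝ, Measurable (Function.uncurry Y) ∧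
      (∀ P, Measurable[F.rightCont s] (Y P)) ∧
      (∀ P ω, Y P ω ∈ Icc (0 : ℝ) 1) ∧ ∀ P, Y P =ᵐ[κ P] (κ P)[X P | F.rightCont s] := by
  -- `F_{s+}` need not be countably generated, so the conditional expectations given `F_{u n}` with
  -- `u n ↓ s` are used.
  set u : ℕ → ℝ≥0 := fun n => s + 1 / ((n : ℝ≥0) + 1) with hu
  have hus : ∀ n, s < u n := fun n => lt_add_of_pos_right _ (by positivity)
  have hanti : Antitone u := fun m n h => by
    simp only [hu]; gcongr
  choose Y hY hYm hY1 hYc using fun n =>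
    exists_measurable_condExp κ hX hX1 (F.le (u n)) (hF (u n))
  have hYabs : ∀ n P ω, |Y n P ω| ≤ 1 := fun n P ω => by
    rw [abs_of_nonneg (hY1 n P ω).1]; exact (hY1 n P ω).2
  have hYP : ∀ n P, Measurable (Y n P) := fun n P => (hY n).of_uncurry_left
  have hXi : ∀ P, Integrable (X P) (κ P) := fun P =>
    integrable_of_abs_le hX.of_uncurry_left (C := 1) fun ω => by
      rw [abs_of_nonneg (hX1 P ω).1]; exact (hX1 P ω).2
  have hYi : ∀ n P, Integrable (Y n P) (κ P) := fun n P =>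
    integrable_of_abs_le (hYP n P) (hYabs n P)
  have hYY : ∀ m n P, Integrable (fun ω => Y m P ω * Y n P ω) (κ P) := fun m n P =>
    integrable_of_abs_le ((hYP m P).mul (hYP n P)) (C := 1) fun ω => by
      rw [abs_mul]
      exact mul_le_one₀ (hYabs m P ω) (abs_nonneg _) (hYabs n P ω)
  -- Orthogonality of reverse martingale increments: both sides equal `∫ Y n * X`. Hence squared
  -- `L²` distances are differences of the nonincreasing sequence of squared norms, which is Cauchy.
  have hprod : ∀ P m n, m ≤ n →
      ∫ ω, Y n P ω * Y m P ω ∂(κ P) = ∫ ω, Y n P ω * Y n P ω ∂(κ P) := fun P m n hmn => by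
    have hle : F (u n) ≤ F (u m) := F.mono (hanti hmn)
    rw [integral_mul_eq_of_ae_eq_condExp (F.le (u m)) (hXi P) (hYc m P)
      ((hYm n P).mono hle le_rfl) (hYabs n P),
      integral_mul_eq_of_ae_eq_condExp (F.le (u n)) (hXi P) (hYc n P) (hYm n P) (hYabs n P)]
  have hsq : ∀ P m n, m ≤ n → ∫ ω, (Y m P ω - Y n P ω) ^ 2 ∂(κ P) =
      ∫ ω, Y m P ω * Y m P ω ∂(κ P) - ∫ ω, Y n P ω * Y n P ω ∂(κ P) := fun P m n hmn => by
    have : ∀ ω, (Y m P ω - Y n P ω) ^ 2 =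
        Y m P ω * Y m P ω - 2 * (Y n P ω * Y m P ω) + Y n P ω * Y n P ω := fun ω => by ring
    simp_rw [this]
    rw [integral_add (f := fun ω => Y m P ω * Y m P ω - 2 * (Y n P ω * Y m P ω))
      ((hYY m m P).sub ((hYY n m P).const_mul 2)) (hYY n n P), integral_sub (hYY m m P) ((hYY n m P).const_mul 2), integral_const_mul, hprod P m n hmn]
    ring
  have hC : ∀ P, ∀ ε : ℝ≥0∞, ε ≠ 0 → ∃ N, ∀ m ≥ N, ∀ n ≥ N,
      eLpNorm (Y m P - Y n P) 1 (κ P) ≤ ε := by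
    intro P ε hε
    set q : ℕ → ℝ := fun n => ∫ ω, Y n P ω * Y n P ω ∂(κ P) with hq
    have hqa : Antitone q := fun m n hmn => by
      have := hsq P m n hmn
      have h0 : 0 ≤ ∫ ω, (Y m P ω - Y n P ω) ^ 2 ∂(κ P) := integral_nonneg fun ω => sq_nonneg _
      simp only [hq]; linarith
    have hqc : CauchySeq q := (tendsto_atTop_ciInf hqa ⟨0, by
      rintro _ ⟨n, rfl⟩
      exact integral_nonneg fun ω => mul_self_nonneg _⟩).cauchySeq
    obtain ⟨δ, hδ, hδε⟩ : ∃ δ : ℝ, 0 < δ ∧ ENNReal.ofReal δ ≤ ε := by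
      rcases eq_or_ne ε ∞ with rfl | h
      · exact ⟨1, one_pos, le_top⟩
      · exact ⟨ε.toReal, ENNReal.toReal_pos hε h, ENNReal.ofReal_toReal_le⟩
    obtain ⟨N, hN⟩ := Metric.cauchySeq_iff.1 hqc (δ ^ 2) (by positivity)
    have key : ∀ m ≥ N, ∀ n ≥ N, m ≤ n → eLpNorm (Y m P - Y n P) 1 (κ P) ≤ ε := by
      intro m hm n hn hmn
      refine (eLpNorm_one_le_sqrt ((hYP m P).sub (hYP n P)) (C := 2) fun ω => ?_).trans
        ((ENNReal.ofReal_le_ofReal ?_).trans hδε)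
      · have := hYabs m P ω; have := hYabs n P ω
        simp only [Pi.sub_apply]
        exact (abs_sub _ _).trans (by linarith)
      · rw [Real.sqrt_le_left hδ.le]
        simp only [Pi.sub_apply]
        rw [hsq P m n hmn]
        have := hN m hm n hn
        rw [Real.dist_eq] at this
        exact (le_abs_self _).trans this.le
    refine ⟨N, fun m hm n hn => ?_⟩
    rcases le_total m n with h | h
    · exact key m hm n hn h
    · rw [eLpNorm_sub_comm]; exact key n hn m hm h
  obtain ⟨N, hNm, hNj, hNf⟩ := exists_fast_index κ hY hC
  have hadapt : ∀ P, Measurable[F.rightCont s] fun ω =>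
      limsup (fun j => Y (N j P) P ω) atTop := by
    intro P
    rw [measurable_rightCont_iff]
    intro t ht
    obtain ⟨J, hJ⟩ : ∃ J, u J ≤ t := by
      have hlim : Tendsto u atTop (𝓝 (s + 0)) :=
        tendsto_const_nhds.add (tendsto_one_div_add_atTop_nhds_zero_nat (𝕜 := ℝ≥0))
      rw [add_zero] at hlim
      exact (hlim.eventually (Iic_mem_nhds ht)).exists
    -- Since `j ≤ N j P`, the terms from `J` on are all `F_t`-measurable, and the upper limit does
    -- not see the earlier ones.
    have : (fun ω => limsup (fun j => Y (N j P) P ω) atTop) =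
        fun ω => limsup (fun j => Y (N (j + J) P) P ω) atTop := by
      ext ω
      exact (limsup_nat_add (fun j => Y (N j P) P ω) J).symm
    rw [this]
    refine Measurable.limsup (mδ := F t) fun j => ?_
    exact (hYm _ P).mono (F.mono ((hanti ((Nat.le_add_left J j).trans (hNj _ P))).trans hJ)) le_rfl
  refine ⟨fun P ω => limsup (fun j => Y (N j P) P ω) atTop, ?_, fun P => ?_, fun P ω =>
    limsup_mem_Icc fun n => hY1 _ _ _, fun P => ?_⟩
  · exact Measurable.limsup fun j => measurable_comp_index hY (hNm j)
  · exact hadapt P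
  · have hle : F.rightCont s ≤ mΩ := F.rightCont.le s
    have hlim : ∀ᵐ ω ∂(κ P), Tendsto (fun j => Y (N j P) P ω) atTop
        (𝓝 (limsup (fun j => Y (N j P) P ω) atTop)) := by
      filter_upwards [Lp.ae_tendsto_of_cauchy_eLpNorm
        (fun j => (hYP (N j P) P).aestronglyMeasurable) le_rfl tsum_two_mul_half_pow_ne_top
        (fun J i j => hNf P J i j)] with ω ⟨l, hl⟩
      rwa [hl.limsup_eq]
    have hL1 := Lp.cauchy_tendsto_of_tendsto
        (fun j => (hYP (N j P) P).aestronglyMeasurable) _ tsum_two_mul_half_pow_ne_top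
        (fun J i j => hNf P J i j) hlim
    have hmeas : Measurable fun ω => limsup (fun j => Y (N j P) P ω) atTop :=
      Measurable.limsup fun j => hYP _ P
    have hint : Integrable (fun ω => limsup (fun j => Y (N j P) P ω) atTop) (κ P) :=
      integrable_of_abs_le hmeas (C := 1) fun ω => by
        have := limsup_mem_Icc fun j => hY1 (N j P) P ω
        rw [abs_of_nonneg this.1]; exact this.2
    refine ae_eq_condExp_of_forall_setIntegral_eq hle (hXi P) (fun G _ _ => hint.integrableOn)
      (fun G hG _ => ?_) ?_
    · have h1 := tendsto_setIntegral_of_L1' _ hint.aestronglyMeasurable (.of_forall fun j => hYi (N j P) P) hL1 G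
      refine tendsto_nhds_unique h1 (tendsto_const_nhds.congr fun j => ?_)
      have hG' : MeasurableSet[F (u (N j P))] G := (rightCont_le (hus _)) G hG
      rw [integral_congr_ae (ae_restrict_of_ae (hYc (N j P) P)),
        setIntegral_condExp (F.le _) (hXi P) hG']
    · exact (hadapt P).stronglyMeasurable.aestronglyMeasurable

end ConditionalExpectation

/-! ### Rational convex combinations. -/

section ConvexWeights

/-- Rational weights of convex combinations of the terms with index at least `n`. -/
def convexWeights (n : ℕ) : Set (ℕ →₀ ℚ≥0) := {w | (w.sum fun _ q => q) = 1 ∧ ∀ i < n, w i = 0}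

/-- The linear combination of `x` with weights `w`. -/
noncomputable def combination (w : ℕ →₀ ℚ≥0) (x : ℕ → ℝ) : ℝ := w.sum fun i q => (q : ℝ) * x i

theorem convexWeights_anti : Antitone convexWeights := fun _ _ h _ hw =>
  ⟨hw.1, fun i hi => hw.2 i (hi.trans_le h)⟩

theorem single_mem_convexWeights (n : ℕ) : Finsupp.single n 1 ∈ convexWeights n :=
  ⟨by simp, fun i hi => Finsupp.single_eq_of_ne hi.ne⟩

theorem combination_single (n : ℕ) (x : ℕ → ℝ) : combination (Finsupp.single n 1) x = x n := by
  simp [combination]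

theorem combination_eq_sum (w : ℕ →₀ ℚ≥0) (x : ℕ → ℝ) :
    combination w x = ∑ i ∈ w.support, (w i : ℝ) * x i := rfl

theorem combination_half_add (w w' : ℕ →₀ ℚ≥0) (x : ℕ → ℝ) :
    combination ((1 / 2 : ℚ≥0) • w + (1 / 2 : ℚ≥0) • w') x =
      (combination w x + combination w' x) / 2 := by
  unfold combination
  rw [Finsupp.sum_add_index' (by simp) (by intros; push_cast; ring),
    Finsupp.sum_smul_index (by simp), Finsupp.sum_smul_index (by simp)]
  simp only [Finsupp.sum, add_div, Finset.sum_div]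
  congr 1 <;> refine Finset.sum_congr rfl fun i _ => ?_ <;> push_cast <;> ring

theorem half_add_mem_convexWeights {n : ℕ} {w w' : ℕ →₀ ℚ≥0} (hw : w ∈ convexWeights n)
    (hw' : w' ∈ convexWeights n) :
    (1 / 2 : ℚ≥0) • w + (1 / 2 : ℚ≥0) • w' ∈ convexWeights n := by
  refine ⟨?_, fun i hi => by simp [hw.2 i hi, hw'.2 i hi]⟩
  rw [Finsupp.sum_add_index' (by simp) (by intros; rfl),
    Finsupp.sum_smul_index (by simp), Finsupp.sum_smul_index (by simp)]
  have h1 := hw.1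
  have h2 := hw'.1
  simp only [Finsupp.sum] at h1 h2 ⊢
  rw [← Finset.mul_sum, ← Finset.mul_sum, h1, h2]
  norm_num

theorem combination_const {n : ℕ} {w : ℕ →₀ ℚ≥0} (hw : w ∈ convexWeights n) (c : ℝ) :
    combination w (fun _ => c) = c := by
  rw [combination_eq_sum, ← Finset.sum_mul]
  have h1 := hw.1
  simp only [Finsupp.sum] at h1
  have : ∑ i ∈ w.support, (w i : ℝ) = 1 := by exact_mod_cast h1
  rw [this, one_mul]

theorem le_of_mem_support {n : ℕ} {w : ℕ →₀ ℚ≥0} (hw : w ∈ convexWeights n) {i : ℕ}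
    (hi : i ∈ w.support) : n ≤ i := by
  by_contra h
  exact Finsupp.mem_support_iff.1 hi (hw.2 i (not_le.1 h))

theorem combination_mono {n : ℕ} {w : ℕ →₀ ℚ≥0} (hw : w ∈ convexWeights n) {x y : ℕ → ℝ}
    (h : ∀ i ≥ n, x i ≤ y i) : combination w x ≤ combination w y :=
  Finset.sum_le_sum fun i hi =>
    mul_le_mul_of_nonneg_left (h i (le_of_mem_support hw hi)) (by positivity)

theorem combination_congr {n : ℕ} {w : ℕ →₀ ℚ≥0} (hw : w ∈ convexWeights n) {x y : ℕ → ℝ}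
    (h : ∀ i ≥ n, x i = y i) : combination w x = combination w y :=
  Finset.sum_congr rfl fun i hi => by
    simp only [h i (le_of_mem_support hw hi)]

theorem combination_sub (w : ℕ →₀ ℚ≥0) (x y : ℕ → ℝ) :
    combination w (fun i => x i - y i) = combination w x - combination w y := by
  simp only [combination_eq_sum, mul_sub, Finset.sum_sub_distrib]

theorem combination_nonneg (w : ℕ →₀ ℚ≥0) {x : ℕ → ℝ} (h : ∀ i, 0 ≤ x i) :
    0 ≤ combination w x :=
  Finset.sum_nonneg fun i _ => mul_nonneg (by positivity) (h i)

theorem abs_combination_le (w : ℕ →₀ ℚ≥0) {x C : ℕ → ℝ} (h : ∀ i, |x i| ≤ C i) :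
    |combination w x| ≤ combination w C := by
  refine (Finset.abs_sum_le_sum_abs _ _).trans (Finset.sum_le_sum fun i _ => ?_)
  rw [abs_mul, abs_of_nonneg (by positivity : (0 : ℝ) ≤ (w i : ℝ))]
  exact mul_le_mul_of_nonneg_left (h i) (by positivity)

theorem measurable_combination {α : Type*} {m : MeasurableSpace α} (w : ℕ →₀ ℚ≥0)
    {x : ℕ → α → ℝ} (hx : ∀ i, Measurable (x i)) :
    Measurable fun a => combination w fun i => x i a := by
  simp only [combination_eq_sum]
  exact Finset.measurable_sum _ fun i _ => (hx i).const_mul _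

theorem integral_combination {α : Type*} {m : MeasurableSpace α} {μ : Measure α} (w : ℕ →₀ ℚ≥0)
    {x : ℕ → α → ℝ} (hx : ∀ i, Integrable (x i) μ) :
    ∫ a, combination w (fun i => x i a) ∂μ = combination w fun i => ∫ a, x i a ∂μ := by
  simp only [combination_eq_sum]
  rw [integral_finsetSum _ fun i _ => (hx i).const_mul _]
  simp only [integral_const_mul]

theorem integrable_combination {α : Type*} {m : MeasurableSpace α} {μ : Measure α}
    (w : ℕ →₀ ℚ≥0) {x : ℕ → α → ℝ} (hx : ∀ i, Integrable (x i) μ) :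
    Integrable (fun a => combination w fun i => x i a) μ := by
  simp only [combination_eq_sum]
  exact integrable_finsetSum _ fun i _ => (hx i).const_mul _

end ConvexWeights

/-! ### Measurable convex combinations converging in `L¹`. -/

section Selection

variable {E Ω : Type*} [mE : MeasurableSpace E] [mΩ : MeasurableSpace Ω]

/-- A sequence bounded in `L²(P)` for each law `P` has convex combinations of its tails, chosen
measurably in `P`, that converge rapidly in `L¹(P)`. -/
theorem exists_measurable_convexWeights (κ : Kernel E Ω) [IsMarkovKernel κ] {v : ℕ → E → Ω → ℝ}
    (hv : ∀ n, Measurable (Function.uncurry (v n))) {C : ℕ → ℝ} (hC : ∀ n P ω, |v n P ω| ≤ C n)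
    {K : ℝ} (hK : ∀ n P, ∫ ω, v n P ω ^ 2 ∂(κ P) ≤ K) :
    ∃ (e : ℕ → (ℕ →₀ ℚ≥0)) (k : ℕ → E → ℕ), (∀ j, Measurable (k j)) ∧
      (∀ j P, e (k j P) ∈ convexWeights j) ∧
      ∀ P J i j, J ≤ i → J ≤ j →
        eLpNorm ((fun ω => combination (e (k i P)) fun l => v l P ω) -
          fun ω => combination (e (k j P)) fun l => v l P ω) 1 (κ P) < 2 * 2⁻¹ ^ J := by
  -- Rational weights are countable, so choosing weights amounts to choosing an index.
  obtain ⟨e, he⟩ := exists_surjective_nat (ℕ →₀ ℚ≥0)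
  set Q : E → (ℕ →₀ ℚ≥0) → ℝ := fun P w => ∫ ω, (combination w fun l => v l P ω) ^ 2 ∂(κ P) with hQ
  have hQ0 : ∀ P w, 0 ≤ Q P w := fun P w => integral_nonneg fun ω => sq_nonneg _
  have hcm : ∀ w, Measurable (Function.uncurry fun P ω => combination w fun l => v l P ω) :=
    fun w => measurable_combination w (x := fun l (a : E × Ω) => v l a.1 a.2) hv
  have hcP : ∀ w P, Measurable fun ω => combination w fun l => v l P ω :=
    fun w P => (hcm w).of_uncurry_left
  have hcb : ∀ w P ω, |combination w fun l => v l P ω| ≤ combination w C := fun w P ω =>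
    abs_combination_le w fun l => hC l P ω
  have hsqi : ∀ w P, Integrable (fun ω => (combination w fun l => v l P ω) ^ 2) (κ P) :=
    fun w P => integrable_of_abs_le ((hcP w P).pow_const 2) (C := (combination w C) ^ 2)
      fun ω => by
        rw [abs_pow]
        exact pow_le_pow_left₀ (abs_nonneg _) (hcb w P ω) 2
  have hQm : ∀ w, Measurable fun P => Q P w := fun w =>
    (StronglyMeasurable.integral_kernel_prod_right
      ((hcm w).pow_const 2).stronglyMeasurable).measurable
  have hbdd : ∀ P n, BddBelow (range fun w : convexWeights n => Q P w) := fun P n =>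
    ⟨0, by rintro _ ⟨w, rfl⟩; exact hQ0 P w⟩
  have hne : ∀ n, Nonempty (convexWeights n) := fun n => ⟨⟨_, single_mem_convexWeights n⟩⟩
  -- A minimizer of the `L²` norm over rational weights need not exist; an approximate one, within
  -- `1 / (n + 1)`, does.
  set p : ℕ → E → ℕ → Prop := fun n P k => e k ∈ convexWeights n ∧
    ∀ w ∈ convexWeights n, Q P (e k) ≤ Q P w + 1 / ((n : ℝ) + 1) with hp
  have hsel : ∀ n, ∃ k : E → ℕ, Measurable k ∧ ∀ P, p n P (k P) := fun n => by
    refine exists_measurable_index (fun k => ?_) fun P => ?_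
    · have : {P | p n P k} = {P | e k ∈ convexWeights n} ∩ ⋂ w, ⋂ (_ : w ∈ convexWeights n),
          {P | Q P (e k) ≤ Q P w + 1 / ((n : ℝ) + 1)} := by
        ext P; simp [hp]
      rw [this]
      exact (MeasurableSet.const _).inter <| .iInter fun w => .iInter fun _ =>
        measurableSet_le (hQm _) ((hQm w).add_const _)
    · obtain ⟨w, hw⟩ := exists_lt_of_ciInf_lt
        (lt_add_of_pos_right (⨅ w : convexWeights n, Q P w)
          (by positivity : (0 : ℝ) < 1 / ((n : ℝ) + 1)))
      obtain ⟨k, hk⟩ := he w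
      refine ⟨k, hk ▸ w.2, fun w' hw' => ?_⟩
      rw [hk]
      exact hw.le.trans (add_le_add_left (ciInf_le (hbdd P n) ⟨w', hw'⟩) _)
  choose k hkm hkp using hsel
  have hzm : ∀ n, Measurable (Function.uncurry fun P ω =>
      combination (e (k n P)) fun l => v l P ω) := fun n =>
    measurable_comp_index (Y := fun i P ω => combination (e i) fun l => v l P ω)
      (fun i => hcm (e i)) (hkm n)
  have hcauchy : ∀ P, ∀ ε : ℝ≥0∞, ε ≠ 0 → ∃ N, ∀ m ≥ N, ∀ n ≥ N,
      eLpNorm ((fun ω => combination (e (k m P)) fun l => v l P ω) -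
        fun ω => combination (e (k n P)) fun l => v l P ω) 1 (κ P) ≤ ε := by
    intro P ε hε
    obtain ⟨δ, hδ, hδε⟩ : ∃ δ : ℝ, 0 < δ ∧ ENNReal.ofReal δ ≤ ε := by
      rcases eq_or_ne ε ∞ with rfl | h
      · exact ⟨1, one_pos, le_top⟩
      · exact ⟨ε.toReal, ENNReal.toReal_pos hε h, ENNReal.ofReal_toReal_le⟩
    set c : ℕ → ℝ := fun n => ⨅ w : convexWeights n, Q P w with hc
    -- The infima increase because the sets of weights shrink, and the `L²` bound `K` makes them
    -- converge.
    have hcmono : Monotone c := fun m n hmn => le_ciInf fun w =>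
      ciInf_le (hbdd P m) (⟨w, convexWeights_anti hmn w.2⟩ : convexWeights m)
    have hcK : ∀ n, c n ≤ K := fun n =>
      (ciInf_le (hbdd P n) ⟨_, single_mem_convexWeights n⟩).trans
        (by simpa only [hQ, combination_single] using hK n P)
    have hQk : ∀ n, Q P (e (k n P)) ≤ c n + 1 / ((n : ℝ) + 1) := fun n => by
      rw [← sub_le_iff_le_add]
      exact le_ciInf fun w => by
        rw [sub_le_iff_le_add]; exact (hkp n P).2 w w.2
    have hlim : Tendsto c atTop (𝓝 (⨆ n, c n)) :=
      tendsto_atTop_ciSup hcmono ⟨K, by rintro _ ⟨n, rfl⟩; exact hcK n⟩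
    have hlim2 : Tendsto (fun N : ℕ => 4 * ((⨆ n, c n) - c N) + 4 * (1 / ((N : ℝ) + 1)))
        atTop (𝓝 (4 * ((⨆ n, c n) - ⨆ n, c n) + 4 * 0)) :=
      ((tendsto_const_nhds.sub hlim).const_mul 4).add
        ((tendsto_one_div_add_atTop_nhds_zero_nat).const_mul 4)
    obtain ⟨N, hN⟩ := (hlim2.eventually (gt_mem_nhds
      (show 4 * ((⨆ n, c n) - ⨆ n, c n) + 4 * 0 < δ ^ 2 by simpa using pow_pos hδ 2))).exists
    refine ⟨N, fun m hm n hn => ?_⟩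
    refine (eLpNorm_one_le_sqrt ((hcP _ P).sub (hcP _ P))
      (C := combination (e (k m P)) C + combination (e (k n P)) C) fun ω => ?_).trans
        ((ENNReal.ofReal_le_ofReal ?_).trans hδε)
    · simp only [Pi.sub_apply]
      exact (abs_sub _ _).trans (add_le_add (hcb _ P ω) (hcb _ P ω))
    rw [Real.sqrt_le_left hδ.le]
    simp only [Pi.sub_apply]
    set w := e (k m P) with hwdef
    set w' := e (k n P) with hwdef'
    have hw : w ∈ convexWeights N := convexWeights_anti hm (hkp m P).1
    have hw' : w' ∈ convexWeights N := convexWeights_anti hn (hkp n P).1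
    -- Parallelogram identity: the midpoint is again an admissible combination, so its squared norm
    -- is at least `c N`, while those of the two near-minimizers exceed the supremum of `c` by at
    -- most `1 / (N + 1)`.
    have hid : ∀ ω, ((combination w fun l => v l P ω) - combination w' fun l => v l P ω) ^ 2 =
        2 * (combination w fun l => v l P ω) ^ 2 + 2 * (combination w' fun l => v l P ω) ^ 2 -
        4 * (combination ((1 / 2 : ℚ≥0) • w + (1 / 2 : ℚ≥0) • w') fun l => v l P ω) ^ 2 :=
      fun ω => by rw [combination_half_add]; ring
    simp_rw [hid]
    rw [integral_sub (f := fun ω => 2 * (combination w fun l => v l P ω) ^ 2 +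
        2 * (combination w' fun l => v l P ω) ^ 2)
      (((hsqi w P).const_mul 2).add ((hsqi w' P).const_mul 2)) ((hsqi _ P).const_mul 4),
      integral_add ((hsqi w P).const_mul 2) ((hsqi w' P).const_mul 2),
      integral_const_mul, integral_const_mul, integral_const_mul]
    change 2 * Q P w + 2 * Q P w' - 4 * Q P _ ≤ _
    have h1 : c N ≤ Q P ((1 / 2 : ℚ≥0) • w + (1 / 2 : ℚ≥0) • w') :=
      ciInf_le (hbdd P N) ⟨_, half_add_mem_convexWeights hw hw'⟩
    have hsup : ∀ n, c n ≤ ⨆ n, c n := fun n => hcmono.ge_of_tendsto hlim n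
    have h2 := hQk m
    have h3 := hQk n
    have h4 : 1 / ((m : ℝ) + 1) ≤ 1 / ((N : ℝ) + 1) := by gcongr
    have h5 : 1 / ((n : ℝ) + 1) ≤ 1 / ((N : ℝ) + 1) := by gcongr
    have h6 := hsup m
    have h7 := hsup n
    linarith
  obtain ⟨N, hNm, hNj, hNf⟩ := exists_fast_index κ hzm hcauchy
  refine ⟨e, fun j P => k (N j P) P, fun j => ?_, fun j P =>
    convexWeights_anti (hNj j P) (hkp (N j P) P).1, hNf⟩
  have h1 : Measurable fun x : ℕ × E => k x.1 x.2 := measurable_from_prod_countable_right hkm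
  exact h1.comp ((hNm j).prodMk measurable_id)

end Selection

/-! ### Step paths and summation estimates. -/

section Paths

/-- The left-continuous step path of level `n` with jumps `α k` at the times `k / 2 ^ n`. -/
noncomputable def stepPath (n : ℕ) (α : ℕ → ℝ) (t : ℝ≥0) : ℝ :=
  ∑ k ∈ Finset.range (4 ^ n), if dyadic n k < t then α k else 0

theorem stepPath_dyadic {n m : ℕ} (hm : m ≤ 4 ^ n) (α : ℕ → ℝ) :
    stepPath n α (dyadic n m) = ∑ k ∈ Finset.range m, α k := by
  unfold stepPath
  simp only [dyadic_lt_dyadic]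
  rw [← Finset.sum_filter]
  congr 1
  ext k
  simp only [Finset.mem_filter, Finset.mem_range]
  omega

theorem stepPath_mono (n : ℕ) {α : ℕ → ℝ} (hα : ∀ k, 0 ≤ α k) : Monotone (stepPath n α) :=
  fun s t hst => Finset.sum_le_sum fun k _ => by
    by_cases h : dyadic n k < s
    · rw [if_pos h, if_pos (h.trans_le hst)]
    · rw [if_neg h]; split_ifs
      · exact hα k
      · exact le_rfl

theorem stepPath_zero (n : ℕ) (α : ℕ → ℝ) : stepPath n α 0 = 0 :=
  Finset.sum_eq_zero fun _ _ => if_neg (not_lt.2 zero_le)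

theorem stepPath_nonneg (n : ℕ) {α : ℕ → ℝ} (hα : ∀ k, 0 ≤ α k) (t : ℝ≥0) : 0 ≤ stepPath n α t :=
  (stepPath_zero n α).symm.le.trans (stepPath_mono n hα zero_le)

theorem stepPath_le (n : ℕ) {α : ℕ → ℝ} (hα : ∀ k, α k ∈ Icc (0 : ℝ) 1) (t : ℝ≥0) :
    stepPath n α t ≤ 4 ^ n := by
  refine (Finset.sum_le_card_nsmul _ _ 1 fun k _ => ?_).trans (by simp)
  split_ifs
  · exact (hα k).2
  · exact zero_le_one

theorem continuousWithinAt_stepPath (n : ℕ) (α : ℕ → ℝ) (t : ℝ≥0) :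
    ContinuousWithinAt (stepPath n α) (Iic t) t := by
  unfold stepPath
  refine tendsto_finsetSum _ fun k _ => ?_
  by_cases h : dyadic n k < t
  · refine tendsto_const_nhds.congr' ?_
    filter_upwards [mem_nhdsWithin_of_mem_nhds (Ioi_mem_nhds h)] with s hs
    rw [if_pos (mem_Ioi.1 hs), if_pos h]
  · refine tendsto_const_nhds.congr' ?_
    filter_upwards [self_mem_nhdsWithin] with s hs
    rw [if_neg h, if_neg fun h' => h (h'.trans_le hs)]

/-- The difference at infinity of the step path of level `n` and of the path it compensates. -/
noncomputable def terminalValue (n : ℕ) (α : ℕ → ℝ) (ξ : ℝ≥0 → ℝ) : ℝ :=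
  ∑ k ∈ Finset.range (4 ^ n), α k - (ξ (2 ^ n) - ξ 0)

/-- With `S` the partial sums, `S_{l+1}² - S_l² = 2 S_{l+1} α_l - α_l²`. The factor `S_{l+1}`
contains `α_l`; in the discrete compensator it is nevertheless known at the start of the `l`-th
interval. -/
theorem sq_sum_le (α : ℕ → ℝ) (K : ℕ) :
    (∑ k ∈ Finset.range K, α k) ^ 2 ≤
      2 * ∑ l ∈ Finset.range K, (∑ k ∈ Finset.range (l + 1), α k) * α l := by
  induction K with
  | zero => simp
  | succ K ih =>
    rw [Finset.sum_range_succ (fun l => (∑ k ∈ Finset.range (l + 1), α k) * α l),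
      Finset.sum_range_succ α K]
    nlinarith [sq_nonneg (α K)]

/-- Summation by parts moves the differences from `ξ` onto the partial sums. -/
theorem sum_mul_sub_le {α ξ : ℕ → ℝ} (hα : ∀ k, 0 ≤ α k) (hξ : ∀ k, ξ k ∈ Icc (0 : ℝ) 1) (K : ℕ) :
    ∑ l ∈ Finset.range K, (∑ k ∈ Finset.range (l + 1), α k) * (ξ (l + 1) - ξ l) ≤
      ∑ k ∈ Finset.range K, α k := by
  have key : ∑ l ∈ Finset.range K, (∑ k ∈ Finset.range (l + 1), α k) * (ξ (l + 1) - ξ l) =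
      ξ K * ∑ k ∈ Finset.range K, α k - ∑ l ∈ Finset.range K, ξ l * α l := by
    induction K with
    | zero => simp
    | succ K ih =>
      rw [Finset.sum_range_succ, ih, Finset.sum_range_succ α K,
        Finset.sum_range_succ (fun l => ξ l * α l)]
      ring
  rw [key]
  have h1 : 0 ≤ ∑ l ∈ Finset.range K, ξ l * α l :=
    Finset.sum_nonneg fun l _ => mul_nonneg (hξ l).1 (hα l)
  have h2 : ξ K * ∑ k ∈ Finset.range K, α k ≤ 1 * ∑ k ∈ Finset.range K, α k :=
    mul_le_mul_of_nonneg_right (hξ K).2 (Finset.sum_nonneg fun k _ => hα k)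
  linarith

end Paths

/-! ### Discrete compensators of bounded increasing processes. -/

/-- A process with values in `[0, 1]` whose paths are almost surely nondecreasing and
right-continuous. -/
structure IsUnitIncreasing {Ω : Type*} {mΩ : MeasurableSpace Ω} (F : Filtration ℝ≥0 mΩ)
    (μ : Measure Ω) (x : Ω → ℝ≥0 → ℝ) : Prop where
  adapted : ∀ t, Measurable[F.rightCont t] fun ω => x ω t
  mem : ∀ ω t, x ω t ∈ Icc (0 : ℝ) 1
  mono : ∀ᵐ ω ∂μ, Monotone (x ω)
  rightCont : ∀ᵐ ω ∂μ, ∀ t, ContinuousWithinAt (x ω) (Ici t) t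

/-- `a n k` is a version of the conditional expectation of the increment of `x` over
`(k / 2 ^ n, (k + 1) / 2 ^ n]` given the information at the beginning of that interval. -/
structure IsDiscreteCompensator {Ω : Type*} {mΩ : MeasurableSpace Ω} (F : Filtration ℝ≥0 mΩ)
    (μ : Measure Ω) (x : Ω → ℝ≥0 → ℝ) (a : ℕ → ℕ → Ω → ℝ) : Prop where
  measurable : ∀ n k, Measurable[F.rightCont (dyadic n k)] (a n k)
  mem : ∀ n k ω, a n k ω ∈ Icc (0 : ℝ) 1
  integral_mul : ∀ n k (Z : Ω → ℝ), Measurable[F.rightCont (dyadic n k)] Z →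
    (∃ C, ∀ ω, |Z ω| ≤ C) →
    ∫ ω, Z ω * a n k ω ∂μ = ∫ ω, Z ω * (x ω (dyadic n (k + 1)) - x ω (dyadic n k)) ∂μ

section Discrete

variable {Ω : Type*} {mΩ : MeasurableSpace Ω} {F : Filtration ℝ≥0 mΩ} {μ : Measure Ω}
  {x : Ω → ℝ≥0 → ℝ} {a : ℕ → ℕ → Ω → ℝ}

theorem IsUnitIncreasing.measurable (hx : IsUnitIncreasing F μ x) (t : ℝ≥0) :
    Measurable fun ω => x ω t := (hx.adapted t).mono (F.rightCont.le t) le_rfl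

theorem IsUnitIncreasing.integrable [IsFiniteMeasure μ] (hx : IsUnitIncreasing F μ x) (t : ℝ≥0) :
    Integrable (fun ω => x ω t) μ :=
  integrable_of_abs_le (hx.measurable t) (C := 1) fun ω => by
    rw [abs_of_nonneg (hx.mem ω t).1]; exact (hx.mem ω t).2

theorem IsDiscreteCompensator.measurable' (ha : IsDiscreteCompensator F μ x a) (n k : ℕ) :
    Measurable (a n k) := (ha.measurable n k).mono (F.rightCont.le _) le_rfl

theorem IsDiscreteCompensator.integrable [IsFiniteMeasure μ]
    (ha : IsDiscreteCompensator F μ x a) (n k : ℕ) : Integrable (a n k) μ :=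
  integrable_of_abs_le (ha.measurable' n k) (C := 1) fun ω => by
    rw [abs_of_nonneg (ha.mem n k ω).1]; exact (ha.mem n k ω).2

theorem IsDiscreteCompensator.setIntegral [IsFiniteMeasure μ]
    (ha : IsDiscreteCompensator F μ x a) (n k : ℕ) {G : Set Ω}
    (hG : MeasurableSet[F.rightCont (dyadic n k)] G) :
    ∫ ω in G, a n k ω ∂μ = ∫ ω in G, (x ω (dyadic n (k + 1)) - x ω (dyadic n k)) ∂μ := by
  have hG' : MeasurableSet G := F.rightCont.le _ G hG
  have h := ha.integral_mul n k (G.indicator 1)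
    ((measurable_indicator_const_iff (1 : ℝ)).2 hG) ⟨1, fun ω => by
      by_cases h : ω ∈ G <;> simp [h]⟩
  have hi : ∀ f : Ω → ℝ, (fun ω => G.indicator (1 : Ω → ℝ) ω * f ω) = G.indicator f := fun f => by
    ext ω; by_cases h : ω ∈ G <;> simp [h]
  rwa [hi, hi, integral_indicator hG', integral_indicator hG'] at h

theorem abs_sum_le_four_pow (ha : ∀ n k ω, a n k ω ∈ Icc (0 : ℝ) 1) (n m : ℕ) (ω : Ω) :
    |∑ k ∈ Finset.range m, a n k ω| ≤ m := by
  rw [abs_of_nonneg (Finset.sum_nonneg fun k _ => (ha n k ω).1)]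
  refine (Finset.sum_le_card_nsmul _ _ 1 fun k _ => (ha n k ω).2).trans (by simp)

theorem abs_terminalValue_le (hx : IsUnitIncreasing F μ x) (ha : IsDiscreteCompensator F μ x a)
    (n : ℕ) (ω : Ω) : |terminalValue n (fun k => a n k ω) (x ω)| ≤ (4 ^ n : ℕ) + 1 := by
  refine (abs_sub _ _).trans (add_le_add (abs_sum_le_four_pow ha.mem n _ ω) ?_)
  have h1 := hx.mem ω (2 ^ n)
  have h2 := hx.mem ω 0
  rw [abs_le]
  constructor <;> linarith [h1.1, h1.2, h2.1, h2.2]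

theorem measurable_terminalValue (hx : IsUnitIncreasing F μ x) (ha : IsDiscreteCompensator F μ x a)
    (n : ℕ) : Measurable fun ω => terminalValue n (fun k => a n k ω) (x ω) :=
  (Finset.measurable_sum _ fun k _ => ha.measurable' n k).sub
    ((hx.measurable _).sub (hx.measurable _))

/-- Energy inequality: after `sq_sum_le`, the predictable partial sums allow `a n l` to be replaced
by the increment of `x`; `sum_mul_sub_le` then leaves twice the expected sum, which is twice an
expected increment of `x`. The bound does not depend on the level. -/
theorem integral_sum_sq_le [IsProbabilityMeasure μ] (hx : IsUnitIncreasing F μ x)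
    (ha : IsDiscreteCompensator F μ x a) (n m : ℕ) :
    ∫ ω, (∑ k ∈ Finset.range m, a n k ω) ^ 2 ∂μ ≤ 2 := by
  have hs : ∀ m, Measurable fun ω => ∑ k ∈ Finset.range m, a n k ω := fun m =>
    Finset.measurable_sum _ fun k _ => ha.measurable' n k
  have hsl : ∀ l, Measurable[F.rightCont (dyadic n l)] fun ω =>
      ∑ k ∈ Finset.range (l + 1), a n k ω := fun l =>
    Finset.measurable_sum _ fun k hk => (ha.measurable n k).mono
      (F.rightCont.mono (dyadic_le_dyadic.2 (by simpa [Nat.lt_succ_iff] using hk))) le_rfl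
  have hsb := abs_sum_le_four_pow ha.mem n
  have hi1 : ∀ l, Integrable (fun ω => (∑ k ∈ Finset.range (l + 1), a n k ω) * a n l ω) μ :=
    fun l => (ha.integrable n l).bdd_mul (hs _).aestronglyMeasurable
      (.of_forall (hsb (l + 1)))
  have hi2 : ∀ l, Integrable (fun ω => (∑ k ∈ Finset.range (l + 1), a n k ω) *
      (x ω (dyadic n (l + 1)) - x ω (dyadic n l))) μ :=
    fun l => ((hx.integrable _).sub (hx.integrable _)).bdd_mul (hs _).aestronglyMeasurable
      (.of_forall (hsb (l + 1)))
  have hi3 : Integrable (fun ω => ∑ k ∈ Finset.range m, a n k ω) μ :=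
    integrable_finsetSum _ fun k _ => ha.integrable n k
  calc ∫ ω, (∑ k ∈ Finset.range m, a n k ω) ^ 2 ∂μ
      ≤ ∫ ω, 2 * ∑ l ∈ Finset.range m, (∑ k ∈ Finset.range (l + 1), a n k ω) * a n l ω ∂μ :=
        integral_mono (integrable_of_abs_le ((hs m).pow_const 2) (C := (m : ℝ) ^ 2) fun ω => by
            rw [abs_pow]; exact pow_le_pow_left₀ (abs_nonneg _) (hsb m ω) 2)
          ((integrable_finsetSum _ fun l _ => hi1 l).const_mul 2)
          fun ω => sq_sum_le (fun k => a n k ω) m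
    _ = 2 * ∫ ω, ∑ l ∈ Finset.range m, (∑ k ∈ Finset.range (l + 1), a n k ω) *
          (x ω (dyadic n (l + 1)) - x ω (dyadic n l)) ∂μ := by
        rw [integral_const_mul, integral_finsetSum _ fun l _ => hi1 l,
          integral_finsetSum _ fun l _ => hi2 l]
        congr 1
        exact Finset.sum_congr rfl fun l _ => ha.integral_mul n l _ (hsl l) ⟨_, hsb (l + 1)⟩
    _ ≤ 2 * ∫ ω, ∑ k ∈ Finset.range m, a n k ω ∂μ := by
        refine mul_le_mul_of_nonneg_left ?_ zero_le_two
        exact integral_mono (integrable_finsetSum _ fun l _ => hi2 l) hi3 fun ω =>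
          sum_mul_sub_le (ξ := fun k => x ω (dyadic n k)) (fun k => (ha.mem n k ω).1)
            (fun k => hx.mem ω _) m
    _ = 2 * ∫ ω, (x ω (dyadic n m) - x ω (dyadic n 0)) ∂μ := by
        rw [integral_finsetSum _ fun k _ => ha.integrable n k]
        have : ∀ k, ∫ ω, a n k ω ∂μ =
            ∫ ω, (x ω (dyadic n (k + 1)) - x ω (dyadic n k)) ∂μ := fun k => by
          simpa using ha.setIntegral n k MeasurableSet.univ
        simp_rw [this]
        rw [← integral_finsetSum (f := fun k ω => x ω (dyadic n (k + 1)) - x ω (dyadic n k)) _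
          fun k _ => (hx.integrable _).sub (hx.integrable _)]
        congr 2
        ext ω
        exact Finset.sum_range_sub (fun k => x ω (dyadic n k)) m
    _ ≤ 2 * ∫ _, (1 : ℝ) ∂μ := by
        refine mul_le_mul_of_nonneg_left ?_ zero_le_two
        exact integral_mono (f := fun ω => x ω (dyadic n m) - x ω (dyadic n 0))
          ((hx.integrable _).sub (hx.integrable _)) (integrable_const _) fun ω => by
            have h1 := (hx.mem ω (dyadic n m)).2
            have h2 := (hx.mem ω (dyadic n 0)).1
            dsimp only
            linarith
    _ = 2 := by simp

/-- The inequality `(u - v)² ≤ 2u² + 2v²` with `|v| ≤ 1` gives `6 = 2 * 2 + 2`. -/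
theorem integral_terminalValue_sq_le [IsProbabilityMeasure μ] (hx : IsUnitIncreasing F μ x)
    (ha : IsDiscreteCompensator F μ x a) (n : ℕ) :
    ∫ ω, terminalValue n (fun k => a n k ω) (x ω) ^ 2 ∂μ ≤ 6 := by
  have hs : Measurable fun ω => ∑ k ∈ Finset.range (4 ^ n), a n k ω :=
    Finset.measurable_sum _ fun k _ => ha.measurable' n k
  have hi : Integrable (fun ω => (∑ k ∈ Finset.range (4 ^ n), a n k ω) ^ 2) μ :=
    integrable_of_abs_le (hs.pow_const 2) (C := ((4 ^ n : ℕ) : ℝ) ^ 2) fun ω => by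
      rw [abs_pow]
      exact pow_le_pow_left₀ (abs_nonneg _) (abs_sum_le_four_pow ha.mem n _ ω) 2
  calc ∫ ω, terminalValue n (fun k => a n k ω) (x ω) ^ 2 ∂μ
      ≤ ∫ ω, (2 * (∑ k ∈ Finset.range (4 ^ n), a n k ω) ^ 2 + 2) ∂μ := by
        refine integral_mono (integrable_of_abs_le ((measurable_terminalValue hx ha n).pow_const 2)
          (C := (((4 ^ n : ℕ) : ℝ) + 1) ^ 2) fun ω => ?_) ((hi.const_mul 2).add
            (integrable_const _)) fun ω => ?_
        · rw [abs_pow]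
          exact pow_le_pow_left₀ (abs_nonneg _) (abs_terminalValue_le hx ha n ω) 2
        · unfold terminalValue
          have h1 := hx.mem ω (2 ^ n)
          have h2 := hx.mem ω 0
          have h3 : (x ω (2 ^ n) - x ω 0) ^ 2 ≤ 1 := by
            rw [sq_le_one_iff_abs_le_one, abs_le]
            constructor <;> linarith [h1.1, h1.2, h2.1, h2.2]
          nlinarith [sq_nonneg (∑ k ∈ Finset.range (4 ^ n), a n k ω + (x ω (2 ^ n) - x ω 0))]
    _ = 2 * ∫ ω, (∑ k ∈ Finset.range (4 ^ n), a n k ω) ^ 2 ∂μ + 2 := by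
        rw [integral_add (hi.const_mul 2) (integrable_const _), integral_const_mul]
        simp
    _ ≤ 6 := by linarith [integral_sum_sq_le hx ha n (4 ^ n)]

end Discrete

section Existence

variable {E Ω : Type*} [mE : MeasurableSpace E] [mΩ : MeasurableSpace Ω]

theorem exists_discreteCompensator (κ : Kernel E Ω) [IsMarkovKernel κ] (F : Filtration ℝ≥0 mΩ)
    (hF : ∀ t, @MeasurableSpace.CountablyGenerated Ω (F t)) {x : E → Ω → ℝ≥0 → ℝ}
    (hxm : ∀ t, Measurable (Function.uncurry fun P ω => x P ω t))
    (hx : ∀ P, IsUnitIncreasing F (κ P) (x P)) :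
    ∃ a : ℕ → ℕ → E → Ω → ℝ, (∀ n k, Measurable (Function.uncurry (a n k))) ∧
      ∀ P, IsDiscreteCompensator F (κ P) (x P) fun n k => a n k P := by
  -- Paths are only almost surely nondecreasing; clamping the increments puts them in `[0, 1]`
  -- everywhere and alters them only on a null set.
  have hdm : ∀ n k, Measurable (Function.uncurry fun P ω =>
      max 0 (min 1 (x P ω (dyadic n (k + 1)) - x P ω (dyadic n k)))) := fun n k =>
    measurable_const.max (measurable_const.min ((hxm _).sub (hxm _)))
  have hd1 : ∀ n k P ω, max 0 (min 1 (x P ω (dyadic n (k + 1)) - x P ω (dyadic n k))) ∈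
      Icc (0 : ℝ) 1 := fun n k P ω => ⟨le_max_left _ _, max_le zero_le_one (min_le_left _ _)⟩
  choose a ha1 ha2 ha3 ha4 using fun n k =>
    exists_measurable_condExp_rightCont κ F hF (hdm n k) (hd1 n k) (dyadic n k)
  refine ⟨a, ha1, fun P => ⟨fun n k => ha2 n k P, fun n k => ha3 n k P, ?_⟩⟩
  rintro n k Z hZ ⟨C, hC⟩
  rw [integral_mul_eq_of_ae_eq_condExp (F.rightCont.le _)
    (integrable_of_abs_le (hdm n k).of_uncurry_left (C := 1) fun ω => by
      rw [abs_of_nonneg (hd1 n k P ω).1]; exact (hd1 n k P ω).2) (ha4 n k P) hZ hC]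
  refine integral_congr_ae ?_
  filter_upwards [(hx P).mono] with ω hω
  have h1 : x P ω (dyadic n k) ≤ x P ω (dyadic n (k + 1)) :=
    hω (dyadic_le_dyadic.2 (Nat.le_succ k))
  have h2 := ((hx P).mem ω (dyadic n (k + 1))).2
  have h3 := ((hx P).mem ω (dyadic n k)).1
  rw [min_eq_right (by linarith), max_eq_right (by linarith)]

/-- Convex combinations `w j` of the discrete compensators with rapidly converging terminal
values. -/
structure IsConvexApproximation (F : Filtration ℝ≥0 mΩ)
    (μ : Measure Ω) (x : Ω → ℝ≥0 → ℝ) (a : ℕ → ℕ → Ω → ℝ) (w : ℕ → (ℕ →₀ ℚ≥0)) : Prop where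
  unit : IsUnitIncreasing F μ x
  discrete : IsDiscreteCompensator F μ x a
  mem_convexWeights : ∀ j, w j ∈ convexWeights j
  fast : ∀ J i j, J ≤ i → J ≤ j →
    eLpNorm ((fun ω => combination (w i) fun n => terminalValue n (fun k => a n k ω) (x ω)) -
      fun ω => combination (w j) fun n => terminalValue n (fun k => a n k ω) (x ω)) 1 μ <
      2 * 2⁻¹ ^ J

theorem exists_convexApproximation (κ : Kernel E Ω) [IsMarkovKernel κ] (F : Filtration ℝ≥0 mΩ)
    (hF : ∀ t, @MeasurableSpace.CountablyGenerated Ω (F t)) {x : E → Ω → ℝ≥0 → ℝ}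
    (hxm : ∀ t, Measurable (Function.uncurry fun P ω => x P ω t))
    (hx : ∀ P, IsUnitIncreasing F (κ P) (x P)) :
    ∃ (a : ℕ → ℕ → E → Ω → ℝ) (e : ℕ → (ℕ →₀ ℚ≥0)) (i : ℕ → E → ℕ),
      (∀ n k, Measurable (Function.uncurry (a n k))) ∧ (∀ j, Measurable (i j)) ∧
      ∀ P, IsConvexApproximation F (κ P) (x P) (fun n k => a n k P) fun j => e (i j P) := by
  obtain ⟨a, ham, ha⟩ := exists_discreteCompensator κ F hF hxm hx
  obtain ⟨e, i, hi, hei, hf⟩ := exists_measurable_convexWeights κ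
    (v := fun n P ω => terminalValue n (fun k => a n k P ω) (x P ω))
    (fun n => (Finset.measurable_sum _ fun k _ => ham n k).sub ((hxm _).sub (hxm _)))
    (C := fun n => (4 ^ n : ℕ) + 1) (fun n P ω => abs_terminalValue_le (hx P) (ha P) n ω)
    (K := 6) (fun n P => integral_terminalValue_sq_le (hx P) (ha P) n)
  exact ⟨a, e, i, ham, hi, fun P => ⟨hx P, ha P, fun j => hei j P, hf P⟩⟩

end Existence

/-! ### Regularization of the limiting paths. -/

section Regularization

/-- The right-continuous regularization `t ↦ inf_{u > t} g u`. -/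
noncomputable def rightReg (g : ℝ≥0 → ℝ≥0∞) (t : ℝ≥0) : ℝ≥0∞ := ⨅ (u : ℝ≥0) (_ : t < u), g u

theorem rightReg_le (g : ℝ≥0 → ℝ≥0∞) {t u : ℝ≥0} (h : t < u) : rightReg g t ≤ g u :=
  iInf₂_le u h

theorem monotone_rightReg (g : ℝ≥0 → ℝ≥0∞) : Monotone (rightReg g) := fun _ _ hst =>
  le_iInf₂ fun _ hu => rightReg_le g (hst.trans_lt hu)

theorem le_rightReg {g : ℝ≥0 → ℝ≥0∞} (hg : Monotone g) (t : ℝ≥0) : g t ≤ rightReg g t :=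
  le_iInf₂ fun _ hu => hg hu.le

theorem continuousWithinAt_rightReg (g : ℝ≥0 → ℝ≥0∞) (t : ℝ≥0) :
    ContinuousWithinAt (rightReg g) (Ici t) t := by
  refine tendsto_order.2 ⟨fun a ha => ?_, fun a ha => ?_⟩
  · filter_upwards [self_mem_nhdsWithin] with s hs
    exact ha.trans_le (monotone_rightReg g hs)
  · obtain ⟨u, hu, hua⟩ : ∃ u, t < u ∧ g u < a := by
      simpa [rightReg, iInf_lt_iff] using ha
    filter_upwards [mem_nhdsWithin_of_mem_nhds (Iio_mem_nhds hu)] with s hs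
    exact (rightReg_le g hs).trans_lt hua

theorem tendsto_rightReg {g : ℝ≥0 → ℝ≥0∞} (hg : Monotone g) {t : ℝ≥0} {u : ℕ → ℝ≥0}
    (hu : Tendsto u atTop (𝓝[>] t)) : Tendsto (fun n => g (u n)) atTop (𝓝 (rightReg g t)) := by
  have hu' := tendsto_nhdsWithin_iff.1 hu
  refine tendsto_order.2 ⟨fun a ha => ?_, fun a ha => ?_⟩
  · filter_upwards [hu'.2] with n hn
    exact ha.trans_le (rightReg_le g hn)
  · obtain ⟨v, hv, hva⟩ : ∃ u, t < u ∧ g u < a := by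
      simpa [rightReg, iInf_lt_iff] using ha
    filter_upwards [hu'.1.eventually (Iio_mem_nhds hv)] with n hn
    exact (hg (le_of_lt hn)).trans_lt hva

theorem measurable_rightReg {α : Type*} {m : MeasurableSpace α} {g : α → ℝ≥0 → ℝ≥0∞}
    (hg : ∀ a, Monotone (g a)) {t u : ℝ≥0} (htu : t < u)
    (hm : ∀ s < u, Measurable fun a => g a s) : Measurable fun a => rightReg (g a) t := by
  obtain ⟨N, hN⟩ := eventually_atTop.1 (((tendsto_dyadic_nextIndex t).mono_right
    nhdsWithin_le_nhds).eventually (Iio_mem_nhds htu))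
  refine measurable_of_tendsto_metrizable
    (f := fun n a => g a (dyadic (n + N) (nextIndex (n + N) t)))
    (fun n => hm _ (hN _ (Nat.le_add_left _ _))) (tendsto_pi_nhds.2 fun a => ?_)
  exact (tendsto_rightReg (hg a) (tendsto_dyadic_nextIndex t)).comp (tendsto_add_atTop_nat N)

/-- The infimum over `u > t` is a limit along times decreasing to `t`, hence it depends only on an
arbitrarily short stretch after `t`. -/
theorem measurable_rightCont_rightReg {Ω : Type*} {mΩ : MeasurableSpace Ω}
    {F : Filtration ℝ≥0 mΩ} {g : Ω → ℝ≥0 → ℝ≥0∞} (hg : ∀ ω, Monotone (g ω))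
    (hm : ∀ s, Measurable[F.rightCont s] fun ω => g ω s) (t : ℝ≥0) :
    Measurable[F.rightCont t] fun ω => rightReg (g ω) t :=
  measurable_rightCont_iff.2 fun u hu => measurable_rightReg (m := F u) hg hu fun s hs =>
    (hm s).mono (rightCont_le hs) le_rfl

/-- The running supremum of `b` over dyadic times. -/
noncomputable def dyadicSup (b : ℝ≥0 → ℝ≥0∞) (t : ℝ≥0) : ℝ≥0∞ :=
  ⨆ n, ⨆ k, if dyadic n k ≤ t then b (dyadic n k) else 0

theorem monotone_dyadicSup (b : ℝ≥0 → ℝ≥0∞) : Monotone (dyadicSup b) := fun s t hst => by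
  refine iSup_mono fun n => iSup_mono fun k => ?_
  by_cases h : dyadic n k ≤ s
  · rw [if_pos h, if_pos (h.trans hst)]
  · rw [if_neg h]; exact zero_le

theorem dyadicSup_eq {b : ℝ≥0 → ℝ≥0∞}
    (hb : ∀ n k n' k', dyadic n k ≤ dyadic n' k' → b (dyadic n k) ≤ b (dyadic n' k')) (n k : ℕ) :
    dyadicSup b (dyadic n k) = b (dyadic n k) := by
  refine le_antisymm (iSup_le fun n' => iSup_le fun k' => ?_) ?_
  · split_ifs with h
    · exact hb _ _ _ _ h
    · exact zero_le
  · refine le_trans ?_ (le_iSup_of_le n (le_iSup (fun k' =>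
      if dyadic n k' ≤ dyadic n k then b (dyadic n k') else 0) k))
    rw [if_pos le_rfl]

/-- The convex combination with weights `w` of the step paths of all levels. -/
noncomputable def approxPath (w : ℕ →₀ ℚ≥0) (α : ℕ → ℕ → ℝ) (t : ℝ≥0) : ℝ :=
  combination w fun n => stepPath n (α n) t

/-- The upper limit of the approximating paths. -/
noncomputable def limitPath (w : ℕ → (ℕ →₀ ℚ≥0)) (α : ℕ → ℕ → ℝ) (t : ℝ≥0) : ℝ≥0∞ :=
  limsup (fun j => ENNReal.ofReal (approxPath (w j) α t)) atTop

/-- The right-continuous path obtained from the limits of the approximating paths at dyadic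
times. -/
noncomputable def compensatorPath (w : ℕ → (ℕ →₀ ℚ≥0)) (α : ℕ → ℕ → ℝ) : ℝ≥0 → ℝ≥0∞ :=
  rightReg (dyadicSup (limitPath w α))

/-- The approximating paths converge at dyadic times. -/
structure ConvergesAtDyadic (w : ℕ → (ℕ →₀ ℚ≥0)) (α : ℕ → ℕ → ℝ) : Prop where
  mem_convexWeights : ∀ j, w j ∈ convexWeights j
  nonneg : ∀ n k, 0 ≤ α n k
  tendsto : ∀ n k, ∃ l : ℝ, Tendsto (fun j => approxPath (w j) α (dyadic n k)) atTop (𝓝 l)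

variable {w : ℕ → (ℕ →₀ ℚ≥0)} {α : ℕ → ℕ → ℝ}

theorem approxPath_nonneg (hα : ∀ n k, 0 ≤ α n k) (w : ℕ →₀ ℚ≥0) (t : ℝ≥0) :
    0 ≤ approxPath w α t :=
  combination_nonneg _ fun n => stepPath_nonneg n (hα n) t

theorem approxPath_zero (w : ℕ →₀ ℚ≥0) (α : ℕ → ℕ → ℝ) : approxPath w α 0 = 0 := by
  simp [approxPath, stepPath_zero, combination_eq_sum]

theorem limitPath_zero (w : ℕ → (ℕ →₀ ℚ≥0)) (α : ℕ → ℕ → ℝ) : limitPath w α 0 = 0 := by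
  simp [limitPath, approxPath_zero]

namespace ConvergesAtDyadic

theorem approxPath_mono (h : ConvergesAtDyadic w α) (j : ℕ) : Monotone (approxPath (w j) α) :=
  fun _ _ hst => combination_mono (h.mem_convexWeights j) fun n _ =>
    stepPath_mono n (h.nonneg n) hst

theorem limitPath_mono (h : ConvergesAtDyadic w α) : Monotone (limitPath w α) := fun _ _ hst =>
  limsup_le_limsup (.of_forall fun j => ENNReal.ofReal_le_ofReal (h.approxPath_mono j hst))

theorem tendsto_limitPath (h : ConvergesAtDyadic w α) (n k : ℕ) :
    limitPath w α (dyadic n k) ≠ ∞ ∧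
    Tendsto (fun j => approxPath (w j) α (dyadic n k)) atTop
      (𝓝 (limitPath w α (dyadic n k)).toReal) := by
  obtain ⟨l, hl⟩ := h.tendsto n k
  have h1 : limitPath w α (dyadic n k) = ENNReal.ofReal l :=
    ((ENNReal.continuous_ofReal.tendsto l).comp hl).limsup_eq
  have h2 : 0 ≤ l := ge_of_tendsto' hl fun j => approxPath_nonneg h.nonneg _ _
  rw [h1, ENNReal.toReal_ofReal h2]
  exact ⟨ENNReal.ofReal_ne_top, hl⟩

/-- On convergent paths the running supremum changes nothing. It is there to make `compensatorPath`
nondecreasing and right-continuous for arbitrary weights and jumps. -/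
theorem dyadicSup_limitPath (h : ConvergesAtDyadic w α) (n k : ℕ) :
    dyadicSup (limitPath w α) (dyadic n k) = limitPath w α (dyadic n k) :=
  dyadicSup_eq (fun _ _ _ _ hle => h.limitPath_mono hle) n k

theorem compensatorPath_le (h : ConvergesAtDyadic w α) {t : ℝ≥0} {n k : ℕ}
    (ht : t < dyadic n k) : compensatorPath w α t ≤ limitPath w α (dyadic n k) :=
  (rightReg_le _ ht).trans_eq (h.dyadicSup_limitPath n k)

theorem le_compensatorPath (h : ConvergesAtDyadic w α) (n k : ℕ) :
    limitPath w α (dyadic n k) ≤ compensatorPath w α (dyadic n k) :=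
  (h.dyadicSup_limitPath n k).symm.trans_le (le_rightReg (monotone_dyadicSup _) _)

theorem compensatorPath_ne_top (h : ConvergesAtDyadic w α) (t : ℝ≥0) :
    compensatorPath w α t ≠ ∞ :=
  ((h.compensatorPath_le (lt_dyadic_nextIndex 0 t)).trans_lt
    (h.tendsto_limitPath _ _).1.lt_top).ne

theorem tendsto_compensatorPath (h : ConvergesAtDyadic w α) (t : ℝ≥0) :
    Tendsto (fun n => limitPath w α (dyadic n (nextIndex n t))) atTop
      (𝓝 (compensatorPath w α t)) :=
  (tendsto_rightReg (monotone_dyadicSup _) (tendsto_dyadic_nextIndex t)).congr fun _ =>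
    h.dyadicSup_limitPath _ _

end ConvergesAtDyadic

end Regularization

/-! ### Convergence at dyadic times and the martingale property. -/

section Martingale

variable {Ω : Type*} {mΩ : MeasurableSpace Ω} {F : Filtration ℝ≥0 mΩ} {μ : Measure Ω}
  {x : Ω → ℝ≥0 → ℝ} {a : ℕ → ℕ → Ω → ℝ} {w : ℕ → (ℕ →₀ ℚ≥0)}

theorem measurable_stepPath {m : MeasurableSpace Ω} {n : ℕ} {t : ℝ≥0}
    (ha : ∀ k, dyadic n k < t → Measurable (a n k)) :
    Measurable fun ω => stepPath n (fun k => a n k ω) t := by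
  refine Finset.measurable_sum _ fun k _ => ?_
  by_cases h : dyadic n k < t
  · simpa only [if_pos h] using ha k h
  · simpa only [if_neg h] using measurable_const

theorem measurable_approxPath {m : MeasurableSpace Ω} {t : ℝ≥0}
    (ha : ∀ n k, dyadic n k < t → Measurable (a n k)) (w : ℕ →₀ ℚ≥0) :
    Measurable fun ω => approxPath w (fun n k => a n k ω) t :=
  measurable_combination w fun n => measurable_stepPath (ha n)

theorem measurable_limitPath {m : MeasurableSpace Ω} {t : ℝ≥0}
    (ha : ∀ n k, dyadic n k < t → Measurable (a n k)) :
    Measurable fun ω => limitPath w (fun n k => a n k ω) t :=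
  Measurable.limsup fun _ => (measurable_approxPath ha _).ennreal_ofReal

theorem measurable_dyadicSup {m : MeasurableSpace Ω} {t : ℝ≥0} {b : Ω → ℝ≥0 → ℝ≥0∞}
    (hb : ∀ n k, dyadic n k ≤ t → Measurable fun ω => b ω (dyadic n k)) :
    Measurable fun ω => dyadicSup (b ω) t := by
  refine Measurable.iSup fun n => Measurable.iSup fun k => ?_
  by_cases h : dyadic n k ≤ t
  · simpa only [if_pos h] using hb n k h
  · simpa only [if_neg h] using measurable_const

theorem IsUnitIncreasing.integrable_sub [IsFiniteMeasure μ] (hx : IsUnitIncreasing F μ x)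
    (s t : ℝ≥0) : Integrable (fun ω => x ω s - x ω t) μ := (hx.integrable s).sub (hx.integrable t)

namespace IsConvexApproximation

theorem measurable_of_lt (h : IsConvexApproximation F μ x a w) {t : ℝ≥0} (n k : ℕ)
    (hk : dyadic n k < t) : Measurable[F.rightCont t] (a n k) :=
  (h.discrete.measurable n k).mono (F.rightCont.mono hk.le) le_rfl

theorem adapted_limitPath (h : IsConvexApproximation F μ x a w) (t : ℝ≥0) :
    Measurable[F.rightCont t] fun ω => limitPath w (fun n k => a n k ω) t :=
  measurable_limitPath (m := F.rightCont t) h.measurable_of_lt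

theorem adapted_compensatorPath (h : IsConvexApproximation F μ x a w) (t : ℝ≥0) :
    Measurable[F.rightCont t] fun ω => compensatorPath w (fun n k => a n k ω) t :=
  measurable_rightCont_rightReg (fun _ => monotone_dyadicSup _) (fun s =>
    measurable_dyadicSup (m := F.rightCont s) fun _ _ hk =>
      (h.adapted_limitPath _).mono (F.rightCont.mono hk) le_rfl) t

theorem measurable_limitPath (h : IsConvexApproximation F μ x a w) (t : ℝ≥0) :
    Measurable fun ω => limitPath w (fun n k => a n k ω) t :=
  (h.adapted_limitPath t).mono (F.rightCont.le t) le_rfl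

theorem measurable_compensatorPath (h : IsConvexApproximation F μ x a w) (t : ℝ≥0) :
    Measurable fun ω => compensatorPath w (fun n k => a n k ω) t :=
  (h.adapted_compensatorPath t).mono (F.rightCont.le t) le_rfl

/-- This is the discrete martingale property: the compensated increments over intervals starting at
or after `dyadic n m` integrate to zero over `G`. -/
theorem setIntegral_terminalValue [IsFiniteMeasure μ] (h : IsConvexApproximation F μ x a w)
    {n m : ℕ} (hm : m ≤ 4 ^ n) {G : Set Ω} (hG : MeasurableSet[F.rightCont (dyadic n m)] G) :
    ∫ ω in G, terminalValue n (fun k => a n k ω) (x ω) ∂μ =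
      ∫ ω in G, (stepPath n (fun k => a n k ω) (dyadic n m) -
        (x ω (dyadic n m) - x ω 0)) ∂μ := by
  set D : ℕ → Ω → ℝ := fun k ω => a n k ω - (x ω (dyadic n (k + 1)) - x ω (dyadic n k)) with hD
  have hsum : ∀ (K : ℕ) ω, ∑ k ∈ Finset.range K, D k ω =
      ∑ k ∈ Finset.range K, a n k ω - (x ω (dyadic n K) - x ω 0) := fun K ω => by
    rw [Finset.sum_sub_distrib, Finset.sum_range_sub (fun k => x ω (dyadic n k)), dyadic_zero]
  have hDi : ∀ k, Integrable (D k) μ := fun k =>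
    (h.discrete.integrable n k).sub (h.unit.integrable_sub _ _)
  have h1 : ∀ ω, terminalValue n (fun k => a n k ω) (x ω) = ∑ k ∈ Finset.range (4 ^ n), D k ω :=
    fun ω => by rw [hsum, dyadic_four_pow]; rfl
  have h2 : ∀ ω, stepPath n (fun k => a n k ω) (dyadic n m) - (x ω (dyadic n m) - x ω 0) =
      ∑ k ∈ Finset.range m, D k ω := fun ω => by rw [hsum, stepPath_dyadic hm]
  simp_rw [h1, h2]
  rw [integral_finsetSum _ fun k _ => (hDi k).integrableOn,
    integral_finsetSum _ fun k _ => (hDi k).integrableOn]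
  refine (Finset.sum_subset (Finset.range_mono hm) fun k _ hk => ?_).symm
  have hmk : m ≤ k := by simpa using hk
  have hGk : MeasurableSet[F.rightCont (dyadic n k)] G :=
    F.rightCont.mono (dyadic_le_dyadic.2 hmk) G hG
  have := h.discrete.setIntegral n k hGk
  simp only [hD]
  rw [integral_sub (h.discrete.integrable n k).integrableOn
    (h.unit.integrable_sub _ _).integrableOn, this, sub_self]

theorem integrable_terminalValue [IsFiniteMeasure μ] (h : IsConvexApproximation F μ x a w)
    (n : ℕ) : Integrable (fun ω => terminalValue n (fun k => a n k ω) (x ω)) μ :=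
  integrable_of_abs_le (measurable_terminalValue h.unit h.discrete n)
    (abs_terminalValue_le h.unit h.discrete n)

theorem measurable_stepPath (h : IsConvexApproximation F μ x a w) (n : ℕ) (t : ℝ≥0) :
    Measurable fun ω => stepPath n (fun k => a n k ω) t :=
  MeasurableCompensator.measurable_stepPath fun k _ => h.discrete.measurable' n k

theorem measurable_approxPath (h : IsConvexApproximation F μ x a w) (v : ℕ →₀ ℚ≥0) (t : ℝ≥0) :
    Measurable fun ω => approxPath v (fun n k => a n k ω) t :=
  measurable_combination v fun n => h.measurable_stepPath n t

theorem integrable_stepPath [IsFiniteMeasure μ] (h : IsConvexApproximation F μ x a w) (n : ℕ)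
    (t : ℝ≥0) : Integrable (fun ω => stepPath n (fun k => a n k ω) t) μ :=
  integrable_of_abs_le (h.measurable_stepPath n t) (C := 4 ^ n) fun ω => by
    rw [abs_of_nonneg (stepPath_nonneg n (fun k => (h.discrete.mem n k ω).1) t)]
    exact stepPath_le n (fun k => h.discrete.mem n k ω) t

theorem integrable_approxPath [IsFiniteMeasure μ] (h : IsConvexApproximation F μ x a w)
    (v : ℕ →₀ ℚ≥0) (t : ℝ≥0) :
    Integrable (fun ω => approxPath v (fun n k => a n k ω) t) μ :=
  integrable_combination v fun n => h.integrable_stepPath n t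

/-- The index `N` is a level from which `q` lies in every grid, so each level carrying weight
satisfies the discrete martingale property at `q`. -/
theorem setIntegral_combination [IsFiniteMeasure μ] (h : IsConvexApproximation F μ x a w)
    {q : ℝ≥0} {N : ℕ} (hq : ∀ n ≥ N, ∃ m ≤ 4 ^ n, q = dyadic n m) {v : ℕ →₀ ℚ≥0}
    (hv : v ∈ convexWeights N) {G : Set Ω} (hG : MeasurableSet[F.rightCont q] G) :
    ∫ ω in G, combination v (fun n => terminalValue n (fun k => a n k ω) (x ω)) ∂μ =
      ∫ ω in G, (approxPath v (fun n k => a n k ω) q - (x ω q - x ω 0)) ∂μ := by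
  have h1 : ∀ ω, approxPath v (fun n k => a n k ω) q - (x ω q - x ω 0) =
      combination v fun n => stepPath n (fun k => a n k ω) q - (x ω q - x ω 0) := fun ω => by
    rw [combination_sub, combination_const hv]; rfl
  simp_rw [h1]
  rw [integral_combination v fun n => (h.integrable_terminalValue n).integrableOn,
    integral_combination v (x := fun n ω =>
      stepPath n (fun k => a n k ω) q - (x ω q - x ω 0)) fun n =>
        ((h.integrable_stepPath n q).sub (h.unit.integrable_sub _ _)).integrableOn]
  refine combination_congr hv fun n hn => ?_
  obtain ⟨m, hm, rfl⟩ := hq n hn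
  exact h.setIntegral_terminalValue hm hG

theorem condExp_combination [IsFiniteMeasure μ] (h : IsConvexApproximation F μ x a w)
    {q : ℝ≥0} {N : ℕ} (hq : ∀ n ≥ N, ∃ m ≤ 4 ^ n, q = dyadic n m) {v : ℕ →₀ ℚ≥0}
    (hv : v ∈ convexWeights N) :
    (fun ω => approxPath v (fun n k => a n k ω) q - (x ω q - x ω 0)) =ᵐ[μ]
      μ[fun ω => combination v (fun n => terminalValue n (fun k => a n k ω) (x ω)) |
        F.rightCont q] := by
  have hi : Integrable (fun ω => approxPath v (fun n k => a n k ω) q - (x ω q - x ω 0)) μ :=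
    (h.integrable_approxPath v q).sub (h.unit.integrable_sub _ _)
  refine ae_eq_condExp_of_forall_setIntegral_eq (F.rightCont.le q)
    (integrable_combination v h.integrable_terminalValue) (fun G _ _ => hi.integrableOn)
    (fun G hG _ => (h.setIntegral_combination hq hv hG).symm) ?_
  refine Measurable.aestronglyMeasurable ?_
  exact (MeasurableCompensator.measurable_approxPath (m := F.rightCont q)
    h.measurable_of_lt v).sub ((h.unit.adapted q).sub
      ((h.unit.adapted 0).mono (F.rightCont.mono zero_le) le_rfl))

/-- Conditional expectation contracts `L¹`, so the rapid convergence of the terminal values is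
inherited at `q`. The parts involving `x` cancel in the difference. -/
theorem eLpNorm_approxPath_sub_lt [IsFiniteMeasure μ] (h : IsConvexApproximation F μ x a w)
    {q : ℝ≥0} {N : ℕ} (hq : ∀ n ≥ N, ∃ m ≤ 4 ^ n, q = dyadic n m) (J i j : ℕ) (hi : J ≤ i)
    (hj : J ≤ j) :
    eLpNorm ((fun ω => approxPath (w (i + N)) (fun n k => a n k ω) q) -
      fun ω => approxPath (w (j + N)) (fun n k => a n k ω) q) 1 μ < 2 * 2⁻¹ ^ J := by
  have hw : ∀ i, w (i + N) ∈ convexWeights N := fun i =>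
    convexWeights_anti (Nat.le_add_left N i) (h.mem_convexWeights _)
  have hint := fun i => integrable_combination (μ := μ) (w (i + N)) h.integrable_terminalValue
  refine lt_of_le_of_lt ?_ (h.fast J (i + N) (j + N) (by omega) (by omega))
  refine le_trans (le_of_eq ?_) (eLpNorm_condExp_le_eLpNorm (m := F.rightCont q) _ le_rfl)
  refine eLpNorm_congr_ae ?_
  filter_upwards [h.condExp_combination hq (hw i), h.condExp_combination hq (hw j),
    condExp_sub (hint i) (hint j) (F.rightCont q)] with ω h1 h2 h3
  rw [h3, Pi.sub_apply, Pi.sub_apply, ← h1, ← h2]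
  ring

theorem ae_convergesAtDyadic [IsFiniteMeasure μ] (h : IsConvexApproximation F μ x a w) :
    ∀ᵐ ω ∂μ, ConvergesAtDyadic w fun n k => a n k ω := by
  have key : ∀ n k, ∀ᵐ ω ∂μ, ∃ l : ℝ,
      Tendsto (fun j => approxPath (w j) (fun n k => a n k ω) (dyadic n k)) atTop (𝓝 l) := by
    intro n k
    obtain ⟨N, hN⟩ := exists_dyadic_eq n k
    filter_upwards [Lp.ae_tendsto_of_cauchy_eLpNorm
      (f := fun j ω => approxPath (w (j + N)) (fun n k => a n k ω) (dyadic n k))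
      (fun j => (h.measurable_approxPath _ _).aestronglyMeasurable) le_rfl
      tsum_two_mul_half_pow_ne_top (h.eLpNorm_approxPath_sub_lt hN)] with ω ⟨l, hl⟩
    exact ⟨l, (tendsto_add_atTop_iff_nat N).1 hl⟩
  filter_upwards [ae_all_iff.2 fun n => ae_all_iff.2 (key n)] with ω hω
  exact ⟨h.mem_convexWeights, fun n k => (h.discrete.mem n k ω).1, hω⟩

theorem tendsto_eLpNorm_approxPath [IsFiniteMeasure μ] (h : IsConvexApproximation F μ x a w)
    (n k : ℕ) : Integrable (fun ω => (limitPath w (fun n k => a n k ω) (dyadic n k)).toReal) μ ∧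
    Tendsto (fun j => eLpNorm ((fun ω => approxPath (w j) (fun n k => a n k ω) (dyadic n k)) -
      fun ω => (limitPath w (fun n k => a n k ω) (dyadic n k)).toReal) 1 μ) atTop (𝓝 0) := by
  obtain ⟨N, hN⟩ := exists_dyadic_eq n k
  have hlim : ∀ᵐ ω ∂μ, Tendsto (fun j => approxPath (w (j + N)) (fun n k => a n k ω) (dyadic n k))
      atTop (𝓝 (limitPath w (fun n k => a n k ω) (dyadic n k)).toReal) := by
    filter_upwards [h.ae_convergesAtDyadic] with ω hω
    exact (hω.tendsto_limitPath n k).2.comp (tendsto_add_atTop_nat N)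
  have hL := Lp.cauchy_tendsto_of_tendsto
    (f := fun j ω => approxPath (w (j + N)) (fun n k => a n k ω) (dyadic n k))
    (fun j => (h.measurable_approxPath _ _).aestronglyMeasurable) _
    tsum_two_mul_half_pow_ne_top (h.eLpNorm_approxPath_sub_lt hN) hlim
  refine ⟨memLp_one_iff_integrable.1 (Lp.memLp_of_cauchy_tendsto le_rfl
    (fun j => memLp_one_iff_integrable.2 (h.integrable_approxPath (w (j + N)) (dyadic n k))) _
    (h.measurable_limitPath _).ennreal_toReal.aestronglyMeasurable hL), ?_⟩
  exact (tendsto_add_atTop_iff_nat N).1 hL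

theorem tendsto_setIntegral_approxPath [IsFiniteMeasure μ] (h : IsConvexApproximation F μ x a w)
    (n k : ℕ) (G : Set Ω) :
    Tendsto (fun j => ∫ ω in G, approxPath (w j) (fun n k => a n k ω) (dyadic n k) ∂μ) atTop
      (𝓝 (∫ ω in G, (limitPath w (fun n k => a n k ω) (dyadic n k)).toReal ∂μ)) :=
  tendsto_setIntegral_of_L1' _ (h.tendsto_eLpNorm_approxPath n k).1.aestronglyMeasurable
    (.of_forall fun j => h.integrable_approxPath (w j) (dyadic n k))
    (h.tendsto_eLpNorm_approxPath n k).2 G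

theorem setIntegral_limitPath_sub [IsFiniteMeasure μ] (h : IsConvexApproximation F μ x a w)
    {n k n' k' : ℕ} (hle : dyadic n k ≤ dyadic n' k') {G : Set Ω}
    (hG : MeasurableSet[F.rightCont (dyadic n k)] G) :
    ∫ ω in G, (limitPath w (fun n k => a n k ω) (dyadic n' k')).toReal ∂μ -
      ∫ ω in G, (limitPath w (fun n k => a n k ω) (dyadic n k)).toReal ∂μ =
    ∫ ω in G, x ω (dyadic n' k') ∂μ - ∫ ω in G, x ω (dyadic n k) ∂μ := by
  obtain ⟨N, hN⟩ := exists_dyadic_eq n k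
  obtain ⟨N', hN'⟩ := exists_dyadic_eq n' k'
  refine tendsto_nhds_unique ((h.tendsto_setIntegral_approxPath n' k' G).sub
    (h.tendsto_setIntegral_approxPath n k G)) (tendsto_const_nhds.congr' ?_)
  filter_upwards [eventually_ge_atTop N, eventually_ge_atTop N'] with j hj hj'
  have h1 := h.setIntegral_combination hN (convexWeights_anti hj (h.mem_convexWeights j)) hG
  have h2 := h.setIntegral_combination hN' (convexWeights_anti hj' (h.mem_convexWeights j))
    (F.rightCont.mono hle G hG)
  have hs : ∀ q, ∫ ω in G, (approxPath (w j) (fun n k => a n k ω) q - (x ω q - x ω 0)) ∂μ =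
      ∫ ω in G, approxPath (w j) (fun n k => a n k ω) q ∂μ -
        (∫ ω in G, x ω q ∂μ - ∫ ω in G, x ω 0 ∂μ) := fun q => by
    rw [← integral_sub (h.unit.integrable _).integrableOn (h.unit.integrable _).integrableOn,
      ← integral_sub (h.integrable_approxPath _ _).integrableOn
        (h.unit.integrable_sub _ _).integrableOn]
  rw [hs] at h1 h2
  linarith

theorem tendsto_setIntegral_nextIndex [IsFiniteMeasure μ] (h : IsConvexApproximation F μ x a w)
    (t : ℝ≥0) (G : Set Ω) :
    Integrable (fun ω => (compensatorPath w (fun n k => a n k ω) t).toReal) μ ∧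
    Tendsto (fun n => ∫ ω in G,
      (limitPath w (fun n k => a n k ω) (dyadic n (nextIndex n t))).toReal ∂μ) atTop
      (𝓝 (∫ ω in G, (compensatorPath w (fun n k => a n k ω) t).toReal ∂μ)) := by
  -- By monotonicity, the limit at an integer time beyond `t + 1` dominates all the approximations
  -- from the right of `t`.
  have hb := (h.tendsto_eLpNorm_approxPath 0 (nextIndex 0 (t + 1))).1
  have ht : ∀ n, dyadic n (nextIndex n t) ≤ dyadic 0 (nextIndex 0 (t + 1)) := fun n =>
    ((dyadic_nextIndex_le n t).trans (by gcongr; exact pow_le_one₀ zero_le (by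
      rw [div_le_one two_pos]; exact one_le_two))).trans (lt_dyadic_nextIndex 0 (t + 1)).le
  constructor
  · refine hb.mono' (h.measurable_compensatorPath t).ennreal_toReal.aestronglyMeasurable ?_
    filter_upwards [h.ae_convergesAtDyadic] with ω hω
    rw [Real.norm_eq_abs, abs_of_nonneg ENNReal.toReal_nonneg]
    exact ENNReal.toReal_mono (hω.tendsto_limitPath _ _).1 (hω.compensatorPath_le
      ((lt_dyadic_nextIndex 0 t).trans_le (ht 0)))
  · refine tendsto_integral_of_dominated_convergence _
      (fun n => (h.measurable_limitPath _).ennreal_toReal.aestronglyMeasurable) hb.integrableOn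
      (fun n => ?_) ?_
    · refine ae_restrict_of_ae ?_
      filter_upwards [h.ae_convergesAtDyadic] with ω hω
      rw [Real.norm_eq_abs, abs_of_nonneg ENNReal.toReal_nonneg]
      exact ENNReal.toReal_mono (hω.tendsto_limitPath _ _).1 (hω.limitPath_mono (ht n))
    · refine ae_restrict_of_ae ?_
      filter_upwards [h.ae_convergesAtDyadic] with ω hω
      exact (ENNReal.tendsto_toReal (hω.compensatorPath_ne_top t)).comp
        (hω.tendsto_compensatorPath t)

theorem tendsto_setIntegral_process [IsFiniteMeasure μ] (h : IsConvexApproximation F μ x a w)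
    (t : ℝ≥0) (G : Set Ω) :
    Tendsto (fun n => ∫ ω in G, x ω (dyadic n (nextIndex n t)) ∂μ) atTop
      (𝓝 (∫ ω in G, x ω t ∂μ)) := by
  refine tendsto_integral_of_dominated_convergence (fun _ => 1)
    (fun n => (h.unit.measurable _).aestronglyMeasurable) (integrable_const _)
    (fun n => .of_forall fun ω => ?_) (ae_restrict_of_ae ?_)
  · rw [Real.norm_eq_abs, abs_of_nonneg (h.unit.mem ω _).1]
    exact (h.unit.mem ω _).2
  · filter_upwards [h.unit.rightCont] with ω hω
    exact (hω t).tendsto.comp ((tendsto_dyadic_nextIndex t).mono_right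
      (nhdsWithin_mono _ Ioi_subset_Ici_self))

theorem setIntegral_compensatorPath_sub [IsFiniteMeasure μ]
    (h : IsConvexApproximation F μ x a w) {s t : ℝ≥0} (hst : s ≤ t) {G : Set Ω}
    (hG : MeasurableSet[F.rightCont s] G) :
    ∫ ω in G, (compensatorPath w (fun n k => a n k ω) t).toReal ∂μ -
      ∫ ω in G, (compensatorPath w (fun n k => a n k ω) s).toReal ∂μ =
    ∫ ω in G, x ω t ∂μ - ∫ ω in G, x ω s ∂μ := by
  refine tendsto_nhds_unique ((h.tendsto_setIntegral_nextIndex t G).2.sub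
    (h.tendsto_setIntegral_nextIndex s G).2) (((h.tendsto_setIntegral_process t G).sub
    (h.tendsto_setIntegral_process s G)).congr fun n => ?_)
  exact (h.setIntegral_limitPath_sub (dyadic_le_dyadic.2 (monotone_nextIndex n hst))
    (F.rightCont.mono (lt_dyadic_nextIndex n s).le G hG)).symm

/-- Regularization can only increase the value at a dyadic time, yet the expectations agree because
those of `x` are right-continuous. -/
theorem ae_compensatorPath_eq [IsFiniteMeasure μ] (h : IsConvexApproximation F μ x a w)
    (n k : ℕ) : ∀ᵐ ω ∂μ, compensatorPath w (fun n k => a n k ω) (dyadic n k) =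
      limitPath w (fun n k => a n k ω) (dyadic n k) := by
  set q := dyadic n k with hq
  have hi := (h.tendsto_setIntegral_nextIndex q univ).1
  have hi' := (h.tendsto_eLpNorm_approxPath n k).1
  have h1 : ∫ ω in univ, (compensatorPath w (fun n k => a n k ω) q).toReal ∂μ -
      ∫ ω in univ, (limitPath w (fun n k => a n k ω) q).toReal ∂μ =
      ∫ ω in univ, x ω q ∂μ - ∫ ω in univ, x ω q ∂μ := by
    refine tendsto_nhds_unique ((h.tendsto_setIntegral_nextIndex q univ).2.sub
      tendsto_const_nhds) (((h.tendsto_setIntegral_process q univ).sub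
      tendsto_const_nhds).congr fun n' => ?_)
    exact (h.setIntegral_limitPath_sub (lt_dyadic_nextIndex n' q).le MeasurableSet.univ).symm
  rw [setIntegral_univ, setIntegral_univ, sub_self, sub_eq_zero] at h1
  have hle : (fun ω => (limitPath w (fun n k => a n k ω) q).toReal) ≤ᵐ[μ]
      fun ω => (compensatorPath w (fun n k => a n k ω) q).toReal := by
    filter_upwards [h.ae_convergesAtDyadic] with ω hω
    exact ENNReal.toReal_mono (hω.compensatorPath_ne_top q) (hω.le_compensatorPath n k)
  filter_upwards [(integral_eq_iff_of_ae_le hi' hi hle).1 h1.symm, h.ae_convergesAtDyadic]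
    with ω h2 hω
  exact ((ENNReal.toReal_eq_toReal_iff' (hω.tendsto_limitPath n k).1
    (hω.compensatorPath_ne_top q)).1 h2).symm

theorem ae_compensatorPath_zero [IsFiniteMeasure μ] (h : IsConvexApproximation F μ x a w) :
    ∀ᵐ ω ∂μ, compensatorPath w (fun n k => a n k ω) 0 = 0 := by
  have := h.ae_compensatorPath_eq 0 0
  simpa only [dyadic_zero, limitPath_zero] using this

/-- The martingale identity is written with sums in `[0, ∞]`, free of subtraction, so that it can
later be summed over countably many slices. -/
theorem setLIntegral_compensatorPath [IsFiniteMeasure μ]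
    (h : IsConvexApproximation F μ x a w) {s t : ℝ≥0} (hst : s ≤ t) {G : Set Ω}
    (hG : MeasurableSet[F.rightCont s] G) :
    ∫⁻ ω in G, compensatorPath w (fun n k => a n k ω) t ∂μ +
      ∫⁻ ω in G, ENNReal.ofReal (x ω s) ∂μ =
    ∫⁻ ω in G, compensatorPath w (fun n k => a n k ω) s ∂μ +
      ∫⁻ ω in G, ENNReal.ofReal (x ω t) ∂μ := by
  have hA : ∀ t, ∫⁻ ω in G, compensatorPath w (fun n k => a n k ω) t ∂μ =
      ENNReal.ofReal (∫ ω in G, (compensatorPath w (fun n k => a n k ω) t).toReal ∂μ) := fun t => by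
    rw [ofReal_integral_eq_lintegral_ofReal (h.tendsto_setIntegral_nextIndex t univ).1.integrableOn
      (.of_forall fun _ => ENNReal.toReal_nonneg)]
    refine lintegral_congr_ae (ae_restrict_of_ae ?_)
    filter_upwards [h.ae_convergesAtDyadic] with ω hω
    exact (ENNReal.ofReal_toReal (hω.compensatorPath_ne_top t)).symm
  have hX : ∀ t, ∫⁻ ω in G, ENNReal.ofReal (x ω t) ∂μ = ENNReal.ofReal (∫ ω in G, x ω t ∂μ) :=
    fun t => (ofReal_integral_eq_lintegral_ofReal (h.unit.integrable t).integrableOn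
      (.of_forall fun ω => (h.unit.mem ω t).1)).symm
  have hA0 : ∀ t, 0 ≤ ∫ ω in G, (compensatorPath w (fun n k => a n k ω) t).toReal ∂μ := fun t =>
    integral_nonneg fun _ => ENNReal.toReal_nonneg
  have hX0 : ∀ t, 0 ≤ ∫ ω in G, x ω t ∂μ := fun t => integral_nonneg fun ω => (h.unit.mem ω t).1
  rw [hA, hA, hX, hX, ← ENNReal.ofReal_add (hA0 t) (hX0 s), ← ENNReal.ofReal_add (hA0 s) (hX0 t)]
  congr 1
  linarith [h.setIntegral_compensatorPath_sub hst hG]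

end IsConvexApproximation

end Martingale

/-! ### First passage times. -/

section Passage

/-- The first time before `T` at which the path `g` reaches the level `r`, and `T` if there is no
such time. -/
noncomputable def passageTime (g : ℝ≥0 → ℝ≥0∞) (r : ℝ≥0∞) (T : ℝ≥0) : ℝ≥0 :=
  sInf {t | r ≤ g t ∨ T ≤ t}

/-- Right-continuity keeps `g` below `r` for a little while after `s`. The resulting description of
`{s < σ}` shows that passage times are stopping times. -/
theorem lt_passageTime_iff {g : ℝ≥0 → ℝ≥0∞} (hg : Monotone g)
    (hc : ∀ t, ContinuousWithinAt g (Ici t) t) {r : ℝ≥0∞} {s T : ℝ≥0} :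
    s < passageTime g r T ↔ g s < r ∧ s < T := by
  constructor
  · intro h
    have : s ∉ {t | r ≤ g t ∨ T ≤ t} := fun hs => (notMem_of_lt_csInf h (OrderBot.bddBelow _)) hs
    simpa only [mem_ofPred_eq, not_or, not_le] using this
  · rintro ⟨h1, h2⟩
    have hev : ∀ᶠ u in 𝓝[>] s, g u < r ∧ u < T := by
      refine Filter.Eventually.and ?_ (mem_nhdsWithin_of_mem_nhds (Iio_mem_nhds h2))
      exact ((hc s).mono Ioi_subset_Ici_self).eventually (Iio_mem_nhds h1)
    obtain ⟨u, hu, hsu⟩ := (hev.and self_mem_nhdsWithin).exists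
    refine lt_of_lt_of_le hsu (le_csInf ⟨T, Or.inr le_rfl⟩ fun v hv => ?_)
    by_contra hvu
    rw [not_le] at hvu
    rcases hv with hv | hv
    · exact absurd (hv.trans (hg hvu.le)) (not_le.2 hu.1)
    · exact absurd (hv.trans hvu.le) (not_le.2 hu.2)

theorem passageTime_le (g : ℝ≥0 → ℝ≥0∞) (r : ℝ≥0∞) (T : ℝ≥0) : passageTime g r T ≤ T :=
  csInf_le (OrderBot.bddBelow _) (Or.inr le_rfl)

/-- The sum telescopes to the first grid point at or after `σ`, where `g` is at least `g σ`. -/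
theorem sub_le_sum_dyadic {g : ℝ≥0 → ℝ} (hg : Monotone g) {n : ℕ} {σ : ℝ≥0} (hσ : σ ≤ 2 ^ n) :
    g σ - g 0 ≤ ∑ k ∈ Finset.range (4 ^ n),
      if dyadic n k < σ then g (dyadic n (k + 1)) - g (dyadic n k) else 0 := by
  set m := ⌈σ * 2 ^ n⌉₊ with hm
  have hlt : ∀ k, dyadic n k < σ ↔ k < m := fun k => by
    rw [hm, Nat.lt_ceil, dyadic, div_lt_iff₀ (by positivity)]
  have hm4 : m ≤ 4 ^ n := by
    rw [hm, Nat.ceil_le]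
    push_cast
    calc σ * 2 ^ n ≤ 2 ^ n * 2 ^ n := by gcongr
      _ = 4 ^ n := by rw [← mul_pow]; norm_num
  have hσm : σ ≤ dyadic n m := by
    rw [dyadic, le_div_iff₀ (by positivity)]
    exact Nat.le_ceil _
  simp only [hlt]
  rw [← Finset.sum_filter]
  have : (Finset.range (4 ^ n)).filter (· < m) = Finset.range m := by
    ext k; simp only [Finset.mem_filter, Finset.mem_range]; omega
  rw [this, Finset.sum_range_sub (fun k => g (dyadic n k)), dyadic_zero]
  linarith [hg hσm]

theorem stepPath_eq_sum_indicator {Ω : Type*} (a : ℕ → ℕ → Ω → ℝ) (σ : Ω → ℝ≥0) (n : ℕ) (ω : Ω) :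
    stepPath n (fun k => a n k ω) (σ ω) =
      ∑ k ∈ Finset.range (4 ^ n), {ω | dyadic n k < σ ω}.indicator (a n k) ω :=
  Finset.sum_congr rfl fun k _ => by simp [indicator]

end Passage

namespace ConvergesAtDyadic

variable {w : ℕ → (ℕ →₀ ℚ≥0)} {α : ℕ → ℕ → ℝ}

theorem limitPath_le_compensatorPath (h : ConvergesAtDyadic w α) (t : ℝ≥0) :
    limitPath w α t ≤ compensatorPath w α t :=
  ge_of_tendsto' (h.tendsto_compensatorPath t) fun n =>
    h.limitPath_mono (lt_dyadic_nextIndex n t).le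

/-- The upper limit of the approximating paths agrees with the compensator path as soon as it does
so at all first passage times of rational levels. -/
theorem limitPath_eq_compensatorPath (h : ConvergesAtDyadic w α)
    (hσ : ∀ (r : ℚ) (T : ℕ),
      limitPath w α (passageTime (compensatorPath w α) (Real.toNNReal r : ℝ≥0∞) T) =
        compensatorPath w α (passageTime (compensatorPath w α) (Real.toNNReal r : ℝ≥0∞) T))
    (t : ℝ≥0) : limitPath w α t = compensatorPath w α t := by
  refine le_antisymm (h.limitPath_le_compensatorPath t) (not_lt.1 fun hlt => ?_)
  -- Before `t` the compensator path is at most `limitPath w α t < r`, and at `t` it exceeds `r`; so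
  -- the level `r` is first reached exactly at `t`.
  obtain ⟨r, -, hr1, hr2⟩ := ENNReal.lt_iff_exists_rat_btwn.1 hlt
  obtain ⟨T, hT⟩ := exists_nat_gt t
  have hpt : passageTime (compensatorPath w α) (Real.toNNReal r : ℝ≥0∞) T = t := by
    refine le_antisymm (not_lt.1 fun hlt' => ?_) (le_of_forall_lt fun s hs => ?_)
    · exact absurd ((lt_passageTime_iff (monotone_rightReg _)
        (continuousWithinAt_rightReg _)).1 hlt').1 (not_lt.2 hr2.le)
    · refine (lt_passageTime_iff (monotone_rightReg _)
        (continuousWithinAt_rightReg _)).2 ⟨?_, hs.trans hT⟩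
      obtain ⟨n, k, hk1, hk2⟩ := exists_dyadic_between hs
      exact ((h.compensatorPath_le hk1).trans (h.limitPath_mono hk2.le)).trans_lt hr1
  have := hσ r T
  rw [hpt] at this
  exact hlt.ne this

theorem ofReal_sub_le_liminf (h : ConvergesAtDyadic w α) {σ : ℝ≥0} {n k : ℕ} {c : ℝ}
    (hc : limitPath w α σ < ENNReal.ofReal c) :
    ENNReal.ofReal ((limitPath w α (dyadic n k)).toReal - c) ≤
      liminf (fun j => ENNReal.ofReal (approxPath (w j) α (dyadic n k) -
        approxPath (w j) α σ)) atTop := by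
  have h1 : Tendsto (fun j => ENNReal.ofReal (approxPath (w j) α (dyadic n k) - c)) atTop
      (𝓝 (ENNReal.ofReal ((limitPath w α (dyadic n k)).toReal - c))) :=
    (ENNReal.continuous_ofReal.tendsto _).comp ((h.tendsto_limitPath n k).2.sub_const c)
  rw [← h1.liminf_eq]
  refine liminf_le_liminf ?_
  filter_upwards [eventually_lt_of_limsup_lt hc] with j hj
  have : approxPath (w j) α σ < c := (ENNReal.ofReal_lt_ofReal_iff_of_nonneg
    (approxPath_nonneg h.nonneg _ _)).1 hj
  exact ENNReal.ofReal_le_ofReal (by linarith)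

end ConvergesAtDyadic

theorem lintegral_ofReal_sub {Ω : Type*} {mΩ : MeasurableSpace Ω} {μ : Measure Ω} {f g : Ω → ℝ}
    (hf : Integrable f μ) (hg : Integrable g μ) (h : g ≤ᵐ[μ] f) :
    ∫⁻ ω, ENNReal.ofReal (f ω - g ω) ∂μ = ENNReal.ofReal (∫ ω, f ω ∂μ - ∫ ω, g ω ∂μ) := by
  rw [← integral_sub hf hg]
  exact (ofReal_integral_eq_lintegral_ofReal (hf.sub hg)
    (h.mono fun ω hω => sub_nonneg.2 hω)).symm

/-! ### Convergence of the approximations at passage times. -/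

section PassageConvergence

variable {Ω : Type*} {mΩ : MeasurableSpace Ω} {F : Filtration ℝ≥0 mΩ} {μ : Measure Ω}
  {x : Ω → ℝ≥0 → ℝ} {a : ℕ → ℕ → Ω → ℝ} {w : ℕ → (ℕ →₀ ℚ≥0)}

namespace IsConvexApproximation

theorem measurableSet_lt_passageTime (h : IsConvexApproximation F μ x a w) (r : ℝ≥0∞)
    (T s : ℝ≥0) : MeasurableSet[F.rightCont s]
      {ω | s < passageTime (compensatorPath w fun n k => a n k ω) r T} := by
  have : {ω | s < passageTime (compensatorPath w fun n k => a n k ω) r T} =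
      {ω | compensatorPath w (fun n k => a n k ω) s < r} ∩ {ω | s < T} := by
    ext ω
    exact lt_passageTime_iff (monotone_rightReg _) (continuousWithinAt_rightReg _)
  rw [this]
  exact MeasurableSet.inter (m := F.rightCont s) (h.adapted_compensatorPath s measurableSet_Iio)
    (MeasurableSet.const _)

theorem measurable_passageTime (h : IsConvexApproximation F μ x a w) (r : ℝ≥0∞) (T : ℝ≥0) :
    Measurable fun ω => passageTime (compensatorPath w fun n k => a n k ω) r T :=
  measurable_of_Ioi fun s => F.rightCont.le s _ (h.measurableSet_lt_passageTime r T s)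

theorem measurable_compensatorPath_uncurry (h : IsConvexApproximation F μ x a w) :
    Measurable fun y : Ω × ℝ≥0 => compensatorPath w (fun n k => a n k y.1) y.2 :=
  measurable_of_rightContinuous h.measurable_compensatorPath
    fun _ t => continuousWithinAt_rightReg _ t

theorem measurable_stepPath_comp (h : IsConvexApproximation F μ x a w) {σ : Ω → ℝ≥0}
    (hσ : Measurable σ) (n : ℕ) : Measurable fun ω => stepPath n (fun k => a n k ω) (σ ω) := by
  simp_rw [stepPath_eq_sum_indicator]
  exact Finset.measurable_sum _ fun k _ => (h.discrete.measurable' n k).indicator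
    (measurableSet_lt measurable_const hσ)

theorem integrable_stepPath_comp [IsFiniteMeasure μ] (h : IsConvexApproximation F μ x a w)
    {σ : Ω → ℝ≥0} (hσ : Measurable σ) (n : ℕ) :
    Integrable (fun ω => stepPath n (fun k => a n k ω) (σ ω)) μ :=
  integrable_of_abs_le (h.measurable_stepPath_comp hσ n) (C := 4 ^ n) fun ω => by
    rw [abs_of_nonneg (stepPath_nonneg n (fun k => (h.discrete.mem n k ω).1) _)]
    exact stepPath_le n (fun k => h.discrete.mem n k ω) _

theorem integrable_compensatorPath_comp [IsFiniteMeasure μ] (h : IsConvexApproximation F μ x a w)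
    {σ : Ω → ℝ≥0} (hσ : Measurable σ) {T : ℝ≥0} (hT : ∀ ω, σ ω ≤ T) :
    Integrable (fun ω => (compensatorPath w (fun n k => a n k ω) (σ ω)).toReal) μ := by
  have hm : Measurable fun ω => (compensatorPath w (fun n k => a n k ω) (σ ω)).toReal :=
    (h.measurable_compensatorPath_uncurry.comp (measurable_id.prodMk hσ)).ennreal_toReal
  refine (h.tendsto_setIntegral_nextIndex T univ).1.mono' hm.aestronglyMeasurable ?_
  filter_upwards [h.ae_convergesAtDyadic] with ω hω
  rw [Real.norm_eq_abs, abs_of_nonneg ENNReal.toReal_nonneg]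
  exact ENNReal.toReal_mono (hω.compensatorPath_ne_top T) (monotone_rightReg _ (hT ω))

/-- Optional stopping at a first passage time. -/
theorem integral_compensatorPath_le [IsFiniteMeasure μ] (h : IsConvexApproximation F μ x a w)
    (r : ℝ≥0∞) {T : ℝ≥0} {n : ℕ} (hT : T ≤ 2 ^ n) :
    ∫ ω, (compensatorPath w (fun n k => a n k ω)
      (passageTime (compensatorPath w fun n k => a n k ω) r T)).toReal ∂μ ≤
    ∫ ω, stepPath n (fun k => a n k ω)
      (passageTime (compensatorPath w fun n k => a n k ω) r T) ∂μ := by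
  set σ : Ω → ℝ≥0 := fun ω => passageTime (compensatorPath w fun n k => a n k ω) r T with hσ
  have hσm : Measurable σ := h.measurable_passageTime r T
  set A : Ω → ℝ≥0 → ℝ := fun ω t => (compensatorPath w (fun n k => a n k ω) t).toReal with hA
  have hAi : ∀ t, Integrable (fun ω => A ω t) μ := fun t =>
    (h.tendsto_setIntegral_nextIndex t univ).1
  have hG : ∀ k, MeasurableSet[F.rightCont (dyadic n k)] {ω | dyadic n k < σ ω} := fun k =>
    h.measurableSet_lt_passageTime r T _
  have hG' : ∀ k, MeasurableSet {ω | dyadic n k < σ ω} := fun k => F.rightCont.le _ _ (hG k)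
  have hi : ∀ k, Integrable ({ω | dyadic n k < σ ω}.indicator
      fun ω => A ω (dyadic n (k + 1)) - A ω (dyadic n k)) μ := fun k =>
    ((hAi _).sub (hAi _)).indicator (hG' k)
  calc ∫ ω, A ω (σ ω) ∂μ
      ≤ ∫ ω, ∑ k ∈ Finset.range (4 ^ n), {ω | dyadic n k < σ ω}.indicator
          (fun ω => A ω (dyadic n (k + 1)) - A ω (dyadic n k)) ω ∂μ := by
        refine integral_mono_ae (h.integrable_compensatorPath_comp hσm fun ω =>
          passageTime_le _ _ _) (integrable_finsetSum _ fun k _ => hi k) ?_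
        filter_upwards [h.ae_convergesAtDyadic, h.ae_compensatorPath_zero] with ω hω h0
        have hmono : Monotone (A ω) := fun s t hst =>
          ENNReal.toReal_mono (hω.compensatorPath_ne_top t) (monotone_rightReg _ hst)
        have hA0 : A ω 0 = 0 := by simp [hA, h0]
        have := sub_le_sum_dyadic hmono (n := n) (σ := σ ω) ((passageTime_le _ _ _).trans hT)
        rw [hA0, sub_zero] at this
        refine this.trans_eq (Finset.sum_congr rfl fun k _ => ?_)
        simp [indicator]
    -- The event `{dyadic n k < σ}` is known at the start of the interval, and over it both `a n k`
    -- and the increment of `A` have the integral of the increment of `x`.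
    _ = ∑ k ∈ Finset.range (4 ^ n), ∫ ω in {ω | dyadic n k < σ ω}, a n k ω ∂μ := by
        rw [integral_finsetSum _ fun k _ => hi k]
        refine Finset.sum_congr rfl fun k _ => ?_
        rw [integral_indicator (hG' k), h.discrete.setIntegral n k (hG k),
          integral_sub (hAi _).integrableOn (hAi _).integrableOn,
          integral_sub (h.unit.integrable _).integrableOn (h.unit.integrable _).integrableOn]
        exact h.setIntegral_compensatorPath_sub (dyadic_le_dyadic.2 k.le_succ) (hG k)
    _ = ∫ ω, stepPath n (fun k => a n k ω) (σ ω) ∂μ := by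
        simp_rw [stepPath_eq_sum_indicator]
        rw [integral_finsetSum _ fun k _ => (h.discrete.integrable n k).indicator (hG' k)]
        exact Finset.sum_congr rfl fun k _ => (integral_indicator (hG' k)).symm

/-- Let `R_j` be the approximations. Pointwise, `liminf (R_j(T) - R_j(σ))` is at least `A_T - limsup
R_j(σ)`, hence at least `A_T - A_σ`. Optional stopping gives `E A_σ ≤ E R_j(σ)` eventually, so by
Fatou's lemma the expectation of the lower limit is at most `E (A_T - A_σ)`. All these inequalities
are therefore equalities almost surely. -/
theorem ae_limitPath_passageTime [IsProbabilityMeasure μ] (h : IsConvexApproximation F μ x a w)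
    (r : ℝ≥0∞) (T : ℕ) :
    ∀ᵐ ω ∂μ, limitPath w (fun n k => a n k ω)
        (passageTime (compensatorPath w fun n k => a n k ω) r T) =
      compensatorPath w (fun n k => a n k ω)
        (passageTime (compensatorPath w fun n k => a n k ω) r T) := by
  set σ : Ω → ℝ≥0 := fun ω => passageTime (compensatorPath w fun n k => a n k ω) r T with hσ
  have hσm : Measurable σ := h.measurable_passageTime r T
  have hσT : ∀ ω, σ ω ≤ T := fun ω => passageTime_le _ _ _
  have hTd : (T : ℝ≥0) = dyadic 0 T := by simp [dyadic]
  set A : Ω → ℝ≥0 → ℝ := fun ω t => (compensatorPath w (fun n k => a n k ω) t).toReal with hA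
  have hAT : ∀ᵐ ω ∂μ, A ω T = (limitPath w (fun n k => a n k ω) (dyadic 0 T)).toReal := by
    filter_upwards [h.ae_compensatorPath_eq 0 T] with ω hω
    simp only [hA, hTd, hω]
  have hAσi : Integrable (fun ω => A ω (σ ω)) μ := h.integrable_compensatorPath_comp hσm hσT
  have hATi : Integrable (fun ω => A ω T) μ := (h.tendsto_setIntegral_nextIndex _ univ).1
  have hRσm : ∀ j, Measurable fun ω => approxPath (w j) (fun n k => a n k ω) (σ ω) := fun j =>
    measurable_combination _ fun n => h.measurable_stepPath_comp hσm n
  have hRσi : ∀ j, Integrable (fun ω => approxPath (w j) (fun n k => a n k ω) (σ ω)) μ := fun j =>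
    integrable_combination _ fun n => h.integrable_stepPath_comp hσm n
  have hRTm := fun j => h.measurable_approxPath (w j) (dyadic 0 T)
  have hRTi := fun j => h.integrable_approxPath (w j) (dyadic 0 T)
  set f : ℕ → Ω → ℝ≥0∞ := fun j ω => ENNReal.ofReal
    (approxPath (w j) (fun n k => a n k ω) (dyadic 0 T) -
      approxPath (w j) (fun n k => a n k ω) (σ ω)) with hf
  have hfm : ∀ j, Measurable (f j) := fun j => ((hRTm j).sub (hRσm j)).ennreal_ofReal
  have hAσ : ∀ᵐ ω ∂μ, A ω (σ ω) ≤ A ω T := by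
    filter_upwards [h.ae_convergesAtDyadic] with ω hω
    exact ENNReal.toReal_mono (hω.compensatorPath_ne_top _) (monotone_rightReg _ (hσT ω))
  have hfatou : ∫⁻ ω, liminf (fun j => f j ω) atTop ∂μ ≤
      ∫⁻ ω, ENNReal.ofReal (A ω T - A ω (σ ω)) ∂μ := by
    refine (lintegral_liminf_le hfm).trans ?_
    have hlim : Tendsto (fun j => ENNReal.ofReal
        (∫ ω, approxPath (w j) (fun n k => a n k ω) (dyadic 0 T) ∂μ - ∫ ω, A ω (σ ω) ∂μ)) atTop
        (𝓝 (∫⁻ ω, ENNReal.ofReal (A ω T - A ω (σ ω)) ∂μ)) := by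
      rw [lintegral_ofReal_sub hATi hAσi hAσ, integral_congr_ae hAT]
      have := h.tendsto_setIntegral_approxPath 0 T univ
      simp only [Measure.restrict_univ] at this
      exact (ENNReal.continuous_ofReal.tendsto _).comp (this.sub_const _)
    rw [← hlim.liminf_eq]
    refine liminf_le_liminf ?_
    obtain ⟨N, hN⟩ : ∃ N : ℕ, ∀ n ≥ N, (T : ℝ≥0) ≤ 2 ^ n := ⟨T, fun n hn => by
      have : T ≤ 2 ^ n := hn.le.trans n.lt_two_pow_self.le
      exact_mod_cast this⟩
    filter_upwards [eventually_ge_atTop N] with j hj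
    rw [lintegral_ofReal_sub (hRTi j) (hRσi j) ?_]
    · refine ENNReal.ofReal_le_ofReal (sub_le_sub_left ?_ _)
      unfold approxPath
      rw [integral_combination _ fun n => h.integrable_stepPath_comp hσm n,
        ← combination_const (h.mem_convexWeights j) (∫ ω, A ω (σ ω) ∂μ)]
      exact combination_mono (h.mem_convexWeights j) fun n hn =>
        h.integral_compensatorPath_le r (hN n (hj.trans hn))
    · filter_upwards [h.ae_convergesAtDyadic] with ω hω
      simpa [hTd] using hω.approxPath_mono j (hσT ω)
  have hge : (fun ω => ENNReal.ofReal (A ω T - A ω (σ ω))) ≤ᵐ[μ]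
      fun ω => liminf (fun j => f j ω) atTop := by
    filter_upwards [h.ae_convergesAtDyadic, hAT] with ω hω hωT
    rw [hωT]
    have hc : ContinuousWithinAt (fun c => ENNReal.ofReal
        ((limitPath w (fun n k => a n k ω) (dyadic 0 T)).toReal - c)) (Ioi (A ω (σ ω)))
        (A ω (σ ω)) :=
      (ENNReal.continuous_ofReal.comp (continuous_const.sub continuous_id)).continuousWithinAt
    refine le_of_tendsto hc.tendsto ?_
    filter_upwards [self_mem_nhdsWithin] with c hc
    refine hω.ofReal_sub_le_liminf ((hω.limitPath_le_compensatorPath _).trans_lt ?_)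
    rw [← ENNReal.ofReal_toReal (hω.compensatorPath_ne_top (σ ω))]
    exact (ENNReal.ofReal_lt_ofReal_iff (ENNReal.toReal_nonneg.trans_lt hc)).2 hc
  have heq := ae_eq_of_ae_le_of_lintegral_le hge (hATi.sub hAσi).lintegral_lt_top.ne
    (Measurable.liminf hfm).aemeasurable hfatou
  filter_upwards [heq, h.ae_convergesAtDyadic, hAT, hAσ] with ω h1 hω hωT hωσ
  refine le_antisymm (hω.limitPath_le_compensatorPath _) (not_lt.1 fun hlt => ?_)
  -- A value `c` strictly between the upper limit and `A_σ` would force `A_T - c ≤ A_T - A_σ`.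
  obtain ⟨c, hc1, hc2⟩ := ENNReal.lt_iff_exists_nnreal_btwn.1 hlt
  have h2 := hω.ofReal_sub_le_liminf (n := 0) (k := T) (σ := σ ω) (c := c) (by simpa using hc1)
  have h3 : (c : ℝ) < A ω (σ ω) := by
    rw [← ENNReal.ofReal_toReal (hω.compensatorPath_ne_top (σ ω)), ← ENNReal.ofReal_coe_nnreal]
      at hc2
    exact (ENNReal.ofReal_lt_ofReal_iff_of_nonneg c.2).1 hc2
  rw [← hωT] at h2
  have h4 := h2.trans_eq h1.symm
  rw [ENNReal.ofReal_le_ofReal_iff (by linarith)] at h4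
  linarith

theorem ae_limitPath_eq [IsProbabilityMeasure μ] (h : IsConvexApproximation F μ x a w) :
    ∀ᵐ ω ∂μ, ∀ t, limitPath w (fun n k => a n k ω) t =
      compensatorPath w (fun n k => a n k ω) t := by
  filter_upwards [h.ae_convergesAtDyadic, ae_all_iff.2 fun r : ℚ => ae_all_iff.2 fun T : ℕ =>
    h.ae_limitPath_passageTime (Real.toNNReal r : ℝ≥0∞) T] with ω hω hσ
  exact hω.limitPath_eq_compensatorPath hσ

end IsConvexApproximation

end PassageConvergence

/-! ### Predictability for the augmented filtration. -/

section Predictable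

variable {Ω : Type*} {mΩ : MeasurableSpace Ω} {F : Filtration ℝ≥0 mΩ} {μ : Measure Ω}

/-- The predictable σ-field of the usual augmentation. -/
noncomputable abbrev augPredictable (F : Filtration ℝ≥0 mΩ) (μ : Measure Ω) : MeasurableSpace (Ω × ℝ≥0) :=
  predictableSigma (nullSigma μ) (usualAugmentation F μ)

theorem measurable_augPredictable {H : Ω → ℝ≥0 → ℝ}
    (h0 : Measurable[nullSigma μ] fun ω => H ω 0)
    (hm : ∀ t, 0 < t → Measurable[⨆ (s : ℝ≥0) (_ : s < t), usualAugmentation F μ s]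
      fun ω => H ω t)
    (hc : ∀ ω t, 0 < t → ContinuousWithinAt (H ω) (Iic t) t) :
    Measurable[augPredictable F μ] fun y : Ω × ℝ≥0 => H y.1 y.2 := by
  refine measurable_iff_comap_le.2 (le_iSup₂_of_le H ⟨fun t => ?_, hc⟩ le_rfl)
  rcases eq_or_ne t 0 with rfl | ht
  · rwa [show leftLimit (nullSigma μ) (usualAugmentation F μ) 0 = nullSigma μ from if_pos rfl]
  · rw [show leftLimit (nullSigma μ) (usualAugmentation F μ) t =
      ⨆ (s : ℝ≥0) (_ : s < t), usualAugmentation F μ s from if_neg ht]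
    exact hm t (pos_iff_ne_zero.2 ht)

theorem rightCont_le_usualAugmentation (t : ℝ≥0) : F.rightCont t ≤ usualAugmentation F μ t :=
  le_sup_left (a := F.rightCont t) (b := nullSigma μ)

theorem nullSigma_le_usualAugmentation (t : ℝ≥0) : nullSigma μ ≤ usualAugmentation F μ t :=
  le_sup_right (a := F.rightCont t) (b := nullSigma μ)

/-- Time-constant indicators of sets in the null σ-field, and deterministic time itself, are adapted
with continuous paths, even with the σ-field prescribed at `0-`. -/
theorem nullSigma_prod_le_augPredictable :
    (nullSigma μ).prod (inferInstance : MeasurableSpace ℝ≥0) ≤ augPredictable F μ := by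
  refine sup_le ?_ ?_
  · rintro _ ⟨N, hN, rfl⟩
    have hi : Measurable[nullSigma μ] (N.indicator (1 : Ω → ℝ)) :=
      (measurable_indicator_const_iff (1 : ℝ)).2 hN
    have h := measurable_augPredictable (F := F) (μ := μ) (H := fun ω _ => N.indicator 1 ω)
      hi (fun t ht => hi.mono ((nullSigma_le_usualAugmentation 0).trans
        (le_iSup₂_of_le 0 ht le_rfl)) le_rfl) (fun _ _ _ => continuousWithinAt_const)
    have : (Prod.fst ⁻¹' N : Set (Ω × ℝ≥0)) =
        (fun y : Ω × ℝ≥0 => N.indicator (1 : Ω → ℝ) y.1) ⁻¹' {1} := by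
      ext y; by_cases hy : y.1 ∈ N <;> simp [hy]
    rw [this]
    exact h (measurableSet_singleton 1)
  · have h := measurable_augPredictable (F := F) (μ := μ) (H := fun _ t => (t : ℝ))
      measurable_const (fun _ _ => measurable_const)
      (fun _ _ _ => NNReal.continuous_coe.continuousWithinAt)
    have h2 : Measurable[augPredictable F μ] fun y : Ω × ℝ≥0 => Real.toNNReal (y.2 : ℝ) :=
      measurable_real_toNNReal.comp h
    simp only [Real.toNNReal_coe] at h2
    exact measurable_iff_comap_le.1 h2

/-- A measurable subset of a null set is itself a generator. Each preimage is such a subset or the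
complement of one, according to whether the target set contains `0`. -/
theorem measurable_nullSigma_indicator {β : Type*} [MeasurableSpace β] [Zero β] {N : Set Ω}
    (hN : MeasurableSet N) (hN0 : μ N = 0) {f : Ω → β} (hf : Measurable f) :
    Measurable[nullSigma μ] (N.indicator f) := by
  have key : ∀ B : Set Ω, MeasurableSet B → B ⊆ N → MeasurableSet[nullSigma μ] B :=
    fun B hB hBN => MeasurableSpace.measurableSet_generateFrom ⟨hB, measure_mono_null hBN hN0⟩
  intro B hB
  have hm : MeasurableSet (N.indicator f ⁻¹' B) := hf.indicator hN hB
  by_cases h0 : (0 : β) ∈ B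
  · refine (@MeasurableSet.compl_iff _ _ (nullSigma μ)).1 (key _ hm.compl fun ω hω => ?_)
    by_contra hωN
    exact hω (by simpa [hωN] using h0)
  · refine key _ hm fun ω hω => ?_
    by_contra hωN
    exact h0 (by simpa [hωN] using hω)

/-- A right-continuous measurable process that is indistinguishable from a predictable process
is predictable for the augmented filtration. -/
theorem measurable_augPredictable_of_ae_eq {g I : Ω → ℝ≥0 → ℝ≥0∞}
    (hg : ∀ t, Measurable fun ω => g ω t) (hc : ∀ ω t, ContinuousWithinAt (g ω) (Ici t) t)
    (hI : Measurable[augPredictable F μ] fun y : Ω × ℝ≥0 => I y.1 y.2)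
    (h : ∀ᵐ ω ∂μ, ∀ t, I ω t = g ω t) :
    Measurable[augPredictable F μ] fun y : Ω × ℝ≥0 => g y.1 y.2 := by
  classical
  obtain ⟨N, hsub, hN, hN0⟩ := exists_measurable_superset_of_null h
  have h1 : Measurable[augPredictable F μ] fun y : Ω × ℝ≥0 => N.indicator (fun ω => g ω y.2) y.1 := by
    have := @measurable_of_rightContinuous Ω ℝ≥0∞ (nullSigma μ) _ _ _ _
      (fun ω t => N.indicator (fun ω => g ω t) ω)
      (fun t => measurable_nullSigma_indicator hN hN0 (hg t)) (fun ω t => by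
        by_cases hω : ω ∈ N
        · simpa [hω] using hc ω t
        · simpa [hω] using continuousWithinAt_const)
    exact this.mono nullSigma_prod_le_augPredictable le_rfl
  have hNp : MeasurableSet[augPredictable F μ] (Prod.fst ⁻¹' N : Set (Ω × ℝ≥0)) := by
    refine nullSigma_prod_le_augPredictable _ ?_
    exact (@measurable_fst Ω ℝ≥0 (nullSigma μ) _)
      (MeasurableSpace.measurableSet_generateFrom ⟨hN, hN0⟩)
  -- On the exceptional set the process `g` itself is used, which is predictable there because all
  -- its measurable events inside `N` are null.
  have h2 : Measurable[augPredictable F μ] fun y : Ω × ℝ≥0 =>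
      if y.1 ∈ N then N.indicator (fun ω => g ω y.2) y.1 else I y.1 y.2 :=
    Measurable.ite (m := augPredictable F μ) hNp h1 hI
  refine (congrArg _ ?_).mp h2
  funext y
  by_cases hy : y.1 ∈ N
  · simp [hy]
  · have : ∀ t, I y.1 t = g y.1 t := by
      by_contra hcon
      exact hy (hsub hcon)
    simp [hy, this]

variable {x : Ω → ℝ≥0 → ℝ} {a : ℕ → ℕ → Ω → ℝ} {w : ℕ → (ℕ →₀ ℚ≥0)}

/-- A jump entering the value at `t` is known at a grid time strictly before `t`, and the value at
time zero is `0`, hence measurable for any `F_{0-}`. -/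
theorem IsConvexApproximation.measurable_augPredictable_stepPath
    (h : IsConvexApproximation F μ x a w) (n : ℕ) :
    Measurable[augPredictable F μ] fun y : Ω × ℝ≥0 => stepPath n (fun k => a n k y.1) y.2 := by
  refine measurable_augPredictable (H := fun ω t => stepPath n (fun k => a n k ω) t) ?_
    (fun t _ => ?_) fun ω t _ => continuousWithinAt_stepPath n _ t
  · simpa only [stepPath_zero] using measurable_const
  · refine MeasurableCompensator.measurable_stepPath
      (m := ⨆ (s : ℝ≥0) (_ : s < t), usualAugmentation F μ s) fun k hk => ?_
    exact (h.discrete.measurable n k).mono ((rightCont_le_usualAugmentation _).trans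
      (le_iSup₂_of_le _ hk le_rfl)) le_rfl

theorem IsConvexApproximation.measurable_augPredictable_compensatorPath [IsProbabilityMeasure μ]
    (h : IsConvexApproximation F μ x a w) :
    Measurable[augPredictable F μ]
      fun y : Ω × ℝ≥0 => compensatorPath w (fun n k => a n k y.1) y.2 := by
  refine measurable_augPredictable_of_ae_eq (g := fun ω => compensatorPath w (fun n k => a n k ω))
    (I := fun ω => limitPath w (fun n k => a n k ω)) h.measurable_compensatorPath
    (fun _ t => continuousWithinAt_rightReg _ t) ?_ h.ae_limitPath_eq
  exact Measurable.limsup (mδ := augPredictable F μ) fun j => Measurable.ennreal_ofReal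
    (measurable_combination (m := augPredictable F μ) (w j)
      fun n => h.measurable_augPredictable_stepPath n)

end Predictable

/-- `A` is a predictable compensator of the increasing process `x`, with values in `[0, ∞]`. -/
structure IsIncreasingCompensator {Ω : Type*} {mΩ : MeasurableSpace Ω} (F : Filtration ℝ≥0 mΩ)
    (μ : Measure Ω) (x : Ω → ℝ≥0 → ℝ) (A : Ω → ℝ≥0 → ℝ≥0∞) : Prop where
  mono : ∀ ω, Monotone (A ω)
  rightCont : ∀ ω t, ContinuousWithinAt (A ω) (Ici t) t
  adapted : ∀ t, Measurable[F.rightCont t] fun ω => A ω t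
  ne_top : ∀ᵐ ω ∂μ, ∀ t, A ω t ≠ ∞
  zero : ∀ᵐ ω ∂μ, A ω 0 = 0
  setLIntegral : ∀ s t, s ≤ t → ∀ G, MeasurableSet[F.rightCont s] G →
    ∫⁻ ω in G, A ω t ∂μ + ∫⁻ ω in G, ENNReal.ofReal (x ω s) ∂μ =
      ∫⁻ ω in G, A ω s ∂μ + ∫⁻ ω in G, ENNReal.ofReal (x ω t) ∂μ
  predictable : Measurable[augPredictable F μ] fun y : Ω × ℝ≥0 => A y.1 y.2

section Unit

variable {E Ω : Type*} [mE : MeasurableSpace E] [mΩ : MeasurableSpace Ω]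

theorem IsConvexApproximation.isIncreasingCompensator {F : Filtration ℝ≥0 mΩ} {μ : Measure Ω}
    [IsProbabilityMeasure μ] {x : Ω → ℝ≥0 → ℝ} {a : ℕ → ℕ → Ω → ℝ} {w : ℕ → (ℕ →₀ ℚ≥0)}
    (h : IsConvexApproximation F μ x a w) :
    IsIncreasingCompensator F μ x fun ω => compensatorPath w fun n k => a n k ω where
  mono _ := monotone_rightReg _
  rightCont _ := continuousWithinAt_rightReg _
  adapted := h.adapted_compensatorPath
  ne_top := by
    filter_upwards [h.ae_convergesAtDyadic] with ω hω
    exact hω.compensatorPath_ne_top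
  zero := h.ae_compensatorPath_zero
  setLIntegral _ _ hst _ hG := h.setLIntegral_compensatorPath hst hG
  predictable := h.measurable_augPredictable_compensatorPath

theorem exists_compensator_of_unit (κ : Kernel E Ω) [IsMarkovKernel κ] (F : Filtration ℝ≥0 mΩ)
    (hF : ∀ t, @MeasurableSpace.CountablyGenerated Ω (F t)) {x : E → Ω → ℝ≥0 → ℝ}
    (hxm : ∀ t, Measurable (Function.uncurry fun P ω => x P ω t))
    (hx : ∀ P, IsUnitIncreasing F (κ P) (x P)) :
    ∃ A : E → Ω → ℝ≥0 → ℝ≥0∞, (∀ t, Measurable (Function.uncurry fun P ω => A P ω t)) ∧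
      ∀ P, IsIncreasingCompensator F (κ P) (x P) (A P) := by
  obtain ⟨a, e, i, ham, him, h⟩ := exists_convexApproximation κ F hF hxm hx
  refine ⟨fun P ω => compensatorPath (fun j => e (i j P)) fun n k => a n k P ω, fun t => ?_,
    fun P => (h P).isIncreasingCompensator⟩
  have h1 : ∀ j t, Measurable (Function.uncurry fun P ω =>
      approxPath (e (i j P)) (fun n k => a n k P ω) t) := fun j t =>
    measurable_comp_index (Y := fun l P ω => approxPath (e l) (fun n k => a n k P ω) t)
      (fun l => measurable_approxPath (a := fun n k (y : E × Ω) => a n k y.1 y.2)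
        (fun n k _ => ham n k) (e l)) (him j)
  exact measurable_rightReg (fun y : E × Ω => monotone_dyadicSup _) (lt_add_one t) fun s _ =>
    measurable_dyadicSup fun n k _ => Measurable.limsup fun j => (h1 j _).ennreal_ofReal

end Unit

/-! ### From bounded to integrable increasing processes. -/

section Truncation

/-- The part of `r` between the levels `c` and `c + 1`. -/
noncomputable def slice (c : ℕ) (r : ℝ) : ℝ := max 0 (min 1 (r - c))

theorem slice_mem (c : ℕ) (r : ℝ) : slice c r ∈ Icc (0 : ℝ) 1 :=
  ⟨le_max_left _ _, max_le zero_le_one (min_le_left _ _)⟩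

theorem monotone_slice (c : ℕ) : Monotone (slice c) := fun r s h => by
  unfold slice; gcongr

theorem continuous_slice (c : ℕ) : Continuous (slice c) := by
  unfold slice; fun_prop

theorem sum_slice {r : ℝ} (hr : 0 ≤ r) (n : ℕ) : ∑ c ∈ Finset.range n, slice c r = min (n : ℝ) r := by
  induction n with
  | zero => simp [hr]
  | succ n ih =>
    rw [Finset.sum_range_succ, ih, slice]
    push_cast
    rcases le_total r n with h | h
    · rw [min_eq_right h, min_eq_right (by linarith : r ≤ n + 1),
        min_eq_right (by linarith : r - n ≤ 1), max_eq_left (by linarith)]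
      ring
    · rw [min_eq_left h]
      rcases le_total r (n + 1) with h' | h'
      · rw [min_eq_right h', min_eq_right (by linarith : r - n ≤ 1), max_eq_right (by linarith)]
        ring
      · rw [min_eq_left h', min_eq_left (by linarith : 1 ≤ r - n), max_eq_right zero_le_one]

theorem tsum_slice {r : ℝ} (hr : 0 ≤ r) : ∑' c, ENNReal.ofReal (slice c r) = ENNReal.ofReal r := by
  refine HasSum.tsum_eq ((ENNReal.hasSum_iff_tendsto_nat _).2 ?_)
  obtain ⟨N, hN⟩ := exists_nat_ge r
  refine tendsto_const_nhds.congr' ?_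
  filter_upwards [eventually_ge_atTop N] with n hn
  rw [← ENNReal.ofReal_sum_of_nonneg fun c _ => (slice_mem c r).1, sum_slice hr,
    min_eq_right (hN.trans (by exact_mod_cast hn))]

theorem tendsto_tsum_of_dominated {f : ℕ → ℕ → ℝ≥0∞} {g b : ℕ → ℝ≥0∞}
    (hb : ∑' c, b c ≠ ∞) (hfb : ∀ n c, f n c ≤ b c)
    (hf : ∀ c, Tendsto (fun n => f n c) atTop (𝓝 (g c))) :
    Tendsto (fun n => ∑' c, f n c) atTop (𝓝 (∑' c, g c)) := by
  simp only [← lintegral_count] at hb ⊢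
  exact tendsto_lintegral_of_dominated_convergence b (fun n => .of_discrete)
    (fun n => .of_forall (hfb n)) hb (.of_forall hf)

end Truncation

section Integrable

variable {E Ω : Type*} [mE : MeasurableSpace E] [mΩ : MeasurableSpace Ω]

/-- A nonnegative integrable process whose paths are almost surely nondecreasing and
right-continuous. -/
structure IsIntegrableIncreasing {Ω : Type*} {mΩ : MeasurableSpace Ω} (F : Filtration ℝ≥0 mΩ)
    (μ : Measure Ω) (y : Ω → ℝ≥0 → ℝ) : Prop where
  adapted : ∀ t, Measurable[F.rightCont t] fun ω => y ω t
  nonneg : ∀ ω t, 0 ≤ y ω t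
  lintegral_ne_top : ∀ t, ∫⁻ ω, ENNReal.ofReal (y ω t) ∂μ ≠ ∞
  mono : ∀ᵐ ω ∂μ, Monotone (y ω)
  rightCont : ∀ᵐ ω ∂μ, ∀ t, ContinuousWithinAt (y ω) (Ici t) t

theorem IsIntegrableIncreasing.slice {F : Filtration ℝ≥0 mΩ} {μ : Measure Ω} {y : Ω → ℝ≥0 → ℝ}
    (hy : IsIntegrableIncreasing F μ y) (c : ℕ) :
    IsUnitIncreasing F μ fun ω t => slice c (y ω t) where
  adapted t := (continuous_slice c).measurable.comp (hy.adapted t)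
  mem _ _ := slice_mem c _
  mono := hy.mono.mono fun _ h => (monotone_slice c).comp h
  rightCont := hy.rightCont.mono fun _ h t =>
    (continuous_slice c).continuousAt.comp_continuousWithinAt (h t)

/-- The identities for the slices add up by monotone convergence. The sum is almost surely finite at
all times, and dominated convergence over the slices then makes it right-continuous; regularization
only repairs the paths on which it may explode. -/
theorem isIncreasingCompensator_rightReg_tsum {F : Filtration ℝ≥0 mΩ} {μ : Measure Ω}
    {y : Ω → ℝ≥0 → ℝ} (hy : IsIntegrableIncreasing F μ y) {B : ℕ → Ω → ℝ≥0 → ℝ≥0∞}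
    (hB : ∀ c, IsIncreasingCompensator F μ (fun ω t => slice c (y ω t)) (B c)) :
    IsIncreasingCompensator F μ y fun ω => rightReg fun t => ∑' c, B c ω t := by
  have hmono : ∀ ω, Monotone fun t => ∑' c, B c ω t := fun ω s t hst =>
    ENNReal.tsum_le_tsum fun c => (hB c).mono ω hst
  have hBm : ∀ c t, Measurable fun ω => B c ω t := fun c t =>
    ((hB c).adapted t).mono (F.rightCont.le t) le_rfl
  have hym : ∀ t, Measurable fun ω => y ω t := fun t =>
    (hy.adapted t).mono (F.rightCont.le t) le_rfl
  have hslice : ∀ (G : Set Ω) t, ∑' c, ∫⁻ ω in G, ENNReal.ofReal (slice c (y ω t)) ∂μ =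
      ∫⁻ ω in G, ENNReal.ofReal (y ω t) ∂μ := fun G t => by
    have hm : ∀ c, Measurable fun ω => ENNReal.ofReal (slice c (y ω t)) := fun c =>
      ((continuous_slice c).measurable.comp (hym t)).ennreal_ofReal
    rw [← lintegral_tsum fun c => (hm c).aemeasurable]
    exact lintegral_congr fun ω => tsum_slice (hy.nonneg ω t)
  have hfin : ∀ᵐ ω ∂μ, ∀ t, ∑' c, B c ω t ≠ ∞ := by
    have h1 : ∀ T : ℕ, ∀ᵐ ω ∂μ, ∑' c, B c ω T < ∞ := fun T => by
      refine ae_lt_top (Measurable.tsum fun c => hBm c T) ?_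
      rw [lintegral_tsum fun c => (hBm c T).aemeasurable]
      refine ((ENNReal.tsum_le_tsum fun c => ?_).trans_lt
        ((hslice univ T).trans_lt (by simpa using (hy.lintegral_ne_top T).lt_top))).ne
      have h2 := (hB c).setLIntegral 0 T zero_le univ MeasurableSet.univ
      have h3 : ∫⁻ ω, B c ω 0 ∂μ = 0 := by
        rw [lintegral_congr_ae (hB c).zero]; simp
      simp only [Measure.restrict_univ, h3, zero_add] at h2 ⊢
      exact h2 ▸ le_self_add
    filter_upwards [ae_all_iff.2 h1] with ω hω t
    obtain ⟨T, hT⟩ := exists_nat_ge t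
    exact ((hmono ω hT).trans_lt (hω T)).ne
  have heq : ∀ᵐ ω ∂μ, ∀ t, ∑' c, B c ω t = rightReg (fun t => ∑' c, B c ω t) t := by
    filter_upwards [hfin] with ω hω t
    refine tendsto_nhds_unique ?_ (tendsto_rightReg (hmono ω) (tendsto_dyadic_nextIndex t))
    -- The finite sum at time `t + 1` dominates, since the dyadic times approaching `t` stay below
    -- `t + 1`.
    refine tendsto_tsum_of_dominated (hω (t + 1)) (fun n c => (hB c).mono ω ?_) fun c =>
      ((hB c).rightCont ω t).tendsto.comp ((tendsto_dyadic_nextIndex t).mono_right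
        (nhdsWithin_mono _ Ioi_subset_Ici_self))
    refine (dyadic_nextIndex_le n t).trans ?_
    gcongr
    exact pow_le_one₀ zero_le (by rw [div_le_one two_pos]; exact one_le_two)
  have hadapted : ∀ t, Measurable[F.rightCont t] fun ω => rightReg (fun t => ∑' c, B c ω t) t :=
    measurable_rightCont_rightReg hmono fun s =>
      @Measurable.tsum Ω _ ℕ (F.rightCont s) _ _ _ _ _ _ _ _ _ _ _ _ fun c => (hB c).adapted s
  refine ⟨fun ω => monotone_rightReg _, fun ω => continuousWithinAt_rightReg _, hadapted,
    ?_, ?_, fun s t hst G hG => ?_, ?_⟩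
  · filter_upwards [hfin, heq] with ω h1 h2 t
    rw [← h2]; exact h1 t
  · filter_upwards [heq, ae_all_iff.2 fun c => (hB c).zero] with ω h1 h2
    rw [← h1]; simp [h2]
  · have hA : ∀ t, ∫⁻ ω in G, rightReg (fun t => ∑' c, B c ω t) t ∂μ =
        ∑' c, ∫⁻ ω in G, B c ω t ∂μ := fun t => by
      rw [← lintegral_tsum fun c => (hBm c t).aemeasurable]
      refine lintegral_congr_ae (ae_restrict_of_ae ?_)
      filter_upwards [heq] with ω hω using (hω t).symm
    rw [hA, hA, ← hslice, ← hslice, ← ENNReal.tsum_add, ← ENNReal.tsum_add]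
    exact tsum_congr fun c => (hB c).setLIntegral s t hst G hG
  · refine measurable_augPredictable_of_ae_eq (g := fun ω => rightReg fun t => ∑' c, B c ω t)
      (I := fun ω t => ∑' c, B c ω t) (fun t => (hadapted t).mono (F.rightCont.le t) le_rfl)
      (fun ω => continuousWithinAt_rightReg _) ?_ heq
    exact @Measurable.tsum _ _ ℕ (augPredictable F μ) _ _ _ _ _ _ _ _ _ _ _ _ fun c => (hB c).predictable

theorem exists_compensator_of_integrable (κ : Kernel E Ω) [IsMarkovKernel κ]
    (F : Filtration ℝ≥0 mΩ) (hF : ∀ t, @MeasurableSpace.CountablyGenerated Ω (F t))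
    {y : E → Ω → ℝ≥0 → ℝ} (hym : ∀ t, Measurable (Function.uncurry fun P ω => y P ω t))
    (hy : ∀ P, IsIntegrableIncreasing F (κ P) (y P)) :
    ∃ A : E → Ω → ℝ≥0 → ℝ≥0∞, (∀ t, Measurable (Function.uncurry fun P ω => A P ω t)) ∧
      ∀ P, IsIncreasingCompensator F (κ P) (y P) (A P) := by
  choose B hBm hB using fun c => exists_compensator_of_unit κ F hF
    (x := fun P ω t => slice c (y P ω t))
    (fun t => (continuous_slice c).measurable.comp (hym t)) fun P => (hy P).slice c
  refine ⟨fun P ω => rightReg fun t => ∑' c, B c P ω t, fun t => ?_, fun P =>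
    isIncreasingCompensator_rightReg_tsum (hy P) fun c => hB c P⟩
  exact measurable_rightReg (g := fun (z : E × Ω) t => ∑' c, B c z.1 z.2 t)
    (fun z s t hst => ENNReal.tsum_le_tsum fun c => (hB c z.1).mono z.2 hst) (lt_add_one t)
    fun s _ => Measurable.tsum fun c => hBm c s

end Integrable

/-! ### Variation along dyadic times and the Jordan decomposition. -/

/-- The variation of `f` up to time `t` along the dyadic grid of level `n`. -/
noncomputable def gridVar (f : ℝ≥0 → ℝ) (n : ℕ) (t : ℝ≥0) : ℝ≥0∞ :=
  ∑ k ∈ Finset.range (4 ^ n), if dyadic n (k + 1) ≤ t then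
    edist (f (dyadic n (k + 1))) (f (dyadic n k)) else 0

theorem monotone_gridVar (f : ℝ≥0 → ℝ) (n : ℕ) : Monotone (gridVar f n) := fun s t hst => by
  refine Finset.sum_le_sum fun k _ => ?_
  by_cases h : dyadic n (k + 1) ≤ s
  · rw [if_pos h, if_pos (h.trans hst)]
  · rw [if_neg h]; exact zero_le

theorem gridVar_le (f : ℝ≥0 → ℝ) (n : ℕ) (t : ℝ≥0) : gridVar f n t ≤ eVariationOn f univ := by
  refine le_trans (Finset.sum_le_sum fun k _ => ?_) (eVariationOn.sum_le (n := 4 ^ n)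
    (u := dyadic n) (fun i j h => dyadic_le_dyadic.2 h) fun _ => mem_univ _)
  split_ifs
  · exact le_rfl
  · exact zero_le

theorem gridVar_dyadic (f : ℝ≥0 → ℝ) {n j : ℕ} (hj : j ≤ 4 ^ n) :
    gridVar f n (dyadic n j) =
      ∑ k ∈ Finset.range j, edist (f (dyadic n (k + 1))) (f (dyadic n k)) := by
  unfold gridVar
  rw [← Finset.sum_filter]
  refine Finset.sum_congr ?_ fun _ _ => rfl
  ext k
  simp only [Finset.mem_filter, Finset.mem_range, dyadic_le_dyadic]
  omega

theorem gridVar_add_edist_le (f : ℝ≥0 → ℝ) {n i j : ℕ} (hij : i ≤ j) (hj : j ≤ 4 ^ n) :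
    gridVar f n (dyadic n i) + edist (f (dyadic n i)) (f (dyadic n j)) ≤
      gridVar f n (dyadic n j) := by
  rw [gridVar_dyadic f (hij.trans hj), gridVar_dyadic f hj,
    ← Finset.sum_range_add_sum_Ico _ hij]
  gcongr
  refine (edist_le_Ico_sum_edist (fun k => f (dyadic n k)) hij).trans_eq ?_
  exact Finset.sum_congr rfl fun _ _ => edist_comm _ _

/-- The variation of `f` up to time `t` along the dyadic times. -/
noncomputable def dyadicVar (f : ℝ≥0 → ℝ) (t : ℝ≥0) : ℝ≥0∞ :=
  limsup (fun n => gridVar f n t) atTop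

theorem monotone_dyadicVar (f : ℝ≥0 → ℝ) : Monotone (dyadicVar f) := fun _ _ hst =>
  limsup_le_limsup (.of_forall fun n => monotone_gridVar f n hst)

theorem dyadicVar_le (f : ℝ≥0 → ℝ) (t : ℝ≥0) : dyadicVar f t ≤ eVariationOn f univ :=
  limsup_le_of_le (h := .of_forall fun n => gridVar_le f n t)

theorem dyadicVar_add_edist_le (f : ℝ≥0 → ℝ) {n i m j : ℕ} (h : dyadic n i ≤ dyadic m j) :
    dyadicVar f (dyadic n i) + edist (f (dyadic n i)) (f (dyadic m j)) ≤
      dyadicVar f (dyadic m j) := by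
  unfold dyadicVar
  rw [← limsup_add_const _ _ _ (by isBoundedDefault) (by isBoundedDefault)]
  refine limsup_le_limsup ?_
  obtain ⟨N, hN⟩ := exists_dyadic_eq n i
  obtain ⟨M, hM⟩ := exists_dyadic_eq m j
  filter_upwards [eventually_ge_atTop N, eventually_ge_atTop M] with l hl hl'
  obtain ⟨a, -, ha⟩ := hN l hl
  obtain ⟨b, hb, hb'⟩ := hM l hl'
  rw [ha, hb'] at h ⊢
  exact gridVar_add_edist_le f (dyadic_le_dyadic.1 h) hb

/-- The variation process of a right-continuous path. -/
noncomputable def variationPath (f : ℝ≥0 → ℝ) : ℝ≥0 → ℝ≥0∞ := rightReg (dyadicVar f)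

theorem monotone_variationPath (f : ℝ≥0 → ℝ) : Monotone (variationPath f) := monotone_rightReg _

theorem variationPath_le (f : ℝ≥0 → ℝ) (t : ℝ≥0) : variationPath f t ≤ eVariationOn f univ :=
  (rightReg_le _ (lt_add_one t)).trans (dyadicVar_le f _)

/-- Grid sums satisfy this inequality at dyadic times, and right-continuity extends it to all times.
It is all that the Jordan decomposition requires; no identification with the total variation on `[0,
t]` is needed. -/
theorem variationPath_add_edist_le {f : ℝ≥0 → ℝ} (hf : IsRightContinuousPath f) {s t : ℝ≥0}
    (hst : s ≤ t) : variationPath f s + edist (f s) (f t) ≤ variationPath f t := by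
  have hlim : ∀ t, Tendsto (fun n => f (dyadic n (nextIndex n t))) atTop (𝓝 (f t)) := fun t =>
    (hf t).tendsto.comp ((tendsto_dyadic_nextIndex t).mono_right
      (nhdsWithin_mono _ Ioi_subset_Ici_self))
  refine le_of_tendsto_of_tendsto'
    ((tendsto_rightReg (monotone_dyadicVar f) (tendsto_dyadic_nextIndex s)).add
      ((hlim s).edist (hlim t)))
    (tendsto_rightReg (monotone_dyadicVar f) (tendsto_dyadic_nextIndex t)) fun n => ?_
  exact dyadicVar_add_edist_le f (dyadic_le_dyadic.2 (monotone_nextIndex n hst))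

section Measurability

variable {α : Type*} {m : MeasurableSpace α} {f : α → ℝ≥0 → ℝ}

theorem measurable_dyadicVar {t : ℝ≥0} (hf : ∀ s ≤ t, Measurable fun a => f a s) :
    Measurable fun a => dyadicVar (f a) t := by
  refine Measurable.limsup fun n => Finset.measurable_fun_sum _ fun k _ => ?_
  split_ifs with h
  · exact (hf _ h).edist (hf _ ((dyadic_le_dyadic.2 k.le_succ).trans h))
  · exact measurable_const

theorem measurable_variationPath (hf : ∀ s, Measurable fun a => f a s) (t : ℝ≥0) :
    Measurable fun a => variationPath (f a) t :=
  measurable_rightReg (fun _ => monotone_dyadicVar _) (lt_add_one t) fun _ _ =>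
    measurable_dyadicVar fun _ _ => hf _

end Measurability

theorem measurable_rightCont_variationPath {Ω : Type*} {mΩ : MeasurableSpace Ω}
    {F : Filtration ℝ≥0 mΩ} {f : Ω → ℝ≥0 → ℝ}
    (hf : ∀ s, Measurable[F.rightCont s] fun ω => f ω s) (t : ℝ≥0) :
    Measurable[F.rightCont t] fun ω => variationPath (f ω) t :=
  measurable_rightCont_rightReg (fun _ => monotone_dyadicVar _) (fun _ =>
    measurable_dyadicVar fun _ hr => (hf _).mono (F.rightCont.mono hr) le_rfl) t

/-- The positive and negative variation (`ε = 1` and `ε = -1`) of a right-continuous path. -/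
noncomputable def signedVar (ε : ℝ) (f : ℝ≥0 → ℝ) (t : ℝ≥0) : ℝ :=
  max 0 (((variationPath f t).toReal + ε * (f t - f 0)) / 2)

section SignedVar

variable {f : ℝ≥0 → ℝ} {ε : ℝ}

theorem abs_sub_le_toReal_variationPath (hf : IsRightContinuousPath f)
    (hv : ∀ t, variationPath f t ≠ ∞) {s t : ℝ≥0} (hst : s ≤ t) :
    |f t - f s| ≤ (variationPath f t).toReal - (variationPath f s).toReal := by
  have h := ENNReal.toReal_mono (hv t) (variationPath_add_edist_le hf hst)
  rw [ENNReal.toReal_add (hv s) (edist_ne_top _ _), ← dist_edist, dist_comm, Real.dist_eq] at h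
  linarith

theorem abs_sub_zero_le (hf : IsRightContinuousPath f) (hv : ∀ t, variationPath f t ≠ ∞)
    (t : ℝ≥0) : |f t - f 0| ≤ (variationPath f t).toReal :=
  (abs_sub_le_toReal_variationPath hf hv (zero_le : 0 ≤ t)).trans
    (sub_le_self _ ENNReal.toReal_nonneg)

/-- The truncation at `0` has no effect here. It secures nonnegativity on paths of infinite
variation, where `toReal` of `∞` is `0`. -/
theorem signedVar_eq (hf : IsRightContinuousPath f) (hv : ∀ t, variationPath f t ≠ ∞)
    (hε : |ε| = 1) (t : ℝ≥0) :
    signedVar ε f t = ((variationPath f t).toReal + ε * (f t - f 0)) / 2 := by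
  have h1 := abs_sub_zero_le hf hv t
  have h2 := neg_abs_le (ε * (f t - f 0))
  rw [abs_mul, hε, one_mul] at h2
  exact max_eq_right (by linarith)

theorem signedVar_sub (hf : IsRightContinuousPath f) (hv : ∀ t, variationPath f t ≠ ∞)
    (t : ℝ≥0) : signedVar 1 f t - signedVar (-1) f t = f t - f 0 := by
  rw [signedVar_eq hf hv (by simp), signedVar_eq hf hv (by simp)]
  ring

theorem monotone_signedVar (hf : IsRightContinuousPath f) (hv : ∀ t, variationPath f t ≠ ∞)
    (hε : |ε| = 1) : Monotone (signedVar ε f) := fun s t hst => by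
  rw [signedVar_eq hf hv hε, signedVar_eq hf hv hε]
  have h1 := abs_sub_le_toReal_variationPath hf hv hst
  have h2 := neg_abs_le (ε * (f t - f s))
  rw [abs_mul, hε, one_mul] at h2
  linarith

/-- If `g t = ∞`, then `g` stays infinite afterwards and its `toReal` is constantly `0`. Thus
right-continuity holds for every path, not merely almost surely. -/
theorem continuousWithinAt_toReal {g : ℝ≥0 → ℝ≥0∞} (hg : Monotone g) {t : ℝ≥0}
    (hc : ContinuousWithinAt g (Ici t) t) :
    ContinuousWithinAt (fun s => (g s).toReal) (Ici t) t := by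
  by_cases h : g t = ∞
  · refine (continuousWithinAt_const (b := (0 : ℝ))).congr (fun s hs => ?_) (by simp [h])
    rw [top_le_iff.1 (h.symm.trans_le (hg hs)), ENNReal.toReal_top]
  · exact (ENNReal.tendsto_toReal h).comp hc

theorem isRightContinuousPath_signedVar (hf : IsRightContinuousPath f) :
    IsRightContinuousPath (signedVar ε f) := fun t => by
  have h := continuousWithinAt_toReal (monotone_variationPath f)
    (continuousWithinAt_rightReg (dyadicVar f) t)
  exact continuousWithinAt_const.sup
    ((h.add (continuousWithinAt_const.mul ((hf t).sub continuousWithinAt_const))).div_const _)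

end SignedVar

/-- The difference of two nondecreasing functions is locally of bounded variation. -/
theorem locallyBoundedVariationOn_sub {α : Type*} [LinearOrder α] {f g : α → ℝ} {s : Set α}
    (hf : MonotoneOn f s) (hg : MonotoneOn g s) :
    LocallyBoundedVariationOn (fun x => f x - g x) s := fun a b ha hb => by
  -- Each increment of `f - g` is bounded in absolute value by the increment of `f + g`.
  refine ne_top_of_le_ne_top ((hf.add hg).locallyBoundedVariationOn a b ha hb)
    (iSup_le fun p => le_trans (Finset.sum_le_sum fun i _ => ?_) (eVariationOn.sum_le
      (n := p.1) p.2.2.1 p.2.2.2))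
  have hi : (p.2 : ℕ → α) i ≤ (p.2 : ℕ → α) (i + 1) := p.2.2.1 i.le_succ
  have h1 := hf (p.2.2.2 i).1 (p.2.2.2 (i + 1)).1 hi
  have h2 := hg (p.2.2.2 i).1 (p.2.2.2 (i + 1)).1 hi
  rw [edist_dist, edist_dist, Real.dist_eq, Real.dist_eq]
  refine ENNReal.ofReal_le_ofReal (abs_le_abs ?_ ?_) <;> dsimp only [Pi.add_apply] <;> linarith

section Variation

variable {Ω : Type*} {mΩ : MeasurableSpace Ω} {F : Filtration ℝ≥0 mΩ} {μ : Measure Ω}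
  {X : Ω → ℝ≥0 → ℝ}

theorem lintegral_variationPath_ne_top (hv : HasIntegrableVariation μ X) (t : ℝ≥0) :
    ∫⁻ ω, variationPath (X ω) t ∂μ ≠ ∞ :=
  ne_top_of_le_ne_top hv.ne (lintegral_mono fun _ => variationPath_le _ t)

theorem ae_variationPath_ne_top (hX : ∀ t, Measurable fun ω => X ω t)
    (hv : HasIntegrableVariation μ X) : ∀ᵐ ω ∂μ, ∀ t, variationPath (X ω) t ≠ ∞ := by
  have h : ∀ᵐ ω ∂μ, ∀ n : ℕ, variationPath (X ω) n < ∞ := ae_all_iff.2 fun n =>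
    ae_lt_top (measurable_variationPath hX n) (lintegral_variationPath_ne_top hv n)
  filter_upwards [h] with ω hω t
  obtain ⟨n, hn⟩ := exists_nat_ge t
  exact ((monotone_variationPath _ hn).trans_lt (hω n)).ne

theorem isIntegrableIncreasing_signedVar (hrc : ∀ ω, IsRightContinuousPath (X ω))
    (hX : ∀ t, Measurable[F.rightCont t] fun ω => X ω t) (hv : HasIntegrableVariation μ X)
    {ε : ℝ} (hε : |ε| = 1) : IsIntegrableIncreasing F μ fun ω => signedVar ε (X ω) where
  adapted t := by
    have h0 : Measurable[F.rightCont t] fun ω => X ω 0 :=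
      (hX 0).mono (F.rightCont.mono zero_le) le_rfl
    exact measurable_const.max
      (((measurable_rightCont_variationPath hX t).ennreal_toReal.add
        (((hX t).sub h0).const_mul ε)).div_const 2)
  nonneg _ _ := le_max_left _ _
  lintegral_ne_top t := by
    refine ne_top_of_le_ne_top (lintegral_variationPath_ne_top hv t) (lintegral_mono_ae ?_)
    filter_upwards [ae_variationPath_ne_top (fun t => (hX t).mono (F.rightCont.le t) le_rfl) hv]
      with ω hω
    refine ENNReal.ofReal_le_of_le_toReal ?_
    rw [signedVar_eq (hrc ω) hω hε]
    have h1 := abs_sub_zero_le (hrc ω) hω t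
    have h2 := le_abs_self (ε * (X ω t - X ω 0))
    rw [abs_mul, hε, one_mul] at h2
    linarith
  mono := by
    filter_upwards [ae_variationPath_ne_top (fun t => (hX t).mono (F.rightCont.le t) le_rfl) hv]
      with ω hω
    exact monotone_signedVar (hrc ω) hω hε
  rightCont := .of_forall fun ω => isRightContinuousPath_signedVar (hrc ω)

theorem measurable_signedVar {α : Type*} [MeasurableSpace α] {f : α → ℝ≥0 → ℝ}
    (hf : ∀ s, Measurable fun a => f a s) (ε : ℝ) (t : ℝ≥0) :
    Measurable fun a => signedVar ε (f a) t :=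
  measurable_const.max (((measurable_variationPath hf t).ennreal_toReal.add
    (((hf t).sub (hf 0)).const_mul ε)).div_const 2)

end Variation

/-! ### Real-valued martingales for the usual augmentation. -/

section Martingale

variable {Ω : Type*} {mΩ : MeasurableSpace Ω} {F : Filtration ℝ≥0 mΩ} {μ : Measure Ω}

/-- A set of the usual augmentation is almost surely equal to a set of the right-continuous
filtration. -/
theorem exists_ae_eq_of_usualAugmentation {t : ℝ≥0} {G : Set Ω}
    (hG : MeasurableSet[usualAugmentation F μ t] G) :
    ∃ G', MeasurableSet[F.rightCont t] G' ∧ G =ᵐ[μ] G' := by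
  have h : usualAugmentation F μ t ≤ eventuallyMeasurableSpace (F.rightCont t) (ae μ) := by
    refine sup_le le_eventuallyMeasurableSpace (MeasurableSpace.generateFrom_le fun N hN =>
      ⟨∅, @MeasurableSet.empty _ (F.rightCont t), ae_eq_empty.2 hN.2⟩)
  exact h G hG

/-- Null sets do not affect integrals, so testing on sets of `F_{s+}` suffices. -/
theorem martingale_usualAugmentation [IsFiniteMeasure μ] {M : ℝ≥0 → Ω → ℝ}
    (hM : ∀ t, Measurable[F.rightCont t] (M t)) (hi : ∀ t, Integrable (M t) μ)
    (h : ∀ s t, s ≤ t → ∀ G, MeasurableSet[F.rightCont s] G →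
      ∫ ω in G, M s ω ∂μ = ∫ ω in G, M t ω ∂μ) :
    Martingale M (usualAugmentation F μ) μ := by
  have had : ∀ t, StronglyMeasurable[usualAugmentation F μ t] (M t) := fun t =>
    ((hM t).mono (rightCont_le_usualAugmentation t) le_rfl).stronglyMeasurable
  refine ⟨had, fun s t hst => (ae_eq_condExp_of_forall_setIntegral_eq
    ((usualAugmentation F μ).le s) (hi t) (fun _ _ _ => (hi s).integrableOn) (fun G hG _ => ?_)
    (had s).aestronglyMeasurable).symm⟩
  obtain ⟨G', hG', he⟩ := exists_ae_eq_of_usualAugmentation hG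
  rw [setIntegral_congr_set he, setIntegral_congr_set he]
  exact h s t hst G' hG'

theorem martingale_congr_ae {ℱ : Filtration ℝ≥0 mΩ} {M N : ℝ≥0 → Ω → ℝ} (hM : Martingale M ℱ μ)
    (hN : ∀ t, Measurable[ℱ t] (N t)) (h : ∀ t, N t =ᵐ[μ] M t) : Martingale N ℱ μ :=
  ⟨fun t => (hN t).stronglyMeasurable, fun s t hst =>
    (condExp_congr_ae (h t)).trans ((hM.2 s t hst).trans (h s).symm)⟩

variable {y : Ω → ℝ≥0 → ℝ} {A : Ω → ℝ≥0 → ℝ≥0∞}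

theorem IsIntegrableIncreasing.integrable (hy : IsIntegrableIncreasing F μ y) (t : ℝ≥0) :
    Integrable (fun ω => y ω t) μ :=
  (lintegral_ofReal_ne_top_iff_integrable
    ((hy.adapted t).mono (F.rightCont.le t) le_rfl).aestronglyMeasurable
    (.of_forall fun ω => hy.nonneg ω t)).1 (hy.lintegral_ne_top t)

theorem IsIncreasingCompensator.lintegral_ne_top (hA : IsIncreasingCompensator F μ y A)
    (hy : IsIntegrableIncreasing F μ y) (t : ℝ≥0) : ∫⁻ ω, A ω t ∂μ ≠ ∞ := by
  have h := hA.setLIntegral 0 t zero_le univ (@MeasurableSet.univ _ (F.rightCont 0))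
  simp only [Measure.restrict_univ] at h
  rw [lintegral_congr_ae (g := fun _ => 0) hA.zero, lintegral_zero, zero_add] at h
  exact ne_top_of_le_ne_top (hy.lintegral_ne_top t) (h ▸ le_self_add)

theorem IsIncreasingCompensator.integrable (hA : IsIncreasingCompensator F μ y A)
    (hy : IsIntegrableIncreasing F μ y) (t : ℝ≥0) : Integrable (fun ω => (A ω t).toReal) μ :=
  integrable_toReal_of_lintegral_ne_top
    ((hA.adapted t).mono (F.rightCont.le t) le_rfl).aemeasurable (hA.lintegral_ne_top hy t)

theorem IsIncreasingCompensator.martingale [IsFiniteMeasure μ]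
    (hA : IsIncreasingCompensator F μ y A) (hy : IsIntegrableIncreasing F μ y) :
    Martingale (fun t ω => y ω t - (A ω t).toReal) (usualAugmentation F μ) μ := by
  refine martingale_usualAugmentation
    (fun t => (hy.adapted t).sub (hA.adapted t).ennreal_toReal)
    (fun t => (hy.integrable t).sub (hA.integrable hy t)) fun s t hst G hG => ?_
  have hyi : ∀ t, ∫ ω in G, y ω t ∂μ = (∫⁻ ω in G, ENNReal.ofReal (y ω t) ∂μ).toReal := fun t =>
    integral_eq_lintegral_of_nonneg_ae (.of_forall fun ω => hy.nonneg ω t)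
      (hy.integrable t).aestronglyMeasurable.restrict
  have hAi : ∀ t, ∫ ω in G, (A ω t).toReal ∂μ = (∫⁻ ω in G, A ω t ∂μ).toReal := fun t => by
    refine integral_toReal ((hA.adapted t).mono (F.rightCont.le t) le_rfl).aemeasurable ?_
    filter_upwards [ae_restrict_of_ae hA.ne_top] with ω hω using (hω t).lt_top
  have hy' : ∀ t, ∫⁻ ω in G, ENNReal.ofReal (y ω t) ∂μ ≠ ∞ := fun t =>
    ne_top_of_le_ne_top (hy.lintegral_ne_top t) (setLIntegral_le_lintegral _ _)
  have hA' : ∀ t, ∫⁻ ω in G, A ω t ∂μ ≠ ∞ := fun t =>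
    ne_top_of_le_ne_top (hA.lintegral_ne_top hy t) (setLIntegral_le_lintegral _ _)
  rw [integral_sub (hy.integrable s).integrableOn (hA.integrable hy s).integrableOn,
    integral_sub (hy.integrable t).integrableOn (hA.integrable hy t).integrableOn,
    hyi, hyi, hAi, hAi]
  have h := congrArg ENNReal.toReal (hA.setLIntegral s t hst G hG)
  rw [ENNReal.toReal_add (hA' t) (hy' s), ENNReal.toReal_add (hA' s) (hy' t)] at h
  linarith

end Martingale

/-! ### Assembly of the compensator. -/

/-- Processes of integrable variation that depend measurably on a parameter have compensators
that depend measurably on the parameter. -/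
theorem exists_measurable_compensator {E Ω : Type*} [mE : MeasurableSpace E]
    [mΩ : MeasurableSpace Ω] (κ : Kernel E Ω) [IsMarkovKernel κ] (F : Filtration ℝ≥0 mΩ)
    (hF : ∀ t, @MeasurableSpace.CountablyGenerated Ω (F t)) (S : E → Ω → ℝ≥0 → ℝ)
    (hrc : ∀ P ω, IsRightContinuousPath (S P ω))
    (hSm : ∀ t, Measurable fun x : E × Ω => S x.1 x.2 t)
    (hSad : ∀ P t, Measurable[F.rightCont t] fun ω => S P ω t)
    (hSvar : ∀ P, HasIntegrableVariation (κ P) (S P)) :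
    ∃ A : E → Ω → ℝ≥0 → ℝ,
      (Measurable fun x : E × Ω × ℝ≥0 => A x.1 x.2.1 x.2.2) ∧
      ∀ P, Martingale (fun t ω => S P ω t - S P ω 0 - A P ω t) (usualAugmentation F (κ P)) (κ P) ∧
        (∀ ω, IsRightContinuousPath (A P ω)) ∧
        (∀ t, Measurable[F.rightCont t] fun ω => A P ω t) ∧
        IsAugPredictable F (κ P) (A P) ∧
        ∀ᵐ ω ∂(κ P), LocallyBoundedVariationOn (A P ω) univ := by
  have key : ∀ ε : ℝ, |ε| = 1 → _ := fun ε hε => exists_compensator_of_integrable κ F hF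
    (y := fun P ω => signedVar ε (S P ω)) (measurable_signedVar hSm ε) fun P =>
      isIntegrableIncreasing_signedVar (hrc P) (hSad P) (hSvar P) hε
  obtain ⟨B, hBm, hB⟩ := key 1 (by simp)
  obtain ⟨C, hCm, hC⟩ := key (-1) (by simp)
  have hrcA : ∀ P ω, IsRightContinuousPath fun t => (B P ω t).toReal - (C P ω t).toReal :=
    fun P ω t => (continuousWithinAt_toReal ((hB P).mono ω) ((hB P).rightCont ω t)).sub
      (continuousWithinAt_toReal ((hC P).mono ω) ((hC P).rightCont ω t))
  have had : ∀ P t, Measurable[F.rightCont t] fun ω => (B P ω t).toReal - (C P ω t).toReal :=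
    fun P t => ((hB P).adapted t).ennreal_toReal.sub ((hC P).adapted t).ennreal_toReal
  refine ⟨fun P ω t => (B P ω t).toReal - (C P ω t).toReal, ?_, fun P =>
    ⟨?_, hrcA P, had P, ?_, ?_⟩⟩
  · have h := measurable_of_rightContinuous
      (f := fun (x : E × Ω) t => (B x.1 x.2 t).toReal - (C x.1 x.2 t).toReal)
      (fun t => (hBm t).ennreal_toReal.sub (hCm t).ennreal_toReal) fun x => hrcA x.1 x.2
    exact h.comp (measurable_fst.prodMk measurable_snd.fst |>.prodMk measurable_snd.snd)
  -- The difference of the martingales for positive and negative variation is the required process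
  -- almost surely, since the two variations differ by `S - S_0`.
  · have hM := ((hB P).martingale (isIntegrableIncreasing_signedVar (hrc P) (hSad P) (hSvar P)
      (by simp))).sub ((hC P).martingale (isIntegrableIncreasing_signedVar (hrc P) (hSad P)
      (hSvar P) (by simp)))
    refine martingale_congr_ae hM (fun t => ?_) fun t => ?_
    · exact (((hSad P t).sub ((hSad P 0).mono (F.rightCont.mono zero_le) le_rfl)).sub
        (had P t)).mono (rightCont_le_usualAugmentation t) le_rfl
    · filter_upwards [ae_variationPath_ne_top
        (fun t => (hSad P t).mono (F.rightCont.le t) le_rfl) (hSvar P)] with ω hω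
      have h := signedVar_sub (hrc P ω) hω t
      simp only [Pi.sub_apply]
      linarith
  · exact (hB P).predictable.ennreal_toReal.sub (hC P).predictable.ennreal_toReal
  · filter_upwards [(hB P).ne_top, (hC P).ne_top] with ω h1 h2
    exact locallyBoundedVariationOn_sub
      (fun s _ t _ hst => ENNReal.toReal_mono (h1 t) ((hB P).mono ω hst))
      (fun s _ t _ hst => ENNReal.toReal_mono (h2 t) ((hC P).mono ω hst))

end

end MeasurableCompensator

theorem mainTheorem11 {Ω : Type*} [MetricSpace Ω] [TopologicalSpace.SeparableSpace Ω]
    [mΩ : MeasurableSpace Ω] [BorelSpace Ω]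
    (F : Filtration ℝ≥0 mΩ)
    (hF : ∀ t : ℝ≥0, @MeasurableSpace.CountablyGenerated Ω (F t))
    (𝔓 : Set (ProbabilityMeasure Ω))
    (h𝔓 : MeasurableSet[borel (ProbabilityMeasure Ω)] 𝔓)
    (S : 𝔓 → Ω → ℝ≥0 → ℝ)
    (hSrc : ∀ (P : 𝔓) (ω : Ω), MeasurableCompensator.IsRightContinuousPath (S P ω))
    (hSadapted : ∀ t : ℝ≥0,
      Measurable[(MeasurableCompensator.hatFiltration 𝔓 F).rightCont t]
        fun x : 𝔓 × Ω => S x.1 x.2 t)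
    (hSadaptedP : ∀ (P : 𝔓) (t : ℝ≥0), Measurable[F.rightCont t] fun ω => S P ω t)
    (hSvar : ∀ P : 𝔓,
      MeasurableCompensator.HasIntegrableVariation (P.1 : Measure Ω) (S P)) :
    ∃ A : 𝔓 → Ω → ℝ≥0 → ℝ,
      Measurable[MeasurableSpace.prod (borel 𝔓) (MeasurableSpace.prod mΩ (inferInstance : MeasurableSpace ℝ≥0))]
        (fun x : 𝔓 × Ω × ℝ≥0 => A x.1 x.2.1 x.2.2) ∧
      ∀ P : 𝔓,
        Martingale (fun (t : ℝ≥0) (ω : Ω) => S P ω t - S P ω 0 - A P ω t)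
          (MeasurableCompensator.usualAugmentation F (P.1 : Measure Ω)) (P.1 : Measure Ω) ∧
        (∀ ω : Ω, MeasurableCompensator.IsRightContinuousPath (A P ω)) ∧
        (∀ t : ℝ≥0, Measurable[F.rightCont t] fun ω => A P ω t) ∧
        MeasurableCompensator.IsAugPredictable F (P.1 : Measure Ω) (A P) ∧
        ∀ᵐ ω ∂(P.1 : Measure Ω), LocallyBoundedVariationOn (A P ω) Set.univ := by
  -- The inclusion of `𝔓` into the measures on `Ω` is the kernel. Adaptedness to the product
  -- filtration enters as joint measurability in the law and the state at each time.
  let mE : MeasurableSpace 𝔓 := borel 𝔓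
  have hE : BorelSpace 𝔓 := ⟨rfl⟩
  have hm : @Measurable _ _ mE _ fun P : 𝔓 => (P.1 : Measure Ω) :=
    @MeasurableCompensator.measurable_coe_of_continuous Ω 𝔓 _ _ _ _ mE _ _ continuous_subtype_val
  let κ : @ProbabilityTheory.Kernel 𝔓 Ω mE mΩ := @ProbabilityTheory.Kernel.mk 𝔓 Ω mE mΩ _ hm
  have hκ : @ProbabilityTheory.IsMarkovKernel 𝔓 Ω mE mΩ κ := @ProbabilityTheory.IsMarkovKernel.mk
    𝔓 Ω mE mΩ κ fun P => inferInstanceAs (IsProbabilityMeasure (P.1 : Measure Ω))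
  exact @MeasurableCompensator.exists_measurable_compensator 𝔓 Ω mE mΩ κ hκ F hF S hSrc
    (fun t => (hSadapted t).mono ((MeasurableCompensator.hatFiltration 𝔓 F).rightCont.le t) le_rfl)
    hSadaptedP hSvar
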